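/- Let $(X^4,g)$ be a smooth Riemannian manifold, let $\iota: M^3\hookrightarrow X$ be a smooth embedding of a 3-dimensional manifold, let $h=\iota^*g$ be the induced metric, and let $N=\partial_0$ be a smooth unit normal vector field along $\iota$. Let $\bar\nabla,\nabla$ be the Levi-Civita connections of $g,h$. Let $L(Y,Z)=-g(\bar\nabla_Y Z,N)$ be the second fundamental form, $3H=\operatorname{tr}_h L$, $\mathring L=L-Hh$, and $(\mathring L^2)_{ij}=h^{lk}\mathring L_{il}\mathring L_{kj}$. With the curvature convention $\bar R(Y,Z)V=\bar\nabla_Y\bar\nabla_Z V-\bar\nabla_Z\bar\nabla_Y V-\bar\nabla_{[Y,Z]}V$, $\bar R(\partial_a,\partial_b)\partial_c=\bar R_{abc}{}^d\partial_d$, $\overline{\mathrm{Ric}}_{bc}=\bar R_{abc}{}^a$, let $\bar{\mathsf P}=\frac12(\overline{\mathrm{Ric}}-\frac16\overline{\mathrm{scal}}\,g)$ be the Schouten tensor of $g$ and let the Weyl tensor be $\overline W_{abcd}=\bar R_{abcd}+\bar{\mathsf P}_{ac}g_{bd}-\bar{\mathsf P}_{bc}g_{ad}+\bar{\mathsf P}_{bd}g_{ac}-\bar{\mathsf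 P}_{ad}g_{bc}$. On $M$ let $\bar{\mathsf P}_0=\bar{\mathsf P}(\cdot,N)$ (a 1-form) and let $\overline W_0=\overline W(\cdot,\cdot,\cdot,N)$ (a 3-tensor), with components $\overline W_{ijk0}$. Scalar products, norms, index positions, the Hessian, the divergence $\delta$ ($\delta(\omega)=\nabla^i\omega_i$ on 1-forms, $\delta(b)_j=\nabla^i b_{ij}$ on symmetric 2-tensors) and $\Delta=\delta d$ on $M$ refer to $h$ and $\nabla$. Then $$\Delta(|\mathring L|^2)-2\delta\delta(\mathring L^2)=-2(\mathring L,\mathrm{Hess}(H))-2(\mathring L,\nabla\bar{\mathsf P}_0)-|\delta(\mathring L)|^2-2\mathring L^{ij}\nabla^k\overline W_{kij0}+|\overline W_0|^2 .$$ Moreover both sides are total divergences, that is, divergences of smooth 1-forms on $M$. The left-hand side is $\delta(\gamma)$ for $\gamma=d|\mathring L|^2-2\delta(\mathring L^2)$. On the right-hand side, the sum of the first three terms is $\delta(\alpha)$ with $\alpha_i=-\mathring L_i{}^j\,\delta(\mathring L)_j$, and the sum of the last two terms is $\delta(\beta)$ with $\beta_k=-2\mathring L^{ij}\overline W_{kij0}$.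 -/

import Mathlib

open scoped Manifold ContDiff

noncomputable section

namespace HypersurfaceGeometry

/-- The coordinate space of dimension `n`. -/
abbrev Coord (n : ℕ) := EuclideanSpace ℝ (Fin n)

/-! ### Tensor calculus in coordinates

Tensor fields with lower indices on a coordinate domain are given by their components. The metric
`G` has components `G x i j`, and `(G x)⁻¹ i j` are the components with upper indices. -/

section Coordinates

variable {n : ℕ}

/-- The partial derivative `∂ᵢ f`. -/
def pd (i : Fin n) (f : Coord n → ℝ) (x : Coord n) : ℝ :=
  fderiv ℝ f x (EuclideanSpace.single i 1)

/-- The Christoffel symbol `Γᵏᵢⱼ` of the Levi-Civita connection of `G`. -/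
def christoffel (G : Coord n → Matrix (Fin n) (Fin n) ℝ) (x : Coord n) (k i j : Fin n) : ℝ :=
  (1 / 2) * ∑ l, (G x)⁻¹ k l *
    (pd i (fun y => G y j l) x + pd j (fun y => G y i l) x - pd l (fun y => G y i j) x)

/-- The components `∇ᵢ θⱼ` of the covariant derivative of a 1-form. -/
def cov1 (G : Coord n → Matrix (Fin n) (Fin n) ℝ) (θ : Coord n → Fin n → ℝ)
    (x : Coord n) (i j : Fin n) : ℝ :=
  pd i (fun y => θ y j) x - ∑ m, christoffel G x m i j * θ x m

/-- The components `∇ᵢ bⱼₖ` of the covariant derivative of a covariant 2-tensor. -/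
def cov2 (G : Coord n → Matrix (Fin n) (Fin n) ℝ) (b : Coord n → Fin n → Fin n → ℝ)
    (x : Coord n) (i j k : Fin n) : ℝ :=
  pd i (fun y => b y j k) x - ∑ m, christoffel G x m i j * b x m k
    - ∑ m, christoffel G x m i k * b x j m

/-- The components `∇ᵢ tⱼₖₗ` of the covariant derivative of a covariant 3-tensor. -/
def cov3 (G : Coord n → Matrix (Fin n) (Fin n) ℝ) (t : Coord n → Fin n → Fin n → Fin n → ℝ)
    (x : Coord n) (i j k l : Fin n) : ℝ :=
  pd i (fun y => t y j k l) x - ∑ m, christoffel G x m i j * t x m k l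
    - ∑ m, christoffel G x m i k * t x j m l - ∑ m, christoffel G x m i l * t x j k m

/-- The differential of a function. -/
def dform (u : Coord n → ℝ) (x : Coord n) (i : Fin n) : ℝ := pd i u x

/-- The Hessian `∇ᵢ ∇ⱼ u` of a function. -/
def hess (G : Coord n → Matrix (Fin n) (Fin n) ℝ) (u : Coord n → ℝ) :
    Coord n → Fin n → Fin n → ℝ :=
  cov1 G (dform u)

/-- The divergence `∇ⁱ θᵢ` of a 1-form. -/
def div1 (G : Coord n → Matrix (Fin n) (Fin n) ℝ) (θ : Coord n → Fin n → ℝ) (x : Coord n) : ℝ :=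
  ∑ i, ∑ j, (G x)⁻¹ i j * cov1 G θ x i j

/-- The divergence `∇ⁱ bᵢⱼ` of a covariant 2-tensor. -/
def div2 (G : Coord n → Matrix (Fin n) (Fin n) ℝ) (b : Coord n → Fin n → Fin n → ℝ)
    (x : Coord n) (j : Fin n) : ℝ :=
  ∑ i, ∑ k, (G x)⁻¹ i k * cov2 G b x i k j

/-- The divergence `∇ᵏ tₖᵢⱼ` of a covariant 3-tensor, in the first slot. -/
def div3 (G : Coord n → Matrix (Fin n) (Fin n) ℝ) (t : Coord n → Fin n → Fin n → Fin n → ℝ)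
    (x : Coord n) (i j : Fin n) : ℝ :=
  ∑ k, ∑ l, (G x)⁻¹ k l * cov3 G t x k l i j

/-- The (non-positive) Laplacian `Δ u = δ (du)` of a function. -/
def laplacian (G : Coord n → Matrix (Fin n) (Fin n) ℝ) (u : Coord n → ℝ) : Coord n → ℝ :=
  div1 G (dform u)

/-- The scalar product `Gⁱᵏ θᵢ ηₖ` of 1-forms. -/
def inner1 (G : Coord n → Matrix (Fin n) (Fin n) ℝ) (θ η : Coord n → Fin n → ℝ)
    (x : Coord n) : ℝ :=
  ∑ i, ∑ k, (G x)⁻¹ i k * θ x i * η x k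

/-- The scalar product `aᵢⱼ bⁱʲ` of covariant 2-tensors. -/
def inner2 (G : Coord n → Matrix (Fin n) (Fin n) ℝ) (a b : Coord n → Fin n → Fin n → ℝ)
    (x : Coord n) : ℝ :=
  ∑ i, ∑ j, ∑ k, ∑ l, (G x)⁻¹ i k * (G x)⁻¹ j l * a x i j * b x k l

/-- The scalar product `sᵢⱼₖ tⁱʲᵏ` of covariant 3-tensors. -/
def inner3 (G : Coord n → Matrix (Fin n) (Fin n) ℝ)
    (s t : Coord n → Fin n → Fin n → Fin n → ℝ) (x : Coord n) : ℝ :=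
  ∑ i, ∑ j, ∑ k, ∑ i', ∑ j', ∑ k',
    (G x)⁻¹ i i' * (G x)⁻¹ j j' * (G x)⁻¹ k k' * s x i j k * t x i' j' k'

/-- The components `Rᵢⱼₖˡ` of the curvature tensor, where `R(∂ᵢ, ∂ⱼ) ∂ₖ = Rᵢⱼₖˡ ∂ₗ` and
`R(U, V) Z = ∇_U ∇_V Z - ∇_V ∇_U Z - ∇_[U, V] Z`. -/
def riemannUp (G : Coord n → Matrix (Fin n) (Fin n) ℝ) (x : Coord n) (i j k l : Fin n) : ℝ :=
  pd i (fun y => christoffel G y l j k) x - pd j (fun y => christoffel G y l i k) x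
    + ∑ m, christoffel G x l i m * christoffel G x m j k
    - ∑ m, christoffel G x l j m * christoffel G x m i k

/-- The components `Rᵢⱼₖₗ = Rᵢⱼₖᵐ Gₘₗ`. -/
def riemann (G : Coord n → Matrix (Fin n) (Fin n) ℝ) (x : Coord n) (i j k l : Fin n) : ℝ :=
  ∑ m, riemannUp G x i j k m * G x m l

/-- The Ricci tensor `Ricⱼₖ = Rᵢⱼₖⁱ` (positive on round spheres). -/
def ricci (G : Coord n → Matrix (Fin n) (Fin n) ℝ) (x : Coord n) (j k : Fin n) : ℝ :=
  ∑ i, riemannUp G x i j k i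

/-- The scalar curvature. -/
def scal (G : Coord n → Matrix (Fin n) (Fin n) ℝ) (x : Coord n) : ℝ :=
  ∑ i, ∑ j, (G x)⁻¹ i j * ricci G x i j

/-- `J`, defined by `2 (n - 1) J = scal`. -/
def schoutenTrace (G : Coord n → Matrix (Fin n) (Fin n) ℝ) (x : Coord n) : ℝ :=
  scal G x / (2 * ((n : ℝ) - 1))

/-- The Schouten tensor `P`, defined by `(n - 2) P = Ric - J G`. -/
def schouten (G : Coord n → Matrix (Fin n) (Fin n) ℝ) (x : Coord n) (i j : Fin n) : ℝ :=
  (ricci G x i j - schoutenTrace G x * G x i j) / ((n : ℝ) - 2)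

/-- The Weyl tensor with four lower indices, from the decomposition
`Rᵢⱼₖₗ = Wᵢⱼₖₗ - Pᵢₖ Gⱼₗ + Pⱼₖ Gᵢₗ - Pⱼₗ Gᵢₖ + Pᵢₗ Gⱼₖ`. -/
def weyl (G : Coord n → Matrix (Fin n) (Fin n) ℝ) (x : Coord n) (i j k l : Fin n) : ℝ :=
  riemann G x i j k l + schouten G x i k * G x j l - schouten G x j k * G x i l
    + schouten G x j l * G x i k - schouten G x i l * G x j k

end Coordinates

/-! ### Hypersurfaces of dimension 3 in coordinates -/

/-- The coordinate expressions of a hypersurface with a normal vector field: the components of the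
ambient metric, the parametrization, and the components of the normal vector field. -/
structure LocalHypersurface where
  /-- components of the ambient metric -/
  ambient : Coord 4 → Matrix (Fin 4) (Fin 4) ℝ
  /-- the hypersurface as a map between coordinate spaces -/
  param : Coord 3 → Coord 4
  /-- components of the normal vector `N = ∂₀` at `param x` -/
  normal : Coord 3 → Coord 4

namespace LocalHypersurface

variable (S : LocalHypersurface)

/-- The components `∂ᵢ Fᵃ` of the differential of the parametrization. -/
def tangent (x : Coord 3) (i : Fin 3) (a : Fin 4) : ℝ := pd i (fun y => S.param y a) x

/-- The induced metric `h`. -/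
def h (x : Coord 3) : Matrix (Fin 3) (Fin 3) ℝ :=
  fun i j => ∑ a, ∑ b, S.ambient (S.param x) a b * S.tangent x i a * S.tangent x j b

/-- The components of the ambient covariant derivative `∇̄_{∂ᵢ} ∂ⱼ` along the hypersurface. -/
def ambientCov (x : Coord 3) (i j : Fin 3) (a : Fin 4) : ℝ :=
  pd i (fun y => S.tangent y j a) x
    + ∑ c, ∑ d, christoffel S.ambient (S.param x) a c d * S.tangent x i c * S.tangent x j d

/-- The second fundamental form `Lᵢⱼ = - g(∇̄_{∂ᵢ} ∂ⱼ, N)`. -/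
def L (x : Coord 3) (i j : Fin 3) : ℝ :=
  - ∑ a, ∑ b, S.ambient (S.param x) a b * S.ambientCov x i j a * S.normal x b

/-- The mean curvature, `3 H = tr_h L`. -/
def H (x : Coord 3) : ℝ := (∑ i, ∑ j, (S.h x)⁻¹ i j * S.L x i j) / 3

/-- The trace-free part `L̊ = L - H h` of the second fundamental form. -/
def Lo (x : Coord 3) (i j : Fin 3) : ℝ := S.L x i j - S.H x * S.h x i j

/-- `(L̊²)ᵢⱼ = hˡᵏ L̊ᵢₗ L̊ₖⱼ`. -/
def LoSq (x : Coord 3) (i j : Fin 3) : ℝ := ∑ l, ∑ k, (S.h x)⁻¹ l k * S.Lo x i l * S.Lo x k j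

/-- `|L̊|²`. -/
def normSqLo : Coord 3 → ℝ := inner2 S.h S.Lo S.Lo

/-- The 1-form `P̄₀ = P̄(·, N)` on the hypersurface, for the ambient Schouten tensor `P̄`. -/
def P0 (x : Coord 3) (i : Fin 3) : ℝ :=
  ∑ a, ∑ b, schouten S.ambient (S.param x) a b * S.tangent x i a * S.normal x b

/-- The 3-tensor `(W̄₀)ᵢⱼₖ = W̄ᵢⱼₖ₀` on the hypersurface, for the ambient Weyl tensor `W̄`. -/
def W0 (x : Coord 3) (i j k : Fin 3) : ℝ :=
  ∑ a, ∑ b, ∑ c, ∑ d, weyl S.ambient (S.param x) a b c d *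
    S.tangent x i a * S.tangent x j b * S.tangent x k c * S.normal x d

/-- `Δ |L̊|² - 2 δδ(L̊²)`. -/
def lhs (x : Coord 3) : ℝ :=
  laplacian S.h S.normSqLo x - 2 * div1 S.h (div2 S.h S.LoSq) x

/-- `- 2 (L̊, Hess H) - 2 (L̊, ∇ P̄₀) - |δ L̊|²`. -/
def rhs₁ (x : Coord 3) : ℝ :=
  - 2 * inner2 S.h S.Lo (hess S.h S.H) x - 2 * inner2 S.h S.Lo (cov1 S.h S.P0) x
    - inner1 S.h (div2 S.h S.Lo) (div2 S.h S.Lo) x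

/-- `- 2 L̊ⁱʲ ∇ᵏ W̄ₖᵢⱼ₀ + |W̄₀|²`. -/
def rhs₂ (x : Coord 3) : ℝ :=
  - 2 * inner2 S.h S.Lo (div3 S.h S.W0) x + inner3 S.h S.W0 S.W0 x

/-- The 1-form `d|L̊|² - 2 δ(L̊²)`. -/
def formLhs (x : Coord 3) (i : Fin 3) : ℝ := dform S.normSqLo x i - 2 * div2 S.h S.LoSq x i

/-- The 1-form `- L̊ᵢʲ δ(L̊)ⱼ`. -/
def formRhs₁ (x : Coord 3) (i : Fin 3) : ℝ :=
  - ∑ j, ∑ k, (S.h x)⁻¹ j k * S.Lo x i j * div2 S.h S.Lo x k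

/-- The 1-form `k ↦ - 2 L̊ⁱʲ W̄ₖᵢⱼ₀`. -/
def formRhs₂ (x : Coord 3) (k : Fin 3) : ℝ :=
  - 2 * ∑ i, ∑ j, ∑ i', ∑ j', (S.h x)⁻¹ i i' * (S.h x)⁻¹ j j' * S.Lo x i' j' * S.W0 x k i j

end LocalHypersurface

/-! ### Manifolds -/

section Manifolds

/-- The components of a Riemannian metric in a chart `e'`. -/
def metricInChart {n : ℕ} {X : Type*} [TopologicalSpace X] [ChartedSpace (Coord n) X]
    [IsManifold 𝓘(ℝ, Coord n) ∞ X]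
    (g : Bundle.ContMDiffRiemannianMetric 𝓘(ℝ, Coord n) ∞ (Coord n)
      (fun q : X => TangentSpace 𝓘(ℝ, Coord n) q))
    (e' : OpenPartialHomeomorph X (Coord n)) (y : Coord n) : Matrix (Fin n) (Fin n) ℝ :=
  fun a b => g.inner (e'.symm y)
    (mfderiv 𝓘(ℝ, Coord n) 𝓘(ℝ, Coord n) e'.symm y (EuclideanSpace.single a (1 : ℝ) : Coord n))
    (mfderiv 𝓘(ℝ, Coord n) 𝓘(ℝ, Coord n) e'.symm y (EuclideanSpace.single b (1 : ℝ) : Coord n))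

/-- Smooth 1-forms, i.e. smooth sections of the cotangent bundle. -/
abbrev OneForm (n : ℕ) (M : Type*) [TopologicalSpace M] [ChartedSpace (Coord n) M]
    [IsManifold 𝓘(ℝ, Coord n) ∞ M] :=
  ContMDiffSection 𝓘(ℝ, Coord n) (Coord n →L[ℝ] ℝ) ∞
    (fun p : M => TangentSpace 𝓘(ℝ, Coord n) p →L[ℝ] Bundle.Trivial M ℝ p)

/-- The components of a 1-form in a chart `e`. -/
def OneForm.inChart {n : ℕ} {M : Type*} [TopologicalSpace M] [ChartedSpace (Coord n) M]
    [IsManifold 𝓘(ℝ, Coord n) ∞ M] (θ : OneForm n M)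
    (e : OpenPartialHomeomorph M (Coord n)) (x : Coord n) (i : Fin n) : ℝ :=
  θ (e.symm x)
    (mfderiv 𝓘(ℝ, Coord n) 𝓘(ℝ, Coord n) e.symm x (EuclideanSpace.single i (1 : ℝ) : Coord n))

variable {X : Type*} [TopologicalSpace X] [ChartedSpace (Coord 4) X]
  [IsManifold 𝓘(ℝ, Coord 4) ∞ X]
  {M : Type*} [TopologicalSpace M] [ChartedSpace (Coord 3) M] [IsManifold 𝓘(ℝ, Coord 3) ∞ M]

/-- `N` is a smooth unit normal vector field of `X` along the map `ι : M → X`. -/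
structure IsUnitNormalField
    (g : Bundle.ContMDiffRiemannianMetric 𝓘(ℝ, Coord 4) ∞ (Coord 4)
      (fun q : X => TangentSpace 𝓘(ℝ, Coord 4) q))
    (ι : M → X) (N : (p : M) → TangentSpace 𝓘(ℝ, Coord 4) (ι p)) : Prop where
  contMDiff : ContMDiff 𝓘(ℝ, Coord 3) (𝓘(ℝ, Coord 4).tangent) ∞
    (fun p => (⟨ι p, N p⟩ : TangentBundle 𝓘(ℝ, Coord 4) X))
  unit : ∀ p, g.inner (ι p) (N p) (N p) = 1
  normal : ∀ p (v : TangentSpace 𝓘(ℝ, Coord 3) p),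
    g.inner (ι p) (mfderiv 𝓘(ℝ, Coord 3) 𝓘(ℝ, Coord 4) ι p v) (N p) = 0

/-- The coordinate expressions of `g`, `ι`, `N` in a chart `e` of `M` and a chart `e'` of `X`. -/
def localHypersurface
    (g : Bundle.ContMDiffRiemannianMetric 𝓘(ℝ, Coord 4) ∞ (Coord 4)
      (fun q : X => TangentSpace 𝓘(ℝ, Coord 4) q))
    (ι : M → X) (N : (p : M) → TangentSpace 𝓘(ℝ, Coord 4) (ι p))
    (e : OpenPartialHomeomorph M (Coord 3)) (e' : OpenPartialHomeomorph X (Coord 4)) :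
    LocalHypersurface where
  ambient := metricInChart g e'
  param x := e' (ι (e.symm x))
  normal x := mfderiv 𝓘(ℝ, Coord 4) 𝓘(ℝ, Coord 4) e' (ι (e.symm x)) (N (e.symm x))

/-- The coordinates of the points of `M` that lie in the chart `e` and whose image lies in the
chart `e'`. -/
def commonDomain (ι : M → X) (e : OpenPartialHomeomorph M (Coord 3))
    (e' : OpenPartialHomeomorph X (Coord 4)) : Set (Coord 3) :=
  {x | x ∈ e.target ∧ ι (e.symm x) ∈ e'.source}

end Manifolds

end HypersurfaceGeometry

end

/-! The identity is the divergence of a pointwise identity γ = α + β between 1-forms. Write b for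
the trace-free second fundamental form and σ = dH + P̄₀. In the Codazzi equation, split L = b + Hh
and decompose the ambient curvature into its Weyl and Schouten parts. Since N is orthogonal to M,
only the P̄₀ part of the Schouten tensor survives, and W_ijk = ∇_j b_ik - ∇_i b_jk + σ_j h_ik - σ_i
h_jk, where W = W̄₀. The trace of W over i, k vanishes, because P̄₀ is half of the normal Ricci
form. Hence δb = (3 - 1)σ = 2σ. `IsCodazziOn` records exactly these facts, and everything analytic
is deduced from them.

Contracting W_kij with b^ij kills the h_ij term, as b is trace-free. The rest compares with d|b|²
and with δ(b²)_k = (δb)^l b_lk + b^il ∇_i b_lk, and gives γ = α + β (`IsCodazziOn.form_eq`). The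
divergence of α is -|δb|² - b^ij ∇_i (δb)_j, which is the first group of terms because δb = 2(dH +
P̄₀) (`IsCodazziOn.div1_contraction`). The divergence of β contains -2 W_kij ∇^k b^ij. This equals
|W|², because W is skew in its first two slots and orthogonal to the trace terms
(`sum_pair2_antisymmetrization`, used in `IsCodazziOn.div1_W_contraction`).

The geometric input is `IsUnitNormalOn.codazzi`, proved with matrices: the ambient connection is
pulled back to the parameter domain, and the Gauss formula separates tangential and normal parts. To
obtain global forms, the components of γ, α, β must transform correctly under changes of both charts
(`LocalHypersurface.IsTransition`). For γ and α this is naturality of the Levi-Civita connection and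
of the second fundamental form. For β it follows by subtraction, so no transformation law for the
Weyl tensor is needed. `exists_oneForm` then glues the components. -/

noncomputable section

namespace HypersurfaceGeometry

/-! ### Partial derivatives of functions on coordinate space. -/

section PartialDerivatives

variable {n m : ℕ} {f g : Coord n → ℝ} {x : Coord n}

theorem differentiableAt_of_smooth {E F : Type*} [NormedAddCommGroup E] [NormedSpace ℝ E]
    [NormedAddCommGroup F] [NormedSpace ℝ F] {f : E → F} {x : E} (hf : ContDiffAt ℝ ∞ f x) :
    DifferentiableAt ℝ f x :=
  hf.differentiableAt (by simp)

theorem contDiffAt_pd (i : Fin n) (hf : ContDiffAt ℝ ∞ f x) : ContDiffAt ℝ ∞ (pd i f) x :=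
  (hf.fderiv_right (m := ∞) (by simp)).clm_apply contDiffAt_const

theorem pd_congr (i : Fin n) (h : f =ᶠ[nhds x] g) : pd i f x = pd i g x := by
  rw [pd, pd, h.fderiv_eq]

theorem pd_const (i : Fin n) (c : ℝ) : pd i (fun _ => c) x = 0 := by
  simp [pd]

theorem pd_add (i : Fin n) (hf : DifferentiableAt ℝ f x) (hg : DifferentiableAt ℝ g x) :
    pd i (fun y => f y + g y) x = pd i f x + pd i g x := by
  simp [pd, fderiv_fun_add hf hg]

theorem pd_sub (i : Fin n) (hf : DifferentiableAt ℝ f x) (hg : DifferentiableAt ℝ g x) :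
    pd i (fun y => f y - g y) x = pd i f x - pd i g x := by
  simp [pd, fderiv_fun_sub hf hg]

theorem pd_neg (i : Fin n) : pd i (fun y => - f y) x = - pd i f x := by
  simp [pd, fderiv_fun_neg]

theorem pd_mul (i : Fin n) (hf : DifferentiableAt ℝ f x) (hg : DifferentiableAt ℝ g x) :
    pd i (fun y => f y * g y) x = pd i f x * g x + f x * pd i g x := by
  simp [pd, fderiv_fun_mul hf hg]; ring

theorem pd_const_mul (i : Fin n) (c : ℝ) (hf : DifferentiableAt ℝ f x) :
    pd i (fun y => c * f y) x = c * pd i f x := by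
  rw [pd_mul i (differentiableAt_const c) hf, pd_const]; ring

theorem pd_sum (i : Fin n) {ι : Type*} (s : Finset ι) {f : ι → Coord n → ℝ}
    (hf : ∀ a ∈ s, DifferentiableAt ℝ (f a) x) :
    pd i (fun y => ∑ a ∈ s, f a y) x = ∑ a ∈ s, pd i (f a) x := by
  simp [pd, fderiv_fun_sum hf]

theorem pd_comm (i j : Fin n) (hf : ContDiffAt ℝ ∞ f x) :
    pd i (pd j f) x = pd j (pd i f) x := by
  have hd : DifferentiableAt ℝ (fderiv ℝ f) x :=
    differentiableAt_of_smooth (hf.fderiv_right (m := ∞) (by simp))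
  have key : ∀ i j : Fin n, pd i (pd j f) x =
      fderiv ℝ (fderiv ℝ f) x (EuclideanSpace.single i 1) (EuclideanSpace.single j 1) := by
    intro i j
    change fderiv ℝ (fun y => fderiv ℝ f y (EuclideanSpace.single j 1)) x _ = _
    rw [fderiv_clm_apply hd (differentiableAt_const _)]
    simp
  rw [key, key]
  refine (hf.isSymmSndFDerivAt ?_).eq _ _
  simp only [minSmoothness_of_isRCLikeNormedField]
  exact WithTop.coe_le_coe.2 le_top

theorem pd_eq_of_hasFDerivAt (i : Fin n) {f' : Coord n →L[ℝ] ℝ} (h : HasFDerivAt f f' x) :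
    pd i f x = f' (EuclideanSpace.single i 1) := by
  rw [pd, h.fderiv]

theorem pd_comp (i : Fin m) {f : Coord n → ℝ} {F : Coord m → Coord n} {x : Coord m}
    (hf : DifferentiableAt ℝ f (F x)) (hF : DifferentiableAt ℝ F x) :
    pd i (fun y => f (F y)) x = ∑ c, pd c f (F x) * pd i (fun y => F y c) x := by
  have h1 := hf.hasFDerivAt.comp x hF.hasFDerivAt
  have h2 : ∀ c, pd i (fun y => F y c) x = fderiv ℝ F x (EuclideanSpace.single i 1) c := by
    intro c
    have := (EuclideanSpace.proj (𝕜 := ℝ) c).hasFDerivAt.comp x hF.hasFDerivAt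
    exact pd_eq_of_hasFDerivAt i this
  rw [show pd i (fun y => f (F y)) x = _ from pd_eq_of_hasFDerivAt i h1]
  have h3 : ∀ v, fderiv ℝ f (F x) v = ∑ c, fderiv ℝ f (F x) (EuclideanSpace.single c 1) * v c := by
    intro v
    conv_lhs => rw [← (EuclideanSpace.basisFun (Fin n) ℝ).sum_repr v]
    simp only [map_sum, map_smul, smul_eq_mul, EuclideanSpace.basisFun_repr,
      EuclideanSpace.basisFun_apply, mul_comm]
  simp only [h2]
  rw [ContinuousLinearMap.comp_apply, h3]
  rfl

theorem contDiffAt_coord {F : Coord m → Coord n} {x : Coord m} (hF : ContDiffAt ℝ ∞ F x)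
    (c : Fin n) : ContDiffAt ℝ ∞ (fun y => F y c) x :=
  (EuclideanSpace.proj (𝕜 := ℝ) c).contDiff.contDiffAt.comp x hF

end PartialDerivatives

/-! ### Entrywise differentiation of matrix-valued functions. -/

section MatrixCalculus

open Matrix

variable {n m : ℕ} {ι κ τ : Type*} {x : Coord n}

/-- The entrywise partial derivative of a matrix-valued function. -/
def dmat (i : Fin n) (A : Coord n → Matrix ι κ ℝ) (x : Coord n) : Matrix ι κ ℝ :=
  Matrix.of fun a b => pd i (fun y => A y a b) x

/-- Entrywise smoothness of a matrix-valued function at a point. -/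
def SmoothMatAt (A : Coord n → Matrix ι κ ℝ) (x : Coord n) : Prop :=
  ∀ a b, ContDiffAt ℝ ∞ (fun y => A y a b) x

variable {A B : Coord n → Matrix ι κ ℝ}

@[simp] theorem dmat_apply (i : Fin n) (A : Coord n → Matrix ι κ ℝ) (x : Coord n) (a : ι) (b : κ) :
    dmat i A x a b = pd i (fun y => A y a b) x := rfl

theorem SmoothMatAt.diff (h : SmoothMatAt A x) (a : ι) (b : κ) :
    DifferentiableAt ℝ (fun y => A y a b) x :=
  differentiableAt_of_smooth (h a b)

theorem SmoothMatAt.congr (h : SmoothMatAt A x) (hAB : B =ᶠ[nhds x] A) : SmoothMatAt B x :=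
  fun a b => (h a b).congr_of_eventuallyEq (hAB.fun_comp (fun M => M a b))

theorem SmoothMatAt.dmat (i : Fin n) (h : SmoothMatAt A x) : SmoothMatAt (dmat i A) x :=
  fun a b => contDiffAt_pd i (h a b)

theorem SmoothMatAt.transpose (h : SmoothMatAt A x) : SmoothMatAt (fun y => (A y)ᵀ) x :=
  fun a b => h b a

theorem SmoothMatAt.add (hA : SmoothMatAt A x) (hB : SmoothMatAt B x) :
    SmoothMatAt (fun y => A y + B y) x :=
  fun a b => (hA a b).add (hB a b)

theorem SmoothMatAt.sub (hA : SmoothMatAt A x) (hB : SmoothMatAt B x) :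
    SmoothMatAt (fun y => A y - B y) x :=
  fun a b => (hA a b).sub (hB a b)

theorem SmoothMatAt.neg (hA : SmoothMatAt A x) : SmoothMatAt (fun y => - A y) x :=
  fun a b => (hA a b).neg

theorem SmoothMatAt.smul {f : Coord n → ℝ} (hf : ContDiffAt ℝ ∞ f x) (hA : SmoothMatAt A x) :
    SmoothMatAt (fun y => f y • A y) x :=
  fun a b => hf.mul (hA a b)

theorem SmoothMatAt.mul [Fintype κ] {B : Coord n → Matrix κ τ ℝ} (hA : SmoothMatAt A x)
    (hB : SmoothMatAt B x) : SmoothMatAt (fun y => A y * B y) x := by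
  intro a b
  simp only [Matrix.mul_apply]
  exact ContDiffAt.sum fun c _ => (hA a c).mul (hB c b)

theorem SmoothMatAt.sum {s : Finset τ} {A : τ → Coord n → Matrix ι κ ℝ}
    (hA : ∀ c ∈ s, SmoothMatAt (A c) x) : SmoothMatAt (fun y => ∑ c ∈ s, A c y) x := by
  intro a b
  simp only [Matrix.sum_apply]
  exact ContDiffAt.sum fun c hc => hA c hc a b

theorem SmoothMatAt.det [Fintype ι] [DecidableEq ι] {A : Coord n → Matrix ι ι ℝ}
    (hA : SmoothMatAt A x) : ContDiffAt ℝ ∞ (fun y => (A y).det) x := by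
  simp only [Matrix.det_apply']
  exact ContDiffAt.sum fun σ _ => contDiffAt_const.mul (contDiffAt_prod fun c _ => hA _ _)

/-- Cramer's rule: an entry of the adjugate is the determinant of the matrix with one row replaced
by a constant basis vector. -/
theorem SmoothMatAt.inv [Fintype ι] [DecidableEq ι] {A : Coord n → Matrix ι ι ℝ}
    (hA : SmoothMatAt A x) (h0 : (A x).det ≠ 0) : SmoothMatAt (fun y => (A y)⁻¹) x := by
  intro a b
  simp only [Matrix.inv_def, Ring.inverse_eq_inv', Matrix.smul_apply, smul_eq_mul,
    Matrix.adjugate_apply]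
  refine (hA.det.inv h0).mul (SmoothMatAt.det ?_)
  intro c d
  by_cases h : c = b
  · subst h; simpa using contDiffAt_const
  · simpa [Matrix.updateRow_ne h] using hA c d

theorem SmoothMatAt.trace [Fintype ι] {A : Coord n → Matrix ι ι ℝ}
    (hA : SmoothMatAt A x) : ContDiffAt ℝ ∞ (fun y => (A y).trace) x :=
  ContDiffAt.sum fun c _ => hA c c

theorem SmoothMatAt.comp {F : Coord m → Coord n} {y : Coord m} (hA : SmoothMatAt A (F y))
    (hF : ContDiffAt ℝ ∞ F y) : SmoothMatAt (fun z => A (F z)) y :=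
  fun a b => (hA a b).comp y hF

theorem dmat_congr (i : Fin n) (h : A =ᶠ[nhds x] B) : dmat i A x = dmat i B x := by
  ext a b
  exact pd_congr i (h.fun_comp (fun M => M a b))

theorem dmat_const (i : Fin n) (C : Matrix ι κ ℝ) : dmat i (fun _ => C) x = 0 := by
  ext a b; simp [pd_const]

theorem dmat_transpose (i : Fin n) (A : Coord n → Matrix ι κ ℝ) (x : Coord n) :
    dmat i (fun y => (A y)ᵀ) x = (dmat i A x)ᵀ := rfl

theorem dmat_add (i : Fin n) (hA : SmoothMatAt A x) (hB : SmoothMatAt B x) :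
    dmat i (fun y => A y + B y) x = dmat i A x + dmat i B x := by
  ext a b; exact pd_add i (hA.diff a b) (hB.diff a b)

theorem dmat_sub (i : Fin n) (hA : SmoothMatAt A x) (hB : SmoothMatAt B x) :
    dmat i (fun y => A y - B y) x = dmat i A x - dmat i B x := by
  ext a b; exact pd_sub i (hA.diff a b) (hB.diff a b)

theorem dmat_neg (i : Fin n) (A : Coord n → Matrix ι κ ℝ) :
    dmat i (fun y => - A y) x = - dmat i A x := by
  ext a b; exact pd_neg i

theorem dmat_smul (i : Fin n) {f : Coord n → ℝ} (hf : ContDiffAt ℝ ∞ f x) (hA : SmoothMatAt A x) :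
    dmat i (fun y => f y • A y) x = pd i f x • A x + f x • dmat i A x := by
  ext a b
  exact pd_mul i (differentiableAt_of_smooth hf) (hA.diff a b)

theorem dmat_sum (i : Fin n) (s : Finset τ) {A : τ → Coord n → Matrix ι κ ℝ}
    (hA : ∀ c ∈ s, SmoothMatAt (A c) x) :
    dmat i (fun y => ∑ c ∈ s, A c y) x = ∑ c ∈ s, dmat i (A c) x := by
  ext a b
  simp only [dmat_apply, Matrix.sum_apply]
  exact pd_sum i s fun c hc => (hA c hc).diff a b

theorem dmat_mul [Fintype κ] (i : Fin n) {B : Coord n → Matrix κ τ ℝ} (hA : SmoothMatAt A x)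
    (hB : SmoothMatAt B x) :
    dmat i (fun y => A y * B y) x = dmat i A x * B x + A x * dmat i B x := by
  ext a b
  simp only [dmat_apply, Matrix.mul_apply, Matrix.add_apply]
  rw [pd_sum i (f := fun c y => A y a c * B y c b) _
    fun c _ => (hA.diff a c).mul (hB.diff c b), ← Finset.sum_add_distrib]
  exact Finset.sum_congr rfl fun c _ => pd_mul i (hA.diff a c) (hB.diff c b)

theorem pd_trace [Fintype ι] (i : Fin n) {A : Coord n → Matrix ι ι ℝ} (hA : SmoothMatAt A x) :
    pd i (fun y => (A y).trace) x = (dmat i A x).trace :=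
  pd_sum i _ fun c _ => hA.diff c c

theorem dmat_comm (i j : Fin n) (hA : SmoothMatAt A x) :
    dmat i (dmat j A) x = dmat j (dmat i A) x := by
  ext a b; exact pd_comm i j (hA a b)

theorem dmat_comp (i : Fin m) {F : Coord m → Coord n} {y : Coord m} (hA : SmoothMatAt A (F y))
    (hF : ContDiffAt ℝ ∞ F y) :
    dmat i (fun z => A (F z)) y = ∑ c, pd i (fun z => F z c) y • dmat c A (F y) := by
  ext a b
  simp only [dmat_apply, Matrix.sum_apply, Matrix.smul_apply, smul_eq_mul]
  rw [pd_comp i (hA.diff a b) (differentiableAt_of_smooth hF)]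
  simp [mul_comm]

theorem eventually_det_ne_zero [Fintype ι] [DecidableEq ι] {A : Coord n → Matrix ι ι ℝ}
    (hA : SmoothMatAt A x) (h0 : (A x).det ≠ 0) : ∀ᶠ y in nhds x, (A y).det ≠ 0 :=
  hA.det.continuousAt.eventually_ne h0

/-- Differentiate A⁻¹A = 1, which holds in a neighbourhood because the determinant stays nonzero
there. -/
theorem dmat_inv [Fintype ι] [DecidableEq ι] (i : Fin n) {A : Coord n → Matrix ι ι ℝ}
    (hA : SmoothMatAt A x) (h0 : (A x).det ≠ 0) :
    dmat i (fun y => (A y)⁻¹) x = - ((A x)⁻¹ * dmat i A x * (A x)⁻¹) := by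
  have h1 : dmat i (fun y => (A y)⁻¹ * A y) x = 0 := by
    rw [dmat_congr (B := fun _ => (1 : Matrix ι ι ℝ)) i, dmat_const]
    filter_upwards [eventually_det_ne_zero hA h0] with y hy
    exact Matrix.nonsing_inv_mul _ hy.isUnit
  rw [dmat_mul i (hA.inv h0) hA] at h1
  have h2 := congrArg (· * (A x)⁻¹) h1
  simp only [Matrix.add_mul, Matrix.mul_assoc, Matrix.mul_nonsing_inv _ h0.isUnit, Matrix.mul_one,
    Matrix.zero_mul] at h2
  rw [Matrix.mul_assoc]
  exact eq_neg_of_add_eq_zero_left h2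

end MatrixCalculus

/-! ### Rearrangement of iterated finite sums. -/

section FiniteSums

variable {ι κ τ υ : Type*} [Fintype ι] [Fintype κ] [Fintype τ] [Fintype υ]

theorem sum_rotate (f : ι → κ → τ → ℝ) :
    ∑ a, ∑ b, ∑ c, f a b c = ∑ b, ∑ c, ∑ a, f a b c := by
  rw [Finset.sum_comm]
  exact Finset.sum_congr rfl fun b _ => Finset.sum_comm

theorem sum_pair_comm (f : ι → κ → τ → υ → ℝ) :
    ∑ a, ∑ b, ∑ c, ∑ d, f a b c d = ∑ c, ∑ d, ∑ a, ∑ b, f a b c d := by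
  rw [Finset.sum_congr rfl fun a _ => sum_rotate (f a), sum_rotate]

theorem sum_mul_sum_pair (f : ι → τ → ℝ) (g : κ → υ → ℝ) :
    ∑ a, ∑ b, ∑ c, ∑ d, f a c * g b d = (∑ a, ∑ c, f a c) * ∑ b, ∑ d, g b d := by
  rw [Finset.sum_mul]
  refine Finset.sum_congr rfl fun a _ => ?_
  rw [Finset.sum_comm, Finset.sum_mul]
  refine Finset.sum_congr rfl fun c _ => ?_
  simp only [Finset.mul_sum]

end FiniteSums

/-! ### Algebra of tensor contractions at a point. -/

section Contractions

open Matrix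

variable {n : ℕ}

/-- The scalar product of bilinear forms induced by the inverse metric `q`. -/
def pair2 (q A B : Matrix (Fin n) (Fin n) ℝ) : ℝ :=
  ∑ i, ∑ j, ∑ k, ∑ l, q i k * q j l * A i j * B k l

variable {q g : Matrix (Fin n) (Fin n) ℝ}

/-- Turns the fourfold contraction into matrix algebra, so that Leibniz rules and coordinate changes
reduce to associativity and cyclicity of the trace. -/
theorem pair2_eq_trace (hq : qᵀ = q) (A B : Matrix (Fin n) (Fin n) ℝ) :
    pair2 q A B = (q * (A * q * Bᵀ)).trace := by
  simp only [pair2, Matrix.trace, Matrix.diag_apply, Matrix.mul_apply, Matrix.transpose_apply,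
    Finset.mul_sum, Finset.sum_mul]
  have e : ∀ i j k l, q i k * q j l * A i j * B k l = q k i * (A i j * q j l * B k l) := by
    intro i j k l; rw [← congrFun₂ hq k i, Matrix.transpose_apply]; ring
  simp only [e]
  rw [Finset.sum_congr rfl fun i _ => Finset.sum_comm, Finset.sum_comm]
  refine Finset.sum_congr rfl fun k _ => Finset.sum_congr rfl fun i _ => ?_
  rw [Finset.sum_comm]

theorem pair2_comm (hq : qᵀ = q) (A B : Matrix (Fin n) (Fin n) ℝ) :
    pair2 q A B = pair2 q B A := by
  rw [pair2_eq_trace hq, pair2_eq_trace hq, ← Matrix.trace_transpose]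
  simp only [Matrix.transpose_mul, Matrix.transpose_transpose, hq, Matrix.mul_assoc]
  rw [Matrix.trace_mul_comm]
  simp only [Matrix.mul_assoc]
  rw [← Matrix.mul_assoc, Matrix.trace_mul_comm]
  simp only [Matrix.mul_assoc]

theorem pair2_add_left (A B C : Matrix (Fin n) (Fin n) ℝ) :
    pair2 q (A + B) C = pair2 q A C + pair2 q B C := by
  simp only [pair2, Matrix.add_apply, mul_add, add_mul, Finset.sum_add_distrib]

theorem pair2_add_right (A B C : Matrix (Fin n) (Fin n) ℝ) :
    pair2 q A (B + C) = pair2 q A B + pair2 q A C := by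
  simp only [pair2, Matrix.add_apply, mul_add, Finset.sum_add_distrib]

theorem pair2_smul_left (c : ℝ) (A B : Matrix (Fin n) (Fin n) ℝ) :
    pair2 q (c • A) B = c * pair2 q A B := by
  simp only [pair2, Matrix.smul_apply, smul_eq_mul, Finset.mul_sum]
  refine Finset.sum_congr rfl fun i _ => Finset.sum_congr rfl fun j _ =>
    Finset.sum_congr rfl fun k _ => Finset.sum_congr rfl fun l _ => by ring

theorem pair2_smul_right (c : ℝ) (A B : Matrix (Fin n) (Fin n) ℝ) :
    pair2 q A (c • B) = c * pair2 q A B := by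
  simp only [pair2, Matrix.smul_apply, smul_eq_mul, Finset.mul_sum]
  refine Finset.sum_congr rfl fun i _ => Finset.sum_congr rfl fun j _ =>
    Finset.sum_congr rfl fun k _ => Finset.sum_congr rfl fun l _ => by ring

theorem pair2_sub_left (A B C : Matrix (Fin n) (Fin n) ℝ) :
    pair2 q (A - B) C = pair2 q A C - pair2 q B C := by
  simp only [pair2, Matrix.sub_apply, mul_sub, sub_mul, Finset.sum_sub_distrib]

theorem pair2_sum_left {ι : Type*} (s : Finset ι) (A : ι → Matrix (Fin n) (Fin n) ℝ)
    (B : Matrix (Fin n) (Fin n) ℝ) :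
    pair2 q (∑ c ∈ s, A c) B = ∑ c ∈ s, pair2 q (A c) B := by
  classical
  induction s using Finset.induction_on with
  | empty => simp [pair2]
  | insert a s ha ih => rw [Finset.sum_insert ha, Finset.sum_insert ha, pair2_add_left, ih]

theorem pair2_metric_left (hq : qᵀ = q) (hg : q * g = 1) (B : Matrix (Fin n) (Fin n) ℝ) :
    pair2 q g B = (q * B).trace := by
  rw [pair2_eq_trace hq, ← Matrix.trace_transpose (q * B), Matrix.mul_assoc, ← Matrix.mul_assoc q,
    hg, Matrix.one_mul, Matrix.transpose_mul, hq, Matrix.trace_mul_comm]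

/-- A contraction of a 2-tensor with a family of 1-forms, given as columns `v i`. -/
theorem sum_contraction_eq_pair2 (hq : qᵀ = q) (b : Matrix (Fin n) (Fin n) ℝ) {τ : Type*}
    (v : Fin n → Matrix (Fin n) τ ℝ) (t : τ) :
    ∑ i, ∑ j, q i j * (b * q * v i) j t = pair2 q b (Matrix.of fun i l => v i l t) := by
  rw [pair2_eq_trace hq]
  rfl

/-- Raising all indices of a 3-tensor. -/
def raise3 (q : Matrix (Fin n) (Fin n) ℝ) (t : Fin n → Matrix (Fin n) (Fin n) ℝ)
    (k i j : Fin n) : ℝ :=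
  ∑ k', ∑ i', ∑ j', q k k' * q i i' * q j j' * t k' i' j'

/-- Moving all inverse metrics onto one factor lets the symmetries of that factor be applied term by
term. -/
theorem sum_pair2_eq_raise3 (s t : Fin n → Matrix (Fin n) (Fin n) ℝ) :
    ∑ k, ∑ k', q k k' * pair2 q (s k) (t k') = ∑ k, ∑ i, ∑ j, s k i j * raise3 q t k i j := by
  simp only [raise3, pair2, Finset.mul_sum]
  refine Finset.sum_congr rfl fun k _ => ?_
  rw [Finset.sum_comm]
  refine Finset.sum_congr rfl fun i _ => ?_
  rw [Finset.sum_comm]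
  refine Finset.sum_congr rfl fun j _ => Finset.sum_congr rfl fun k' _ =>
    Finset.sum_congr rfl fun i' _ => Finset.sum_congr rfl fun j' _ => by ring

theorem raise3_antisymm (t : Fin n → Matrix (Fin n) (Fin n) ℝ)
    (ht : ∀ k i j, t k i j = - t i k j) (k i j : Fin n) :
    raise3 q t k i j = - raise3 q t i k j := by
  simp only [raise3]
  rw [Finset.sum_comm]
  simp only [← Finset.sum_neg_distrib]
  refine Finset.sum_congr rfl fun k' _ => Finset.sum_congr rfl fun i' _ =>
    Finset.sum_congr rfl fun j' _ => ?_
  rw [ht]; ring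

/-- The factor g cancels one of the three inverse metrics, and what remains is a raised trace of t.
-/
theorem sum_metric_mul_raise3 (hg : g * q = 1) (hgs : gᵀ = g)
    (t : Fin n → Matrix (Fin n) (Fin n) ℝ)
    (ht : ∀ i, ∑ k, ∑ j, q k j * t k i j = 0) (i : Fin n) :
    ∑ k, ∑ j, g k j * raise3 q t k i j = 0 := by
  have h1 : ∀ j k', ∑ k, g k j * q k k' = (1 : Matrix (Fin n) (Fin n) ℝ) j k' := by
    intro j k'
    rw [← hg, Matrix.mul_apply]
    exact Finset.sum_congr rfl fun k _ => by rw [← congrFun₂ hgs j k, Matrix.transpose_apply]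
  calc ∑ k, ∑ j, g k j * raise3 q t k i j
      = ∑ j, ∑ k', ∑ i', ∑ j', (∑ k, g k j * q k k') * (q i i' * q j j' * t k' i' j') := by
        simp only [raise3, Finset.mul_sum, Finset.sum_mul]
        rw [Finset.sum_comm]
        refine Finset.sum_congr rfl fun j _ => ?_
        rw [Finset.sum_comm]
        refine Finset.sum_congr rfl fun k' _ => ?_
        rw [Finset.sum_comm]
        refine Finset.sum_congr rfl fun i' _ => ?_
        rw [Finset.sum_comm]
        refine Finset.sum_congr rfl fun j' _ => Finset.sum_congr rfl fun k _ => by ring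
    _ = ∑ j, ∑ i', ∑ j', q i i' * q j j' * t j i' j' := by
        simp only [h1, Matrix.one_apply, ite_mul, one_mul, zero_mul]
        refine Finset.sum_congr rfl fun j _ => ?_
        rw [Finset.sum_comm]
        refine Finset.sum_congr rfl fun i' _ => ?_
        rw [Finset.sum_comm]
        exact Finset.sum_congr rfl fun j' _ => by simp
    _ = ∑ i', q i i' * ∑ j, ∑ j', q j j' * t j i' j' := by
        rw [Finset.sum_comm]
        simp only [Finset.mul_sum, mul_assoc]
    _ = 0 := by simp [ht]

/-- The square of the trace-free antisymmetrization of a 3-tensor. -/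
theorem sum_pair2_antisymmetrization (hq : qᵀ = q) (hg : g * q = 1) (hgs : gᵀ = g)
    (A t : Fin n → Matrix (Fin n) (Fin n) ℝ) (s : Fin n → ℝ)
    (h : ∀ i j k, t i j k = A j i k - A i j k + s j * g i k - s i * g j k)
    (ht : ∀ j, ∑ i, ∑ k, q i k * t i j k = 0) :
    -2 * ∑ k, ∑ k', q k k' * pair2 q (t k') (A k) = ∑ k, ∑ k', q k k' * pair2 q (t k) (t k') := by
  have hs : ∀ k i j, t k i j = - t i k j := by intro k i j; rw [h, h]; ring
  have e1 : ∑ k, ∑ k', q k k' * pair2 q (t k') (A k) =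
      ∑ k, ∑ i, ∑ j, A k i j * raise3 q t k i j := by
    rw [← sum_pair2_eq_raise3]
    simp only [pair2_comm hq (t _)]
  set u := raise3 q t with hu
  have hu1 : ∀ k i j, u k i j = - u i k j := raise3_antisymm t hs
  have hu2 : ∀ i, ∑ k, ∑ j, g k j * u k i j = 0 := sum_metric_mul_raise3 hg hgs t ht
  -- The two derivative terms of t contribute equally to the pairing with t, since exchanging the
  -- first two slots costs a sign. This is the source of the factor -2.
  have e2 : ∑ k, ∑ i, ∑ j, A i k j * u k i j = - ∑ k, ∑ i, ∑ j, A k i j * u k i j := by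
    rw [Finset.sum_comm]
    simp only [← Finset.sum_neg_distrib]
    exact Finset.sum_congr rfl fun k _ => Finset.sum_congr rfl fun i _ =>
      Finset.sum_congr rfl fun j _ => by rw [hu1]; ring
  -- The terms with g pair t with its own trace, so they drop out.
  have e3 : ∑ k, ∑ i, ∑ j, s i * g k j * u k i j = 0 := by
    rw [Finset.sum_comm]
    simp only [mul_assoc, ← Finset.mul_sum, hu2, mul_zero, Finset.sum_const_zero]
  have e4 : ∑ k, ∑ i, ∑ j, s k * g i j * u k i j = 0 := by
    have : ∑ k, ∑ i, ∑ j, s k * g i j * u k i j = - ∑ k, ∑ i, ∑ j, s i * g k j * u k i j := by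
      rw [Finset.sum_comm]
      simp only [← Finset.sum_neg_distrib]
      exact Finset.sum_congr rfl fun k _ => Finset.sum_congr rfl fun i _ =>
        Finset.sum_congr rfl fun j _ => by rw [hu1]; ring
    rw [this, e3, neg_zero]
  rw [e1, sum_pair2_eq_raise3, ← hu]
  simp only [h, sub_mul, add_mul, Finset.sum_sub_distrib, Finset.sum_add_distrib, e2, e3, e4]
  ring

end Contractions

/-! ### The Levi-Civita connection and its curvature in matrix form. -/

section LeviCivita

open Matrix

variable {n : ℕ} {G : Coord n → Matrix (Fin n) (Fin n) ℝ} {V : Set (Coord n)} {x : Coord n}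

/-- `G` is a smooth nondegenerate symmetric bilinear form on the open set `V`. -/
structure IsMetricOn (G : Coord n → Matrix (Fin n) (Fin n) ℝ) (V : Set (Coord n)) : Prop where
  isOpen : IsOpen V
  smooth : ∀ x ∈ V, SmoothMatAt G x
  symm : ∀ x ∈ V, (G x)ᵀ = G x
  det_ne_zero : ∀ x ∈ V, (G x).det ≠ 0

namespace IsMetricOn

theorem isUnit_det (hG : IsMetricOn G V) (hx : x ∈ V) : IsUnit (G x).det :=
  (hG.det_ne_zero x hx).isUnit

theorem inv_symm (hG : IsMetricOn G V) (hx : x ∈ V) : ((G x)⁻¹)ᵀ = (G x)⁻¹ := by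
  rw [Matrix.transpose_nonsing_inv, hG.symm x hx]

theorem apply_symm (hG : IsMetricOn G V) (hx : x ∈ V) (i j : Fin n) : G x i j = G x j i :=
  congrFun₂ (hG.symm x hx) j i

theorem inv_apply_symm (hG : IsMetricOn G V) (hx : x ∈ V) (i j : Fin n) :
    (G x)⁻¹ i j = (G x)⁻¹ j i :=
  congrFun₂ (hG.inv_symm hx) j i

theorem smooth_inv (hG : IsMetricOn G V) (hx : x ∈ V) : SmoothMatAt (fun y => (G y)⁻¹) x :=
  (hG.smooth x hx).inv (hG.det_ne_zero x hx)

theorem mem_nhds (hG : IsMetricOn G V) (hx : x ∈ V) : V ∈ nhds x := hG.isOpen.mem_nhds hx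

theorem pd_symm (hG : IsMetricOn G V) (hx : x ∈ V) (i j k : Fin n) :
    pd i (fun y => G y j k) x = pd i (fun y => G y k j) x := by
  apply pd_congr
  filter_upwards [hG.mem_nhds hx] with y hy using hG.apply_symm hy j k

end IsMetricOn

/-- The connection matrix `(Γᵢ)ᵐₖ = Γᵐᵢₖ`. -/
def connMat (G : Coord n → Matrix (Fin n) (Fin n) ℝ) (x : Coord n) (i : Fin n) :
    Matrix (Fin n) (Fin n) ℝ :=
  Matrix.of fun m k => christoffel G x m i k

theorem IsMetricOn.smooth_connMat (hG : IsMetricOn G V) (hx : x ∈ V) (i : Fin n) :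
    SmoothMatAt (fun y => connMat G y i) x := by
  intro m k
  have hd : ∀ i j l, ContDiffAt ℝ ∞ (pd i (fun y => G y j l)) x :=
    fun i j l => contDiffAt_pd i (hG.smooth x hx j l)
  exact contDiffAt_const.mul (ContDiffAt.sum fun l _ =>
    (hG.smooth_inv hx m l).mul (((hd _ _ _).add (hd _ _ _)).sub (hd _ _ _)))

/-- The uniqueness half of the fundamental theorem. Once ∂G is expressed through A, the symmetry of
A cancels four of the six terms in the Christoffel formula and doubles the remaining one. It serves
to identify the connection of an induced metric. -/
theorem connMat_eq_of_torsionFree (A : Fin n → Matrix (Fin n) (Fin n) ℝ)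
    (hsymm : ∀ i j l, A i l j = A j l i) (hA : ∀ i, dmat i G x = (A i)ᵀ + A i) (i : Fin n) :
    connMat G x i = (G x)⁻¹ * A i := by
  ext k j
  have key : ∀ i j l, pd i (fun y => G y j l) x = A i l j + A i j l := fun i j l =>
    congrFun₂ (hA i) j l
  simp only [connMat, christoffel, Matrix.of_apply, Matrix.mul_apply, Finset.mul_sum, key]
  refine Finset.sum_congr rfl fun l _ => ?_
  rw [hsymm j i l, hsymm j l i, hsymm l i j, hsymm i l j]
  have := hsymm i l j
  ring_nf

theorem connMat_symm (hG : IsMetricOn G V) (hx : x ∈ V) (i j m : Fin n) :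
    connMat G x i m j = connMat G x j m i := by
  simp only [connMat, christoffel, Matrix.of_apply]
  congr 1
  refine Finset.sum_congr rfl fun l _ => ?_
  rw [hG.pd_symm hx l i j]
  ring

theorem metric_mul_connMat_apply (hG : IsMetricOn G V) (hx : x ∈ V) (i l j : Fin n) :
    (G x * connMat G x i) l j = (1 / 2) *
      (pd i (fun y => G y j l) x + pd j (fun y => G y i l) x - pd l (fun y => G y i j) x) := by
  have h : connMat G x i = (G x)⁻¹ * Matrix.of (fun l j => (1 / 2) *
      (pd i (fun y => G y j l) x + pd j (fun y => G y i l) x - pd l (fun y => G y i j) x)) := by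
    ext k j
    simp only [connMat, christoffel, Matrix.of_apply, Matrix.mul_apply, Finset.mul_sum]
    refine Finset.sum_congr rfl fun l _ => ?_
    ring
  rw [h, ← Matrix.mul_assoc, Matrix.mul_nonsing_inv _ (hG.isUnit_det hx), Matrix.one_mul]
  rfl

/-- The Levi-Civita connection is metric. -/
theorem dmat_metric (hG : IsMetricOn G V) (hx : x ∈ V) (i : Fin n) :
    dmat i G x = (connMat G x i)ᵀ * G x + G x * connMat G x i := by
  have h : (connMat G x i)ᵀ * G x = (G x * connMat G x i)ᵀ := by
    rw [Matrix.transpose_mul, hG.symm x hx]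
  rw [h]
  ext j l
  rw [Matrix.add_apply, Matrix.transpose_apply, metric_mul_connMat_apply hG hx,
    metric_mul_connMat_apply hG hx, dmat_apply, hG.pd_symm hx i l j, hG.pd_symm hx j i l,
    hG.pd_symm hx l i j]
  ring_nf

theorem dmat_metric_inv (hG : IsMetricOn G V) (hx : x ∈ V) (i : Fin n) :
    dmat i (fun y => (G y)⁻¹) x =
      - ((G x)⁻¹ * (connMat G x i)ᵀ + connMat G x i * (G x)⁻¹) := by
  rw [dmat_inv i (hG.smooth x hx) (hG.det_ne_zero x hx), dmat_metric hG hx]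
  simp only [Matrix.mul_add, Matrix.add_mul, Matrix.mul_assoc,
    Matrix.mul_nonsing_inv _ (hG.isUnit_det hx), Matrix.mul_one]
  rw [← Matrix.mul_assoc (G x)⁻¹ (G x), Matrix.nonsing_inv_mul _ (hG.isUnit_det hx), Matrix.one_mul]

/-- The covariant derivative in the direction `∂ᵢ` of a family of 1-forms, given as columns. -/
def nabla1 {τ : Type*} (G : Coord n → Matrix (Fin n) (Fin n) ℝ) (θ : Coord n → Matrix (Fin n) τ ℝ)
    (x : Coord n) (i : Fin n) : Matrix (Fin n) τ ℝ :=
  dmat i θ x - (connMat G x i)ᵀ * θ x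

/-- The covariant derivative in the direction `∂ᵢ` of a covariant 2-tensor. -/
def nabla2 (G : Coord n → Matrix (Fin n) (Fin n) ℝ) (b : Coord n → Matrix (Fin n) (Fin n) ℝ)
    (x : Coord n) (i : Fin n) : Matrix (Fin n) (Fin n) ℝ :=
  dmat i b x - (connMat G x i)ᵀ * b x - b x * connMat G x i

theorem cov2_eq_nabla2 (G b : Coord n → Matrix (Fin n) (Fin n) ℝ) (x : Coord n) (i j k : Fin n) :
    cov2 G b x i j k = nabla2 G b x i j k := by
  simp only [cov2, nabla2, Matrix.sub_apply, Matrix.mul_apply, dmat_apply, Matrix.transpose_apply,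
    connMat, Matrix.of_apply, mul_comm]

theorem cov1_eq_nabla1 {τ : Type*} (G : Coord n → Matrix (Fin n) (Fin n) ℝ)
    (θ : Coord n → Matrix (Fin n) τ ℝ) (x : Coord n) (i j : Fin n) (t : τ) :
    cov1 G (fun y k => θ y k t) x i j = nabla1 G θ x i j t := by
  simp only [cov1, nabla1, Matrix.sub_apply, Matrix.mul_apply, dmat_apply, Matrix.transpose_apply,
    connMat, Matrix.of_apply]

theorem nabla2_transpose (G b : Coord n → Matrix (Fin n) (Fin n) ℝ) (x : Coord n) (i : Fin n) :
    (nabla2 G b x i)ᵀ = nabla2 G (fun y => (b y)ᵀ) x i := by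
  simp only [nabla2, Matrix.transpose_sub, Matrix.transpose_mul, Matrix.transpose_transpose,
    dmat_transpose]
  abel

theorem nabla2_congr {a b : Coord n → Matrix (Fin n) (Fin n) ℝ} (h : a =ᶠ[nhds x] b) (i : Fin n) :
    nabla2 G a x i = nabla2 G b x i := by
  rw [nabla2, nabla2, dmat_congr i h, h.eq_of_nhds]

theorem nabla2_metric (hG : IsMetricOn G V) (hx : x ∈ V) (i : Fin n) : nabla2 G G x i = 0 := by
  rw [nabla2, dmat_metric hG hx]; abel

theorem nabla2_sub {a b : Coord n → Matrix (Fin n) (Fin n) ℝ} (ha : SmoothMatAt a x)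
    (hb : SmoothMatAt b x) (i : Fin n) :
    nabla2 G (fun y => a y - b y) x i = nabla2 G a x i - nabla2 G b x i := by
  rw [nabla2, nabla2, nabla2, dmat_sub i ha hb, Matrix.mul_sub, Matrix.sub_mul]
  abel

theorem nabla2_smul {f : Coord n → ℝ} {b : Coord n → Matrix (Fin n) (Fin n) ℝ}
    (hf : ContDiffAt ℝ ∞ f x) (hb : SmoothMatAt b x) (i : Fin n) :
    nabla2 G (fun y => f y • b y) x i = pd i f x • b x + f x • nabla2 G b x i := by
  rw [nabla2, nabla2, dmat_smul i hf hb, Matrix.mul_smul, Matrix.smul_mul, smul_sub, smul_sub]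
  abel

/-- Leibniz rule across a contraction: the connection terms in the derivative of G⁻¹ are exactly the
corrections for the two contracted slots. -/
theorem nabla1_contraction {τ : Type*} (hG : IsMetricOn G V) (hx : x ∈ V)
    {b : Coord n → Matrix (Fin n) (Fin n) ℝ} {θ : Coord n → Matrix (Fin n) τ ℝ}
    (hb : SmoothMatAt b x) (hθ : SmoothMatAt θ x) (i : Fin n) :
    nabla1 G (fun y => b y * (G y)⁻¹ * θ y) x i =
      nabla2 G b x i * (G x)⁻¹ * θ x + b x * (G x)⁻¹ * nabla1 G θ x i := by
  rw [nabla1, dmat_mul i (hb.mul (hG.smooth_inv hx)) hθ, dmat_mul i hb (hG.smooth_inv hx),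
    dmat_metric_inv hG hx, nabla1, nabla2]
  simp only [Matrix.mul_add, Matrix.add_mul, Matrix.mul_sub, Matrix.sub_mul, Matrix.mul_assoc,
    Matrix.mul_neg, Matrix.neg_mul]
  abel

theorem nabla2_contraction (hG : IsMetricOn G V) (hx : x ∈ V)
    {a b : Coord n → Matrix (Fin n) (Fin n) ℝ} (ha : SmoothMatAt a x) (hb : SmoothMatAt b x)
    (i : Fin n) :
    nabla2 G (fun y => a y * (G y)⁻¹ * b y) x i =
      nabla2 G a x i * (G x)⁻¹ * b x + a x * (G x)⁻¹ * nabla2 G b x i := by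
  rw [nabla2, dmat_mul i (ha.mul (hG.smooth_inv hx)) hb, dmat_mul i ha (hG.smooth_inv hx),
    dmat_metric_inv hG hx, nabla2, nabla2]
  simp only [Matrix.mul_add, Matrix.add_mul, Matrix.mul_sub, Matrix.sub_mul, Matrix.mul_assoc,
    Matrix.mul_neg, Matrix.neg_mul]
  abel

/-- Covariant differentiation commutes with traces. -/
theorem pd_metricTrace (hG : IsMetricOn G V) (hx : x ∈ V)
    {b : Coord n → Matrix (Fin n) (Fin n) ℝ} (hb : SmoothMatAt b x) (i : Fin n) :
    pd i (fun y => ((G y)⁻¹ * b y).trace) x = ((G x)⁻¹ * nabla2 G b x i).trace := by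
  rw [pd_trace i ((hG.smooth_inv hx).mul hb), dmat_mul i (hG.smooth_inv hx) hb,
    dmat_metric_inv hG hx, nabla2]
  simp only [Matrix.mul_sub, Matrix.add_mul, Matrix.neg_mul, Matrix.trace_add, Matrix.trace_sub,
    Matrix.trace_neg]
  rw [← Matrix.mul_assoc, ← Matrix.mul_assoc, Matrix.trace_mul_comm ((G x)⁻¹ * b x),
    ← Matrix.mul_assoc]
  ring

theorem inner2_eq_trace (hG : IsMetricOn G V) (hx : x ∈ V)
    (a b : Coord n → Matrix (Fin n) (Fin n) ℝ) :
    inner2 G a b x = ((G x)⁻¹ * (a x * (G x)⁻¹ * (b x)ᵀ)).trace :=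
  pair2_eq_trace (hG.inv_symm hx) _ _

theorem pd_inner2 (hG : IsMetricOn G V) (hx : x ∈ V)
    {a b : Coord n → Matrix (Fin n) (Fin n) ℝ} (ha : SmoothMatAt a x) (hb : SmoothMatAt b x)
    (i : Fin n) :
    pd i (inner2 G a b) x =
      inner2 G (fun y => nabla2 G a y i) b x + inner2 G a (fun y => nabla2 G b y i) x := by
  have h : inner2 G a b =ᶠ[nhds x] fun y => ((G y)⁻¹ * (a y * (G y)⁻¹ * (b y)ᵀ)).trace := by
    filter_upwards [hG.mem_nhds hx] with y hy using inner2_eq_trace hG hy a b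
  rw [pd_congr i h, pd_metricTrace hG hx ((ha.mul (hG.smooth_inv hx)).mul hb.transpose),
    nabla2_contraction hG hx ha hb.transpose, inner2_eq_trace hG hx, inner2_eq_trace hG hx,
    Matrix.mul_add, Matrix.trace_add, nabla2_transpose]

/-- The curvature endomorphism `(Rᵢⱼ)ˡₖ = Rᵢⱼₖˡ`. -/
def curvMat (G : Coord n → Matrix (Fin n) (Fin n) ℝ) (x : Coord n) (i j : Fin n) :
    Matrix (Fin n) (Fin n) ℝ :=
  Matrix.of fun l k => riemannUp G x i j k l

theorem curvMat_eq (G : Coord n → Matrix (Fin n) (Fin n) ℝ) (x : Coord n) (i j : Fin n) :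
    curvMat G x i j = dmat i (fun y => connMat G y j) x - dmat j (fun y => connMat G y i) x
      + connMat G x i * connMat G x j - connMat G x j * connMat G x i := by
  ext l k
  simp [curvMat, riemannUp, connMat, Matrix.mul_apply]

theorem riemann_eq (hG : IsMetricOn G V) (hx : x ∈ V) (i j k l : Fin n) :
    riemann G x i j k l = (G x * curvMat G x i j) l k := by
  simp only [riemann, Matrix.mul_apply, curvMat, Matrix.of_apply]
  exact Finset.sum_congr rfl fun m _ => by rw [hG.apply_symm hx m l, mul_comm]

/-- Second partial derivatives of the metric commute. Expanding both orders by metric compatibility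
leaves precisely the skewness of the curvature. -/
theorem curvMat_skew (hG : IsMetricOn G V) (hx : x ∈ V) (i j : Fin n) :
    (curvMat G x i j)ᵀ * G x + G x * curvMat G x i j = 0 := by
  have h1 : ∀ i j, dmat i (dmat j G) x =
      (dmat i (fun y => connMat G y j) x)ᵀ * G x + (connMat G x j)ᵀ * dmat i G x +
      (dmat i G x * connMat G x j + G x * dmat i (fun y => connMat G y j) x) := by
    intro i j
    have h : dmat j G =ᶠ[nhds x] fun y => (connMat G y j)ᵀ * G y + G y * connMat G y j := by
      filter_upwards [hG.mem_nhds hx] with y hy using dmat_metric hG hy j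
    have hc := hG.smooth_connMat hx j
    have hs := hG.smooth x hx
    rw [dmat_congr i h, dmat_add i (hc.transpose.mul hs) (hs.mul hc), dmat_mul i hc.transpose hs,
      dmat_mul i hs hc, dmat_transpose]
  have h2 := dmat_comm i j (hG.smooth x hx)
  rw [h1, h1, dmat_metric hG hx, dmat_metric hG hx, ← sub_eq_zero] at h2
  rw [curvMat_eq, ← h2]
  simp only [Matrix.transpose_sub, Matrix.transpose_add, Matrix.transpose_mul, Matrix.mul_add,
    Matrix.add_mul, Matrix.mul_sub, Matrix.sub_mul, Matrix.mul_assoc]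
  abel

theorem riemann_skew (hG : IsMetricOn G V) (hx : x ∈ V) (i j k l : Fin n) :
    riemann G x i j k l = - riemann G x i j l k := by
  have h := congrFun₂ (curvMat_skew hG hx i j) l k
  rw [riemann_eq hG hx, riemann_eq hG hx]
  have e : (curvMat G x i j)ᵀ * G x = (G x * curvMat G x i j)ᵀ := by
    rw [Matrix.transpose_mul, hG.symm x hx]
  rw [e, Matrix.add_apply, Matrix.transpose_apply, Matrix.zero_apply] at h
  linarith

end LeviCivita

/-! ### Isometric immersions: Gauss formula and Codazzi equation. -/

section IsometricImmersions

open Matrix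

variable {m n : ℕ}

/-- The Jacobian matrix `∂ᵢ Fᵃ`. -/
def jac (F : Coord m → Coord n) (x : Coord m) : Matrix (Fin n) (Fin m) ℝ :=
  Matrix.of fun a i => pd i (fun y => F y a) x

theorem smooth_jac {F : Coord m → Coord n} {x : Coord m} (hF : ContDiffAt ℝ ∞ F x) :
    SmoothMatAt (jac F) x :=
  fun a i => contDiffAt_pd i (contDiffAt_coord hF a)

theorem dmat_jac_symm {F : Coord m → Coord n} {x : Coord m} (hF : ContDiffAt ℝ ∞ F x)
    (i k : Fin m) (a : Fin n) : dmat i (jac F) x a k = dmat k (jac F) x a i :=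
  pd_comm i k (contDiffAt_coord hF a)

/-- The connection matrices of the pullback of the Levi-Civita connection of `K` under `F`. -/
def pullConn (K : Coord n → Matrix (Fin n) (Fin n) ℝ) (F : Coord m → Coord n) (x : Coord m)
    (i : Fin m) : Matrix (Fin n) (Fin n) ℝ :=
  ∑ c, jac F x c i • connMat K (F x) c

/-- The second covariant derivatives of `F`: the column `k` of `(secondDeriv K F x i)` holds the
components of `∇_{∂ᵢ} ∂ₖ F`. -/
def secondDeriv (K : Coord n → Matrix (Fin n) (Fin n) ℝ) (F : Coord m → Coord n) (x : Coord m)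
    (i : Fin m) : Matrix (Fin n) (Fin m) ℝ :=
  dmat i (jac F) x + pullConn K F x i * jac F x

/-- The curvature endomorphism `R(∂ᵢ F, ∂ⱼ F)`. -/
def pullCurv (K : Coord n → Matrix (Fin n) (Fin n) ℝ) (F : Coord m → Coord n) (x : Coord m)
    (i j : Fin m) : Matrix (Fin n) (Fin n) ℝ :=
  ∑ c, ∑ e, (jac F x c i * jac F x e j) • curvMat K (F x) c e

/-- `F` maps `U` into `V` smoothly and `G` is the pullback of the metric `K`. -/
structure IsIsometricOn (G : Coord m → Matrix (Fin m) (Fin m) ℝ)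
    (K : Coord n → Matrix (Fin n) (Fin n) ℝ) (F : Coord m → Coord n) (U : Set (Coord m))
    (V : Set (Coord n)) : Prop where
  source : IsMetricOn G U
  target : IsMetricOn K V
  mapsTo : ∀ x ∈ U, F x ∈ V
  smooth : ∀ x ∈ U, ContDiffAt ℝ ∞ F x
  pullback : ∀ x ∈ U, G x = (jac F x)ᵀ * K (F x) * jac F x

variable {G : Coord m → Matrix (Fin m) (Fin m) ℝ} {K : Coord n → Matrix (Fin n) (Fin n) ℝ}
  {F : Coord m → Coord n} {U : Set (Coord m)} {V : Set (Coord n)} {x : Coord m}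

namespace IsIsometricOn

theorem smooth_target (hF : IsIsometricOn G K F U V) (hx : x ∈ U) :
    SmoothMatAt (fun y => K (F y)) x :=
  (hF.target.smooth _ (hF.mapsTo x hx)).comp (hF.smooth x hx)

theorem smooth_connMat_comp (hF : IsIsometricOn G K F U V) (hx : x ∈ U) (c : Fin n) :
    SmoothMatAt (fun y => connMat K (F y) c) x :=
  SmoothMatAt.comp (A := fun z => connMat K z c)
    (hF.target.smooth_connMat (hF.mapsTo x hx) c) (hF.smooth x hx)

theorem smooth_jac (hF : IsIsometricOn G K F U V) (hx : x ∈ U) : SmoothMatAt (jac F) x :=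
  HypersurfaceGeometry.smooth_jac (hF.smooth x hx)

theorem smooth_pullConn (hF : IsIsometricOn G K F U V) (hx : x ∈ U) (i : Fin m) :
    SmoothMatAt (fun y => pullConn K F y i) x :=
  SmoothMatAt.sum fun c _ => SmoothMatAt.smul (hF.smooth_jac hx c i) (hF.smooth_connMat_comp hx c)

theorem smooth_secondDeriv (hF : IsIsometricOn G K F U V) (hx : x ∈ U) (i : Fin m) :
    SmoothMatAt (fun y => secondDeriv K F y i) x :=
  ((hF.smooth_jac hx).dmat i).add ((hF.smooth_pullConn hx i).mul (hF.smooth_jac hx))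

/-- The pulled-back connection is compatible with the metric along F, by the chain rule and metric
compatibility of K. -/
theorem dmat_target (hF : IsIsometricOn G K F U V) (hx : x ∈ U) (i : Fin m) :
    dmat i (fun y => K (F y)) x =
      (pullConn K F x i)ᵀ * K (F x) + K (F x) * pullConn K F x i := by
  rw [dmat_comp i (hF.target.smooth _ (hF.mapsTo x hx)) (hF.smooth x hx)]
  simp only [dmat_metric hF.target (hF.mapsTo x hx), pullConn, Matrix.transpose_sum,
    Matrix.sum_mul, Matrix.mul_sum, Matrix.transpose_smul, Matrix.smul_mul, Matrix.mul_smul,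
    ← Finset.sum_add_distrib, ← smul_add]
  rfl

/-- Second partials of F commute and the ambient connection is torsion-free. -/
theorem secondDeriv_symm (hF : IsIsometricOn G K F U V) (hx : x ∈ U) (i k : Fin m) (a : Fin n) :
    secondDeriv K F x i a k = secondDeriv K F x k a i := by
  have h : ∀ i k, (pullConn K F x i * jac F x) a k =
      ∑ d, ∑ c, connMat K (F x) c a d * (jac F x c i * jac F x d k) := by
    intro i k
    simp only [pullConn, Matrix.mul_apply, Matrix.sum_apply, Matrix.smul_apply, smul_eq_mul,
      Finset.sum_mul]
    exact Finset.sum_congr rfl fun d _ => Finset.sum_congr rfl fun c _ => by ring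
  rw [secondDeriv, secondDeriv, Matrix.add_apply, Matrix.add_apply,
    dmat_jac_symm (hF.smooth x hx), h, h, Finset.sum_comm]
  congr 1
  refine Finset.sum_congr rfl fun d _ => Finset.sum_congr rfl fun c _ => ?_
  rw [connMat_symm hF.target (hF.mapsTo x hx)]
  ring

/-- The tangential part of the Gauss formula. -/
theorem connMat_eq (hF : IsIsometricOn G K F U V) (hx : x ∈ U) (i : Fin m) :
    connMat G x i = (G x)⁻¹ * ((jac F x)ᵀ * K (F x) * secondDeriv K F x i) := by
  -- The candidate is the tangential part of the second derivative with lowered index. It is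
  -- torsion-free by `secondDeriv_symm`, and metric by differentiating G = JᵀKJ.
  refine connMat_eq_of_torsionFree
    (fun i => (jac F x)ᵀ * K (F x) * secondDeriv K F x i) (fun i j l => ?_) (fun i => ?_) i
  · rw [Matrix.mul_apply, Matrix.mul_apply]
    exact Finset.sum_congr rfl fun a _ => by rw [hF.secondDeriv_symm hx]
  · have h : G =ᶠ[nhds x] fun y => (jac F y)ᵀ * K (F y) * jac F y := by
      filter_upwards [hF.source.mem_nhds hx] with y hy using hF.pullback y hy
    have hT := hF.smooth_jac hx
    have hK := hF.smooth_target hx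
    rw [dmat_congr i h, dmat_mul i (hT.transpose.mul hK) hT, dmat_mul i hT.transpose hK,
      hF.dmat_target hx, dmat_transpose, secondDeriv]
    simp only [Matrix.transpose_add, Matrix.transpose_mul, Matrix.transpose_transpose,
      hF.target.symm _ (hF.mapsTo x hx), Matrix.mul_add, Matrix.add_mul, Matrix.mul_assoc]
    abel

theorem dmat_pullConn (hF : IsIsometricOn G K F U V) (hx : x ∈ U) (i j : Fin m) :
    dmat i (fun y => pullConn K F y j) x =
      ∑ c, dmat i (jac F) x c j • connMat K (F x) c +
      ∑ c, ∑ e, (jac F x c i * jac F x e j) • dmat c (fun z => connMat K z e) (F x) := by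
  simp only [pullConn]
  rw [dmat_sum i (A := fun c y => jac F y c j • connMat K (F y) c) _
    (fun c _ => SmoothMatAt.smul (hF.smooth_jac hx c j) (hF.smooth_connMat_comp hx c))]
  rw [Finset.sum_comm (s := Finset.univ) (t := Finset.univ)
    (f := fun c e => (jac F x c i * jac F x e j) • dmat c (fun z => connMat K z e) (F x)),
    ← Finset.sum_add_distrib]
  refine Finset.sum_congr rfl fun c _ => ?_
  rw [dmat_smul i (hF.smooth_jac hx c j) (hF.smooth_connMat_comp hx c),
    dmat_comp (A := fun z => connMat K z c) i (hF.target.smooth_connMat (hF.mapsTo x hx) c)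
      (hF.smooth x hx), Finset.smul_sum]
  congr 1
  refine Finset.sum_congr rfl fun e _ => ?_
  rw [smul_smul, mul_comm]
  rfl

/-- Curvature commutes with pullback: the terms with second derivatives of F are symmetric in i, j
and cancel. -/
theorem pullCurv_eq (hF : IsIsometricOn G K F U V) (hx : x ∈ U) (i j : Fin m) :
    pullCurv K F x i j = dmat i (fun y => pullConn K F y j) x - dmat j (fun y => pullConn K F y i) x
      + pullConn K F x i * pullConn K F x j - pullConn K F x j * pullConn K F x i := by
  have h1 : ∀ i j, pullConn K F x i * pullConn K F x j =
      ∑ c, ∑ e, (jac F x c i * jac F x e j) • (connMat K (F x) c * connMat K (F x) e) := by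
    intro i j
    simp only [pullConn, Matrix.sum_mul, Matrix.mul_sum, Matrix.smul_mul, Matrix.mul_smul,
      Finset.smul_sum, smul_smul]
    rw [Finset.sum_comm]
    simp only [mul_comm]
  have h2 : ∀ f : Fin n → Fin n → Matrix (Fin n) (Fin n) ℝ,
      ∑ c, ∑ e, (jac F x c j * jac F x e i) • f c e =
      ∑ c, ∑ e, (jac F x c i * jac F x e j) • f e c := by
    intro f
    rw [Finset.sum_comm]
    simp only [mul_comm]
  rw [hF.dmat_pullConn hx i j, hF.dmat_pullConn hx j i, h1, h1 j i, h2, h2]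
  simp only [pullCurv, curvMat_eq, smul_sub, smul_add, Finset.sum_add_distrib,
    Finset.sum_sub_distrib, dmat_jac_symm (hF.smooth x hx) i j]
  abel

/-- The commutator of covariant derivatives along `F`. -/
theorem dmat_secondDeriv_sub (hF : IsIsometricOn G K F U V) (hx : x ∈ U) (i j : Fin m) :
    (dmat i (fun y => secondDeriv K F y j) x + pullConn K F x i * secondDeriv K F x j) -
      (dmat j (fun y => secondDeriv K F y i) x + pullConn K F x j * secondDeriv K F x i) =
    pullCurv K F x i j * jac F x := by
  have hT := hF.smooth_jac hx
  have h : ∀ i j, dmat i (fun y => secondDeriv K F y j) x = dmat i (dmat j (jac F)) x +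
      (dmat i (fun y => pullConn K F y j) x * jac F x +
        pullConn K F x j * dmat i (jac F) x) := by
    intro i j
    simp only [secondDeriv]
    rw [dmat_add i (hT.dmat j) ((hF.smooth_pullConn hx j).mul hT),
      dmat_mul i (hF.smooth_pullConn hx j) hT]
  rw [h, h, hF.pullCurv_eq hx, dmat_comm i j hT, secondDeriv, secondDeriv]
  simp only [Matrix.mul_add, Matrix.add_mul, Matrix.sub_mul, Matrix.mul_assoc]
  abel

end IsIsometricOn

/-- `N` is a unit normal field along the isometric immersion `F` of a hypersurface, as a column. -/
structure IsUnitNormalOn (K : Coord n → Matrix (Fin n) (Fin n) ℝ) (F : Coord m → Coord n)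
    (N : Coord m → Matrix (Fin n) Unit ℝ) (U : Set (Coord m)) : Prop where
  codim : n = m + 1
  smooth : ∀ x ∈ U, SmoothMatAt N x
  unit : ∀ x ∈ U, (N x)ᵀ * K (F x) * N x = 1
  normal : ∀ x ∈ U, (N x)ᵀ * K (F x) * jac F x = 0

/-- The rows `k ↦ - K(∇_{∂ᵢ} ∂ₖ F, N)` of the second fundamental form. -/
def secondForm (K : Coord n → Matrix (Fin n) (Fin n) ℝ) (F : Coord m → Coord n)
    (N : Coord m → Matrix (Fin n) Unit ℝ) (x : Coord m) (i : Fin m) : Matrix Unit (Fin m) ℝ :=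
  - ((N x)ᵀ * K (F x) * secondDeriv K F x i)

namespace IsUnitNormalOn

variable {N : Coord m → Matrix (Fin n) Unit ℝ}

/-- Stacking the tangential and normal coframes gives a left inverse of the frame (J, N). In
codimension one these matrices are square up to reindexing, so it is also a right inverse, which is
the decomposition of the identity into tangential and normal projections. -/
theorem completeness (hN : IsUnitNormalOn K F N U) (hF : IsIsometricOn G K F U V) (hx : x ∈ U) :
    jac F x * ((G x)⁻¹ * (jac F x)ᵀ * K (F x)) + N x * ((N x)ᵀ * K (F x)) = 1 := by
  have hn : (jac F x)ᵀ * K (F x) * N x = 0 := by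
    have := congrArg Matrix.transpose (hN.normal x hx)
    simpa only [Matrix.transpose_mul, Matrix.transpose_transpose, Matrix.transpose_zero,
      hF.target.symm _ (hF.mapsTo x hx), Matrix.mul_assoc] using this
  have h : Matrix.fromRows ((G x)⁻¹ * (jac F x)ᵀ * K (F x)) ((N x)ᵀ * K (F x)) *
      Matrix.fromCols (jac F x) (N x) = 1 := by
    rw [Matrix.fromRows_mul_fromCols, hN.normal x hx, hN.unit x hx,
      Matrix.mul_assoc (G x)⁻¹, Matrix.mul_assoc (G x)⁻¹, Matrix.mul_assoc (G x)⁻¹, hn,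
      ← hF.pullback x hx, Matrix.nonsing_inv_mul _ (hF.source.isUnit_det hx), Matrix.mul_zero,
      Matrix.fromBlocks_one]
  have hcard : Fintype.card (Fin m ⊕ Unit) = Fintype.card (Fin n) := by
    simp [hN.codim]
  rw [Matrix.mul_eq_one_comm_of_card_eq _ _ _ hcard, Matrix.fromCols_mul_fromRows] at h
  exact h

/-- The Gauss formula. -/
theorem gauss (hN : IsUnitNormalOn K F N U) (hF : IsIsometricOn G K F U V) (hx : x ∈ U)
    (i : Fin m) : secondDeriv K F x i = jac F x * connMat G x i - N x * secondForm K F N x i := by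
  rw [hF.connMat_eq hx, secondForm]
  conv_lhs => rw [← Matrix.one_mul (secondDeriv K F x i), ← hN.completeness hF hx]
  simp only [Matrix.add_mul, Matrix.mul_assoc, Matrix.mul_neg, sub_neg_eq_add]

/-- The Codazzi equation. -/
theorem codazzi (hN : IsUnitNormalOn K F N U) (hF : IsIsometricOn G K F U V) (hx : x ∈ U)
    (i j : Fin m) :
    (dmat i (fun y => secondForm K F N y j) x - secondForm K F N x j * connMat G x i) -
      (dmat j (fun y => secondForm K F N y i) x - secondForm K F N x i * connMat G x j) =
    - ((N x)ᵀ * K (F x) * (pullCurv K F x i j * jac F x)) := by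
  have hNs := hN.smooth x hx
  have hT := hF.smooth_jac hx
  have hK := hF.smooth_target hx
  -- The covariant derivative of N along the hypersurface. The next fact is the Leibniz rule for the
  -- pairing of N with a field B along F.
  set DN : Fin m → Matrix (Fin n) Unit ℝ := fun i => dmat i N x + pullConn K F x i * N x with hDN
  have hconst : ∀ {τ : Type} {B C : Coord m → Matrix (Fin n) τ ℝ} (_ : SmoothMatAt B x) (i : Fin m),
      dmat i (fun y => (N y)ᵀ * K (F y) * B y) x =
        (DN i)ᵀ * K (F x) * B x +
          (N x)ᵀ * K (F x) * (dmat i B x + pullConn K F x i * B x) := by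
    intro τ B _ hB i
    rw [dmat_mul i (hNs.transpose.mul hK) hB, dmat_mul i hNs.transpose hK, hF.dmat_target hx,
      dmat_transpose, hDN]
    simp only [Matrix.transpose_add, Matrix.transpose_mul, Matrix.mul_add, Matrix.add_mul,
      Matrix.mul_assoc]
    abel
  have hU := hF.source.mem_nhds hx
  -- Differentiating ⟨N, N⟩ = 1: the derivative of N has no normal component.
  have h1 : ∀ i, (DN i)ᵀ * K (F x) * N x = 0 := by
    intro i
    have h := hconst (C := N) hNs i
    have e : (fun y => (N y)ᵀ * K (F y) * N y) =ᶠ[nhds x] fun _ => 1 := by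
      filter_upwards [hU] with y hy using hN.unit y hy
    rw [dmat_congr i e, dmat_const] at h
    have e2 : (N x)ᵀ * K (F x) * DN i = ((DN i)ᵀ * K (F x) * N x)ᵀ := by
      simp only [Matrix.transpose_mul, Matrix.transpose_transpose,
        hF.target.symm _ (hF.mapsTo x hx), Matrix.mul_assoc]
    change 0 = _ + (N x)ᵀ * K (F x) * DN i at h
    rw [e2] at h
    ext a b
    have h3 := congrFun₂ h a b
    rw [Matrix.add_apply, Matrix.transpose_apply, Matrix.zero_apply, Subsingleton.elim b a] at h3
    rw [Subsingleton.elim b a, Matrix.zero_apply]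
    linarith
  -- Weingarten relation, from differentiating ⟨N, ∂ₖF⟩ = 0.
  have h2 : ∀ i, (DN i)ᵀ * K (F x) * jac F x = secondForm K F N x i := by
    intro i
    have h := hconst (C := jac F) hT i
    have e : (fun y => (N y)ᵀ * K (F y) * jac F y) =ᶠ[nhds x] fun _ => 0 := by
      filter_upwards [hU] with y hy using hN.normal y hy
    rw [dmat_congr i e, dmat_const] at h
    rw [secondForm, secondDeriv]
    exact eq_neg_of_add_eq_zero_left h.symm
  have h3 : ∀ i j, dmat i (fun y => secondForm K F N y j) x =
      - (secondForm K F N x i * connMat G x j) - (N x)ᵀ * K (F x) *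
        (dmat i (fun y => secondDeriv K F y j) x + pullConn K F x i * secondDeriv K F x j) := by
    intro i j
    simp only [secondForm] at h2 ⊢
    rw [dmat_neg, hconst (C := jac F) (hF.smooth_secondDeriv hx j), ← h2 i]
    -- Since DN is tangential, only the tangential part of the Gauss formula contributes here.
    have e : (DN i)ᵀ * K (F x) * secondDeriv K F x j =
        (DN i)ᵀ * K (F x) * jac F x * connMat G x j := by
      rw [hN.gauss hF hx j, Matrix.mul_sub, ← Matrix.mul_assoc, ← Matrix.mul_assoc, h1,
        Matrix.zero_mul, sub_zero]
    rw [e]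
    abel
  rw [h3, h3, ← hF.dmat_secondDeriv_sub hx, Matrix.mul_sub]
  abel

theorem smooth_secondForm (hN : IsUnitNormalOn K F N U) (hF : IsIsometricOn G K F U V)
    (hx : x ∈ U) (i : Fin m) : SmoothMatAt (fun y => secondForm K F N y i) x :=
  (((hN.smooth x hx).transpose.mul (hF.smooth_target hx)).mul (hF.smooth_secondDeriv hx i)).neg

end IsUnitNormalOn

end IsometricImmersions

/-! ### Divergence identities for trace-free tensors of Codazzi type. -/

section DivergenceFormulas

open Matrix

variable {n : ℕ} {G : Coord n → Matrix (Fin n) (Fin n) ℝ} {U : Set (Coord n)} {x : Coord n}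

theorem cov1_congr {θ η : Coord n → Fin n → ℝ} (h : θ =ᶠ[nhds x] η) (i j : Fin n) :
    cov1 G θ x i j = cov1 G η x i j := by
  rw [cov1, cov1, h.eq_of_nhds,
    pd_congr (f := fun y => θ y j) (g := fun y => η y j) i (h.fun_comp (fun v => v j))]

theorem cov1_add {θ η : Coord n → Fin n → ℝ} (hθ : ∀ i, ContDiffAt ℝ ∞ (fun y => θ y i) x)
    (hη : ∀ i, ContDiffAt ℝ ∞ (fun y => η y i) x) (i j : Fin n) :
    cov1 G (fun y k => θ y k + η y k) x i j = cov1 G θ x i j + cov1 G η x i j := by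
  simp only [cov1]
  rw [pd_add i (differentiableAt_of_smooth (hθ j)) (differentiableAt_of_smooth (hη j))]
  simp only [mul_add, Finset.sum_add_distrib]
  ring

theorem cov1_const_mul {θ : Coord n → Fin n → ℝ} (hθ : ∀ i, ContDiffAt ℝ ∞ (fun y => θ y i) x)
    (c : ℝ) (i j : Fin n) :
    cov1 G (fun y k => c * θ y k) x i j = c * cov1 G θ x i j := by
  simp only [cov1]
  rw [pd_const_mul i c (differentiableAt_of_smooth (hθ j)), mul_sub, Finset.mul_sum]
  congr 1
  exact Finset.sum_congr rfl fun m _ => by ring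

theorem div1_congr {θ η : Coord n → Fin n → ℝ} (h : θ =ᶠ[nhds x] η) :
    div1 G θ x = div1 G η x := by
  simp only [div1, cov1_congr h]

theorem div1_add {θ η : Coord n → Fin n → ℝ} (hθ : ∀ i, ContDiffAt ℝ ∞ (fun y => θ y i) x)
    (hη : ∀ i, ContDiffAt ℝ ∞ (fun y => η y i) x) :
    div1 G (fun y k => θ y k + η y k) x = div1 G θ x + div1 G η x := by
  simp only [div1, cov1_add hθ hη, mul_add, Finset.sum_add_distrib]

theorem div1_const_mul {θ : Coord n → Fin n → ℝ} (hθ : ∀ i, ContDiffAt ℝ ∞ (fun y => θ y i) x)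
    (c : ℝ) : div1 G (fun y k => c * θ y k) x = c * div1 G θ x := by
  simp only [div1, cov1_const_mul hθ, Finset.mul_sum]
  exact Finset.sum_congr rfl fun i _ => Finset.sum_congr rfl fun j _ => by ring

theorem div2_eq (G b : Coord n → Matrix (Fin n) (Fin n) ℝ) (x : Coord n) (j : Fin n) :
    div2 G b x j = ∑ i, ∑ k, (G x)⁻¹ i k * nabla2 G b x i k j := by
  simp only [div2, cov2_eq_nabla2]

theorem div2_congr {a b : Coord n → Matrix (Fin n) (Fin n) ℝ} (h : a =ᶠ[nhds x] b) (j : Fin n) :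
    div2 G a x j = div2 G b x j := by
  simp only [div2_eq, nabla2_congr h]

theorem smooth_nabla2 (hG : IsMetricOn G U) (hx : x ∈ U) {b : Coord n → Matrix (Fin n) (Fin n) ℝ}
    (hb : SmoothMatAt b x) (i : Fin n) : SmoothMatAt (fun y => nabla2 G b y i) x :=
  ((hb.dmat i).sub ((hG.smooth_connMat hx i).transpose.mul hb)).sub
    (hb.mul (hG.smooth_connMat hx i))

theorem smooth_div2 (hG : IsMetricOn G U) (hx : x ∈ U) {b : Coord n → Matrix (Fin n) (Fin n) ℝ}
    (hb : SmoothMatAt b x) (j : Fin n) : ContDiffAt ℝ ∞ (fun y => div2 G b y j) x := by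
  simp only [div2_eq]
  exact ContDiffAt.sum fun i _ => ContDiffAt.sum fun k _ =>
    (hG.smooth_inv hx i k).mul (smooth_nabla2 hG hx hb i k j)

theorem smooth_inner2 (hG : IsMetricOn G U) (hx : x ∈ U)
    {a b : Coord n → Matrix (Fin n) (Fin n) ℝ} (ha : SmoothMatAt a x) (hb : SmoothMatAt b x) :
    ContDiffAt ℝ ∞ (fun y => inner2 G a b y) x :=
  ContDiffAt.sum fun i _ => ContDiffAt.sum fun j _ => ContDiffAt.sum fun k _ =>
    ContDiffAt.sum fun l _ =>
      (((hG.smooth_inv hx i k).mul (hG.smooth_inv hx j l)).mul (ha i j)).mul (hb k l)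

/-- A smooth symmetric trace-free 2-tensor `b` on `U`, together with the trace-free part `W` of
the exterior covariant derivative of `b` and half its divergence `σ`. -/
structure IsCodazziOn (G b : Coord n → Matrix (Fin n) (Fin n) ℝ) (σ : Coord n → Fin n → ℝ)
    (W : Coord n → Fin n → Fin n → Fin n → ℝ) (U : Set (Coord n)) : Prop where
  metric : IsMetricOn G U
  smooth : ∀ x ∈ U, SmoothMatAt b x
  symm : ∀ x ∈ U, (b x)ᵀ = b x
  traceFree : ∀ x ∈ U, ((G x)⁻¹ * b x).trace = 0
  codazzi : ∀ x ∈ U, ∀ i j k, W x i j k =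
    nabla2 G b x j i k - nabla2 G b x i j k + σ x j * G x i k - σ x i * G x j k
  trace_eq_zero : ∀ x ∈ U, ∀ j, ∑ i, ∑ k, (G x)⁻¹ i k * W x i j k = 0
  div_eq : ∀ x ∈ U, ∀ j, div2 G b x j = 2 * σ x j

namespace IsCodazziOn

variable {b : Coord n → Matrix (Fin n) (Fin n) ℝ} {σ : Coord n → Fin n → ℝ}
  {W : Coord n → Fin n → Fin n → Fin n → ℝ}

/-- Smoothness of σ, and below of W, is inherited from b and the metric, so the ambient Schouten and
Weyl tensors need no separate regularity argument. -/
theorem smooth_σ (h : IsCodazziOn G b σ W U) (hx : x ∈ U) (j : Fin n) :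
    ContDiffAt ℝ ∞ (fun y => σ y j) x := by
  have := (smooth_div2 h.metric hx (h.smooth x hx) j).const_smul (1 / 2 : ℝ)
  refine this.congr_of_eventuallyEq ?_
  filter_upwards [h.metric.mem_nhds hx] with y hy
  simp [h.div_eq y hy]

theorem smooth_W (h : IsCodazziOn G b σ W U) (hx : x ∈ U) (i j k : Fin n) :
    ContDiffAt ℝ ∞ (fun y => W y i j k) x := by
  have hn := fun i => smooth_nabla2 h.metric hx (h.smooth x hx) i
  have hg := h.metric.smooth x hx
  have : ContDiffAt ℝ ∞ (fun y => nabla2 G b y j i k - nabla2 G b y i j k +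
      σ y j * G y i k - σ y i * G y j k) x :=
    (((hn j i k).sub (hn i j k)).add ((h.smooth_σ hx j).mul (hg i k))).sub
      ((h.smooth_σ hx i).mul (hg j k))
  refine this.congr_of_eventuallyEq ?_
  filter_upwards [h.metric.mem_nhds hx] with y hy using h.codazzi y hy i j k

theorem nabla2_symm (h : IsCodazziOn G b σ W U) (hx : x ∈ U) (i : Fin n) :
    (nabla2 G b x i)ᵀ = nabla2 G b x i := by
  rw [nabla2_transpose]
  apply nabla2_congr
  filter_upwards [h.metric.mem_nhds hx] with y hy using h.symm y hy

/-- The Leibniz rule for b(δb): differentiating b gives |δb|², and differentiating δb = 2σ gives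
twice the pairing of b with ∇σ. -/
theorem div1_contraction (h : IsCodazziOn G b σ W U) (hx : x ∈ U) :
    div1 G (fun y i => - ∑ j, ∑ k, (G y)⁻¹ j k * b y i j * div2 G b y k) x =
      - 2 * inner2 G b (cov1 G σ) x - inner1 G (div2 G b) (div2 G b) x := by
  set δ : Coord n → Matrix (Fin n) Unit ℝ := fun y => Matrix.of fun j _ => div2 G b y j with hδ
  have hδs : SmoothMatAt δ x := fun j _ => smooth_div2 h.metric hx (h.smooth x hx) j
  have hbs := h.smooth x hx
  have hc : SmoothMatAt (fun y => b y * (G y)⁻¹ * δ y) x :=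
    (hbs.mul (h.metric.smooth_inv hx)).mul hδs
  have e1 : (fun y i => - ∑ j, ∑ k, (G y)⁻¹ j k * b y i j * div2 G b y k) =
      fun y i => (-1) * (b y * (G y)⁻¹ * δ y) i () := by
    funext y i
    simp only [Matrix.mul_apply, Finset.sum_mul, hδ, Matrix.of_apply, neg_one_mul]
    rw [Finset.sum_comm]
    simp only [mul_comm]
  -- The relation δb = 2σ holds on the whole open set, so it may be differentiated.
  have e2 : ∀ i j, nabla1 G δ x i j () = 2 * cov1 G σ x i j := by
    intro i j
    rw [← cov1_eq_nabla1, ← cov1_const_mul (fun i => h.smooth_σ hx i)]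
    apply cov1_congr
    filter_upwards [h.metric.mem_nhds hx] with y hy
    funext j
    exact h.div_eq y hy j
  rw [e1, div1_const_mul (fun i => hc i ())]
  simp only [div1, cov1_eq_nabla1, nabla1_contraction h.metric hx hbs hδs, Matrix.add_apply,
    mul_add, Finset.sum_add_distrib]
  rw [sum_contraction_eq_pair2 (h.metric.inv_symm hx)]
  have e3 : (Matrix.of fun i l => nabla1 G δ x i l ()) = (2 : ℝ) • Matrix.of (cov1 G σ x) := by
    ext i l; exact e2 i l
  have e4 : ∑ i, ∑ j, (G x)⁻¹ i j * (nabla2 G b x i * (G x)⁻¹ * δ x) j () =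
      inner1 G (div2 G b) (div2 G b) x := by
    simp only [inner1, Matrix.mul_assoc (nabla2 G b x _)]
    have : ∀ k, ((G x)⁻¹ * δ x) k () = ∑ l, (G x)⁻¹ k l * div2 G b x l := fun k => rfl
    calc _ = ∑ i, ∑ j, ∑ k, (G x)⁻¹ i j * nabla2 G b x i j k * ((G x)⁻¹ * δ x) k () := by
          refine Finset.sum_congr rfl fun i _ => Finset.sum_congr rfl fun j _ => ?_
          rw [Matrix.mul_apply, Finset.mul_sum]
          exact Finset.sum_congr rfl fun k _ => by ring
      _ = ∑ k, (∑ i, ∑ j, (G x)⁻¹ i j * nabla2 G b x i j k) * ((G x)⁻¹ * δ x) k () := by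
          rw [Finset.sum_congr rfl fun i _ => Finset.sum_comm, Finset.sum_comm]
          simp only [Finset.sum_mul]
      _ = _ := by
          simp only [← div2_eq, this, Finset.mul_sum]
          exact Finset.sum_congr rfl fun k _ => Finset.sum_congr rfl fun l _ => by ring
  rw [e3, pair2_smul_right, e4]
  change _ = -2 * pair2 (G x)⁻¹ (b x) (Matrix.of (cov1 G σ x)) - _
  ring

/-- The Leibniz rule is applied to each slice W_k as a 2-tensor. Its covariant derivative lacks the
Christoffel correction for the index k, which is supplied by the covariant derivative of the
resulting 1-form. -/
theorem pd_inner2_slice (h : IsCodazziOn G b σ W U) (hx : x ∈ U) (i k : Fin n) :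
    cov1 G (fun y k => inner2 G (fun y => W y k) b y) x i k =
      pair2 (G x)⁻¹ (Matrix.of fun j l => cov3 G W x i k j l) (b x) +
        pair2 (G x)⁻¹ (Matrix.of (W x k)) (nabla2 G b x i) := by
  have hW : ∀ k, SmoothMatAt (fun y => Matrix.of (W y k)) x := fun k j l => h.smooth_W hx k j l
  have e : (Matrix.of fun j l => cov3 G W x i k j l) =
      nabla2 G (fun y => Matrix.of (W y k)) x i -
        ∑ m, christoffel G x m i k • Matrix.of (W x m) := by
    ext j l
    rw [Matrix.sub_apply, ← cov2_eq_nabla2]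
    simp only [cov3, cov2, Matrix.of_apply, Matrix.sum_apply, Matrix.smul_apply, smul_eq_mul]
    ring
  have e2 : pd i (inner2 G (fun y => W y k) b) x = _ :=
    pd_inner2 h.metric hx (hW k) (h.smooth x hx) i
  rw [cov1, e, pair2_sub_left, pair2_sum_left]
  simp only [pair2_smul_left]
  rw [show pd i (fun y => inner2 G (fun y => W y k) b y) x = _ from e2]
  simp only [inner2, pair2, Matrix.of_apply]
  ring

/-- When the derivative falls on W it gives the pairing of b with div W. When it falls on b, W only
sees the trace-free skew part of ∇b, which is W itself up to a factor, and this produces |W|². -/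
theorem div1_W_contraction (h : IsCodazziOn G b σ W U) (hx : x ∈ U) :
    div1 G (fun y k => -2 * inner2 G (fun y => W y k) b y) x =
      - 2 * inner2 G b (div3 G W) x + inner3 G W W x := by
  have hq := h.metric.inv_symm hx
  have hs : ∀ k, ContDiffAt ℝ ∞ (fun y => inner2 G (fun y => W y k) b y) x := fun k =>
    smooth_inner2 h.metric hx (fun i j => h.smooth_W hx k i j) (h.smooth x hx)
  rw [div1_const_mul hs]
  simp only [div1, h.pd_inner2_slice hx, mul_add (((G x)⁻¹) _ _), Finset.sum_add_distrib]
  have e1 : ∑ i, ∑ k, (G x)⁻¹ i k * pair2 (G x)⁻¹ (Matrix.of fun j l => cov3 G W x i k j l) (b x) =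
      inner2 G b (div3 G W) x := by
    change _ = pair2 (G x)⁻¹ (b x) (Matrix.of (div3 G W x))
    have : Matrix.of (div3 G W x) =
        ∑ i, ∑ k, (G x)⁻¹ i k • Matrix.of fun j l => cov3 G W x i k j l := by
      ext j l
      simp only [div3, Matrix.sum_apply, Matrix.of_apply, Matrix.smul_apply, smul_eq_mul]
    rw [pair2_comm hq, this]
    simp only [pair2_sum_left, pair2_smul_left]
  have e2 := sum_pair2_antisymmetrization hq
    (Matrix.mul_nonsing_inv _ (h.metric.isUnit_det hx)) (h.metric.symm x hx)
    (fun i => nabla2 G b x i) (fun i => Matrix.of (W x i)) (σ x)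
    (fun i j k => h.codazzi x hx i j k) (h.trace_eq_zero x hx)
  have e3 : inner3 G W W x =
      ∑ k, ∑ k', (G x)⁻¹ k k' * pair2 (G x)⁻¹ (Matrix.of (W x k)) (Matrix.of (W x k')) := by
    rw [sum_pair2_eq_raise3]
    simp only [inner3, raise3, Finset.mul_sum, Matrix.of_apply]
    exact Finset.sum_congr rfl fun k _ => Finset.sum_congr rfl fun i' _ =>
      Finset.sum_congr rfl fun j' _ => Finset.sum_congr rfl fun k _ =>
      Finset.sum_congr rfl fun i' _ => Finset.sum_congr rfl fun j' _ => by ring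
  rw [e1, e3, ← e2]
  ring

/-- The relation between the three 1-forms whose divergences are compared. -/
theorem form_eq (h : IsCodazziOn G b σ W U) (hx : x ∈ U) (k : Fin n) :
    dform (inner2 G b b) x k - 2 * div2 G (fun y => b y * (G y)⁻¹ * b y) x k =
      - ∑ j, ∑ l, (G x)⁻¹ j l * b x k j * div2 G b x l + -2 * inner2 G (fun y => W y k) b x := by
  have hq := h.metric.inv_symm hx
  have hbs := h.smooth x hx
  have hb := h.symm x hx
  have hqg := Matrix.nonsing_inv_mul _ (h.metric.isUnit_det hx)
  have e1 : dform (inner2 G b b) x k = 2 * pair2 (G x)⁻¹ (nabla2 G b x k) (b x) := by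
    rw [dform, pd_inner2 h.metric hx hbs hbs]
    change pair2 (G x)⁻¹ (nabla2 G b x k) (b x) + pair2 (G x)⁻¹ (b x) (nabla2 G b x k) = _
    rw [pair2_comm hq (b x)]
    ring
  have e2 : ∑ i, ∑ j, (G x)⁻¹ i j * (nabla2 G b x i * (G x)⁻¹ * b x) j k =
      ∑ j, ∑ l, (G x)⁻¹ j l * b x k j * div2 G b x l := by
    calc _ = ∑ i, ∑ j, ∑ l, (G x)⁻¹ i j * nabla2 G b x i j l * ((G x)⁻¹ * b x) l k := by
          refine Finset.sum_congr rfl fun i _ => Finset.sum_congr rfl fun j _ => ?_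
          rw [Matrix.mul_assoc, Matrix.mul_apply, Finset.mul_sum]
          exact Finset.sum_congr rfl fun k _ => by ring
      _ = ∑ l, div2 G b x l * ((G x)⁻¹ * b x) l k := by
          rw [Finset.sum_congr rfl fun i _ => Finset.sum_comm, Finset.sum_comm]
          simp only [← Finset.sum_mul, ← div2_eq]
      _ = _ := by
          rw [Finset.sum_comm]
          refine Finset.sum_congr rfl fun l _ => ?_
          rw [Matrix.mul_apply, Finset.mul_sum]
          refine Finset.sum_congr rfl fun j _ => ?_
          rw [h.metric.inv_apply_symm hx j l, ← congrFun₂ hb k j, Matrix.transpose_apply]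
          ring
  -- Contraction of the Codazzi relation with b. The final zero is the trace of b, the coefficient
  -- of σ_k.
  have e3 : pair2 (G x)⁻¹ (Matrix.of (W x k)) (b x) =
      pair2 (G x)⁻¹ (b x) (Matrix.of fun i l => nabla2 G b x i l k) -
        pair2 (G x)⁻¹ (nabla2 G b x k) (b x) +
        pair2 (G x)⁻¹ (b x) (Matrix.of fun i l => σ x i * G x l k) - σ x k * 0 := by
    have hm : pair2 (G x)⁻¹ (G x) (b x) = 0 := by
      rw [pair2_metric_left hq hqg, h.traceFree x hx]
    have : Matrix.of (W x k) = (Matrix.of fun i l => nabla2 G b x i l k) - nabla2 G b x k +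
        (Matrix.of fun i l => σ x i * G x l k) - σ x k • G x := by
      ext i l
      simp only [Matrix.sub_apply, Matrix.add_apply, Matrix.of_apply, Matrix.smul_apply,
        smul_eq_mul, h.codazzi x hx]
      rw [← congrFun₂ (h.nabla2_symm hx i) k l, Matrix.transpose_apply,
        h.metric.apply_symm hx k l]
    rw [this, pair2_sub_left, pair2_add_left, pair2_sub_left, pair2_smul_left, hm,
      pair2_comm hq (b x), pair2_comm hq (b x)]
  -- The factor one half comes from σ = δb / 2. Together with twice `e2` this leaves a single copy
  -- of b(δb) in the result.
  have e4 : pair2 (G x)⁻¹ (b x) (Matrix.of fun i l => σ x i * G x l k) =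
      (1 / 2) * ∑ j, ∑ l, (G x)⁻¹ j l * b x k j * div2 G b x l := by
    have := sum_contraction_eq_pair2 hq (b x) (fun i => σ x i • G x) k
    rw [show (Matrix.of fun i l => σ x i * G x l k) =
      Matrix.of fun i l => (σ x i • G x) l k from rfl, ← this]
    simp only [Matrix.mul_smul, Matrix.mul_assoc, hqg, Matrix.mul_one, Matrix.smul_apply,
      smul_eq_mul, h.div_eq x hx]
    rw [Finset.sum_comm, Finset.mul_sum]
    refine Finset.sum_congr rfl fun j _ => ?_
    rw [Finset.mul_sum]
    refine Finset.sum_congr rfl fun l _ => ?_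
    rw [h.metric.inv_apply_symm hx j l, ← congrFun₂ hb k j, Matrix.transpose_apply]
    ring
  rw [div2_eq]
  simp only [nabla2_contraction h.metric hx hbs hbs, Matrix.add_apply, mul_add,
    Finset.sum_add_distrib]
  rw [sum_contraction_eq_pair2 hq, e1, e2]
  change _ = _ + -2 * pair2 (G x)⁻¹ (Matrix.of (W x k)) (b x)
  rw [e3, e4]
  ring

end IsCodazziOn

end DivergenceFormulas

/-! ### The coordinate hypersurface as an instance of the Codazzi structure. -/

namespace LocalHypersurface

open Matrix

variable (S : LocalHypersurface)

/-- The normal vector field as a column matrix. -/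
def normalCol (x : Coord 3) : Matrix (Fin 4) Unit ℝ := Matrix.of fun a _ => S.normal x a

/-- Smoothness and nondegeneracy of the coordinate expressions of a hypersurface. -/
structure IsRegularOn (U : Set (Coord 3)) (V : Set (Coord 4)) : Prop where
  isometric : IsIsometricOn S.h S.ambient S.param U V
  normal : IsUnitNormalOn S.ambient S.param S.normalCol U

theorem h_eq (x : Coord 3) :
    S.h x = (jac S.param x)ᵀ * S.ambient (S.param x) * jac S.param x := by
  ext i j
  simp only [h, tangent, Matrix.mul_apply, Matrix.transpose_apply, jac, Matrix.of_apply,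
    Finset.sum_mul]
  rw [Finset.sum_comm]
  exact Finset.sum_congr rfl fun b _ => Finset.sum_congr rfl fun a _ => by ring

/-- A hypersurface is regular if its ingredients are smooth and nondegenerate. -/
theorem isRegularOn_of {U : Set (Coord 3)} {V : Set (Coord 4)} (hU : IsOpen U)
    (hK : IsMetricOn S.ambient V) (hm : ∀ x ∈ U, S.param x ∈ V)
    (hs : ∀ x ∈ U, ContDiffAt ℝ ∞ S.param x) (hd : ∀ x ∈ U, (S.h x).det ≠ 0)
    (hN : IsUnitNormalOn S.ambient S.param S.normalCol U) : S.IsRegularOn U V where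
  isometric :=
    { source :=
        { isOpen := hU
          smooth := fun x hx => by
            have h1 : SmoothMatAt (fun y => S.ambient (S.param y)) x :=
              (hK.smooth _ (hm x hx)).comp (hs x hx)
            have h2 := smooth_jac (hs x hx)
            exact ((h2.transpose.mul h1).mul h2).congr (Filter.Eventually.of_forall S.h_eq)
          symm := fun x hx => by
            simp only [h_eq, Matrix.transpose_mul, Matrix.transpose_transpose,
              hK.symm _ (hm x hx), Matrix.mul_assoc]
          det_ne_zero := hd }
      target := hK
      mapsTo := hm
      smooth := hs
      pullback := fun x _ => S.h_eq x }
  normal := hN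

theorem ambientCov_eq (x : Coord 3) (i j : Fin 3) (a : Fin 4) :
    S.ambientCov x i j a = secondDeriv S.ambient S.param x i a j := by
  simp only [ambientCov, secondDeriv, Matrix.add_apply, Matrix.mul_apply, pullConn,
    Matrix.sum_apply, Matrix.smul_apply, smul_eq_mul, Finset.sum_mul]
  rw [Finset.sum_comm]
  congr 1
  refine Finset.sum_congr rfl fun d _ => Finset.sum_congr rfl fun c _ => ?_
  simp only [connMat, jac, tangent, Matrix.of_apply]
  ring

theorem normal_pairing {τ : Type*} (x : Coord 3) (B : Matrix (Fin 4) τ ℝ) (t : τ)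
    (hK : (S.ambient (S.param x))ᵀ = S.ambient (S.param x)) :
    ((S.normalCol x)ᵀ * S.ambient (S.param x) * B) () t =
      ∑ a, ∑ b, S.ambient (S.param x) a b * B a t * S.normal x b := by
  simp only [Matrix.mul_apply, Matrix.transpose_apply, Finset.sum_mul]
  refine Finset.sum_congr rfl fun a _ => Finset.sum_congr rfl fun b _ => ?_
  rw [← congrFun₂ hK b a, Matrix.transpose_apply]
  simp only [normalCol, Matrix.of_apply]
  ring

variable {S} {U : Set (Coord 3)} {V : Set (Coord 4)} {x : Coord 3}

namespace IsRegularOn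

theorem ambient_symm (hS : S.IsRegularOn U V) (hx : x ∈ U) :
    (S.ambient (S.param x))ᵀ = S.ambient (S.param x) :=
  hS.isometric.target.symm _ (hS.isometric.mapsTo x hx)

theorem L_eq (hS : S.IsRegularOn U V) (hx : x ∈ U) (i j : Fin 3) :
    S.L x i j = secondForm S.ambient S.param S.normalCol x i () j := by
  rw [secondForm, Matrix.neg_apply, S.normal_pairing x _ _ (hS.ambient_symm hx)]
  simp only [L, ambientCov_eq]

theorem L_symm (hS : S.IsRegularOn U V) (hx : x ∈ U) (i j : Fin 3) : S.L x i j = S.L x j i := by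
  simp only [L, ambientCov_eq, hS.isometric.secondDeriv_symm hx i j]

theorem smooth_L (hS : S.IsRegularOn U V) (hx : x ∈ U) :
    SmoothMatAt (fun y => Matrix.of (S.L y)) x := by
  intro i j
  refine (hS.normal.smooth_secondForm hS.isometric hx i () j).congr_of_eventuallyEq ?_
  filter_upwards [hS.isometric.source.mem_nhds hx] with y hy using hS.L_eq hy i j

theorem H_eq (hS : S.IsRegularOn U V) (hx : x ∈ U) :
    S.H x = ((S.h x)⁻¹ * Matrix.of (S.L x)).trace / 3 := by
  simp only [H, Matrix.trace, Matrix.diag_apply, Matrix.mul_apply, Matrix.of_apply]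
  congr 1
  exact Finset.sum_congr rfl fun i _ => Finset.sum_congr rfl fun j _ => by
    rw [hS.L_symm hx]

theorem smooth_H (hS : S.IsRegularOn U V) (hx : x ∈ U) : ContDiffAt ℝ ∞ S.H x := by
  refine ContDiffAt.congr_of_eventuallyEq (f := fun y =>
    ((S.h y)⁻¹ * Matrix.of (S.L y)).trace / 3) ?_ ?_
  · exact (((hS.isometric.source.smooth_inv hx).mul (hS.smooth_L hx)).trace).div_const 3
  · filter_upwards [hS.isometric.source.mem_nhds hx] with y hy using hS.H_eq hy

theorem smooth_Lo (hS : S.IsRegularOn U V) (hx : x ∈ U) :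
    SmoothMatAt (fun y => Matrix.of (S.Lo y)) x :=
  (hS.smooth_L hx).sub ((hS.isometric.source.smooth x hx).smul (hS.smooth_H hx))

theorem Lo_symm (hS : S.IsRegularOn U V) (hx : x ∈ U) : (Matrix.of (S.Lo x))ᵀ = S.Lo x := by
  ext i j
  simp only [Matrix.transpose_apply, Matrix.of_apply, Lo]
  rw [hS.L_symm hx j i, hS.isometric.source.apply_symm hx j i]

theorem Lo_traceFree (hS : S.IsRegularOn U V) (hx : x ∈ U) :
    ((S.h x)⁻¹ * Matrix.of (S.Lo x)).trace = 0 := by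
  have e : Matrix.of (S.Lo x) = Matrix.of (S.L x) - S.H x • S.h x := rfl
  rw [e, Matrix.mul_sub, Matrix.mul_smul,
    Matrix.nonsing_inv_mul _ (hS.isometric.source.isUnit_det hx), Matrix.trace_sub,
    Matrix.trace_smul, Matrix.trace_one, hS.H_eq hx]
  simp

theorem ambient_tangent_normal (hS : S.IsRegularOn U V) (hx : x ∈ U) (i : Fin 3) :
    ∑ a, ∑ b, S.ambient (S.param x) a b * S.tangent x i a * S.normal x b = 0 := by
  have := congrFun₂ (hS.normal.normal x hx) () i
  rw [S.normal_pairing x _ _ (hS.ambient_symm hx)] at this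
  exact this

end IsRegularOn

variable (S) in
/-- The component `R̄(∂ᵢ, ∂ⱼ, ∂ₖ, N)` of the ambient curvature tensor. -/
def curvNormal (x : Coord 3) (i j k : Fin 3) : ℝ :=
  ∑ a, ∑ b, ∑ c, ∑ d, riemann S.ambient (S.param x) a b c d *
    S.tangent x i a * S.tangent x j b * S.tangent x k c * S.normal x d

variable (S) in
/-- The 1-form `Ric(·, N)`. -/
def ricciNormal (x : Coord 3) (j : Fin 3) : ℝ :=
  ∑ a, ∑ b, ricci S.ambient (S.param x) a b * S.tangent x j a * S.normal x b

namespace IsRegularOn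

/-- Identifies the component sum with the matrix expression on the right of the Codazzi equation. -/
theorem curvNormal_eq (hS : S.IsRegularOn U V) (hx : x ∈ U) (i j k : Fin 3) :
    S.curvNormal x i j k = ((S.normalCol x)ᵀ * S.ambient (S.param x) *
      (pullCurv S.ambient S.param x i j * jac S.param x)) () k := by
  have hV := hS.isometric.mapsTo x hx
  have e : ∀ d c, (S.ambient (S.param x) * pullCurv S.ambient S.param x i j) d c =
      ∑ a, ∑ b, riemann S.ambient (S.param x) a b c d *
        S.tangent x i a * S.tangent x j b := by
    intro d c
    simp only [pullCurv, Matrix.mul_sum, Matrix.mul_smul, Matrix.sum_apply, Matrix.smul_apply,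
      smul_eq_mul, riemann_eq hS.isometric.target hV, jac, tangent, Matrix.of_apply]
    exact Finset.sum_congr rfl fun a _ => Finset.sum_congr rfl fun b _ => by ring
  rw [Matrix.mul_assoc, ← Matrix.mul_assoc (S.ambient (S.param x)), Matrix.mul_apply]
  have e2 : ∀ d, (S.ambient (S.param x) * pullCurv S.ambient S.param x i j * jac S.param x) d k =
      ∑ c, ∑ a, ∑ b, riemann S.ambient (S.param x) a b c d *
        S.tangent x i a * S.tangent x j b * S.tangent x k c := by
    intro d
    rw [Matrix.mul_apply]
    refine Finset.sum_congr rfl fun c _ => ?_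
    rw [e, Finset.sum_mul]
    refine Finset.sum_congr rfl fun a _ => ?_
    rw [Finset.sum_mul]
    rfl
  rw [curvNormal, sum_pair_comm, Finset.sum_comm]
  refine Finset.sum_congr rfl fun d _ => ?_
  rw [e2, Finset.mul_sum]
  refine Finset.sum_congr rfl fun c _ => ?_
  rw [Finset.mul_sum]
  refine Finset.sum_congr rfl fun a _ => ?_
  rw [Finset.mul_sum]
  refine Finset.sum_congr rfl fun b _ => ?_
  simp only [normalCol, Matrix.transpose_apply, Matrix.of_apply]
  ring

/-- The matrix Codazzi equation differentiates only the second slot of L covariantly. The correction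
for the first slot is symmetric in i, j and cancels, so full covariant derivatives may be used. -/
theorem nabla2_L_antisymm (hS : S.IsRegularOn U V) (hx : x ∈ U) (i j k : Fin 3) :
    nabla2 S.h (fun y => Matrix.of (S.L y)) x i j k -
      nabla2 S.h (fun y => Matrix.of (S.L y)) x j i k =
      - S.curvNormal x i j k := by
  have hc := congrFun₂ (hS.normal.codazzi hS.isometric hx i j) () k
  have hd : ∀ i j, dmat i (fun y => secondForm S.ambient S.param S.normalCol y j) x () k =
      dmat i (fun y => Matrix.of (S.L y)) x j k := by
    intro i j
    apply pd_congr
    filter_upwards [hS.isometric.source.mem_nhds hx] with y hy using (hS.L_eq hy j k).symm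
  have hm : ∀ i j, (secondForm S.ambient S.param S.normalCol x j * connMat S.h x i) () k =
      (Matrix.of (S.L x) * connMat S.h x i) j k := by
    intro i j
    rw [Matrix.mul_apply, Matrix.mul_apply]
    exact Finset.sum_congr rfl fun m _ => by rw [← hS.L_eq hx, Matrix.of_apply]
  have ht : ((connMat S.h x i)ᵀ * Matrix.of (S.L x)) j k =
      ((connMat S.h x j)ᵀ * Matrix.of (S.L x)) i k := by
    rw [Matrix.mul_apply, Matrix.mul_apply]
    exact Finset.sum_congr rfl fun m _ => by
      rw [Matrix.transpose_apply, Matrix.transpose_apply,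
        connMat_symm hS.isometric.source hx]
  rw [Matrix.neg_apply, ← hS.curvNormal_eq hx, Matrix.sub_apply, Matrix.sub_apply,
    Matrix.sub_apply, hd, hd, hm, hm] at hc
  rw [← hc, nabla2, nabla2]
  simp only [Matrix.sub_apply, ht]
  ring

/-- Pushed into the ambient space, h⁻¹ becomes K⁻¹ - NNᵀ. The first term gives a Ricci contraction,
and the second vanishes by skewness of the curvature in its last two slots. -/
theorem sum_metric_curvNormal (hS : S.IsRegularOn U V) (hx : x ∈ U) (j : Fin 3) :
    ∑ i, ∑ k, (S.h x)⁻¹ i k * S.curvNormal x i j k = - S.ricciNormal x j := by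
  have hV := hS.isometric.mapsTo x hx
  have hK := hS.isometric.target
  set K := S.ambient (S.param x) with hKd
  have hc : jac S.param x * (S.h x)⁻¹ * (jac S.param x)ᵀ =
      K⁻¹ - S.normalCol x * (S.normalCol x)ᵀ := by
    have hi : K * K⁻¹ = 1 := Matrix.mul_nonsing_inv _ (hK.isUnit_det hV)
    have h1 := congrArg (· * K⁻¹) (hS.normal.completeness hS.isometric hx)
    simp only [Matrix.add_mul, Matrix.mul_assoc, ← hKd, hi,
      Matrix.mul_one, Matrix.one_mul] at h1
    rw [← h1, Matrix.mul_assoc]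
    abel
  have hc2 : ∀ a c, ∑ i, ∑ k, (S.h x)⁻¹ i k * S.tangent x i a * S.tangent x k c =
      K⁻¹ a c - S.normal x a * S.normal x c := by
    intro a c
    have := congrFun₂ hc a c
    simp only [Matrix.sub_apply, Matrix.mul_apply, Finset.univ_unique, Finset.sum_singleton,
      Finset.sum_mul, Matrix.transpose_apply, normalCol, jac, Matrix.of_apply] at this
    rw [← this, Finset.sum_comm]
    exact Finset.sum_congr rfl fun i _ => Finset.sum_congr rfl fun k _ => by
      simp only [tangent]; ring
  -- The sign arises because the Ricci tensor contracts the first slot with the fourth, while here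
  -- the first is contracted with the third.
  have hr : ∀ b d, ∑ a, ∑ c, riemann S.ambient (S.param x) a b c d * K⁻¹ a c =
      - ricci S.ambient (S.param x) b d := by
    intro b d
    have h1 : ∀ a, ∑ c, riemann S.ambient (S.param x) a b d c * K⁻¹ a c =
        riemannUp S.ambient (S.param x) a b d a := by
      intro a
      have h2 : ∀ c, riemann S.ambient (S.param x) a b d c * K⁻¹ a c =
          K⁻¹ a c * (K * curvMat S.ambient (S.param x) a b) c d := by
        intro c; rw [riemann_eq hK hV, mul_comm]
      simp only [h2]
      rw [← Matrix.mul_apply, ← Matrix.mul_assoc, Matrix.nonsing_inv_mul _ (hK.isUnit_det hV),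
        Matrix.one_mul]
      rfl
    simp only [riemann_skew hK hV _ b _ d, neg_mul, Finset.sum_neg_distrib, h1]
    rfl
  have hz : ∀ a b, ∑ c, ∑ d, riemann S.ambient (S.param x) a b c d * S.normal x c * S.normal x d
      = 0 := by
    intro a b
    have : ∑ c, ∑ d, riemann S.ambient (S.param x) a b c d * S.normal x c * S.normal x d =
        - ∑ c, ∑ d, riemann S.ambient (S.param x) a b c d * S.normal x c * S.normal x d := by
      conv_lhs => rw [Finset.sum_comm]
      simp only [← Finset.sum_neg_distrib]
      exact Finset.sum_congr rfl fun c _ => Finset.sum_congr rfl fun d _ => by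
        rw [riemann_skew hK hV a b d c]; ring
    linarith
  calc ∑ i, ∑ k, (S.h x)⁻¹ i k * S.curvNormal x i j k
      = ∑ b, ∑ d, (∑ a, ∑ c, riemann S.ambient (S.param x) a b c d *
          ∑ i, ∑ k, (S.h x)⁻¹ i k * S.tangent x i a * S.tangent x k c) *
            (S.tangent x j b * S.normal x d) := by
        simp only [curvNormal, Finset.mul_sum, Finset.sum_mul]
        rw [sum_pair_comm, Finset.sum_congr rfl fun a _ =>
          Finset.sum_congr rfl fun b _ => sum_pair_comm _, Finset.sum_comm]
        refine Finset.sum_congr rfl fun b _ => ?_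
        conv_rhs => rw [sum_rotate]
        refine Finset.sum_congr rfl fun a _ => Finset.sum_congr rfl fun c _ =>
          Finset.sum_congr rfl fun d _ => Finset.sum_congr rfl fun i _ =>
          Finset.sum_congr rfl fun k _ => by ring
    _ = ∑ b, ∑ d, (- ricci S.ambient (S.param x) b d) * (S.tangent x j b * S.normal x d) -
          ∑ b, ∑ a, S.tangent x j b * S.normal x a *
            ∑ c, ∑ d, riemann S.ambient (S.param x) a b c d * S.normal x c * S.normal x d := by
        simp only [hc2, mul_sub, Finset.sum_sub_distrib, hr, sub_mul]
        congr 1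
        refine Finset.sum_congr rfl fun b _ => ?_
        simp only [Finset.mul_sum, Finset.sum_mul]
        rw [sum_rotate]
        refine Finset.sum_congr rfl fun a _ => Finset.sum_congr rfl fun c _ =>
          Finset.sum_congr rfl fun d _ => by ring
    _ = - S.ricciNormal x j := by
        simp only [hz, mul_zero, Finset.sum_const_zero, sub_zero, ricciNormal,
          ← Finset.sum_neg_distrib]
        exact Finset.sum_congr rfl fun b _ => Finset.sum_congr rfl fun d _ => by ring

/-- The trace part of the Schouten tensor is a multiple of the metric and vanishes on a tangent and
a normal vector. The denominator is 4 - 2. -/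
theorem P0_eq (hS : S.IsRegularOn U V) (hx : x ∈ U) (j : Fin 3) :
    S.P0 x j = S.ricciNormal x j / 2 := by
  have h := hS.ambient_tangent_normal hx j
  have e : S.P0 x j = (S.ricciNormal x j - schoutenTrace S.ambient (S.param x) *
      ∑ a, ∑ b, S.ambient (S.param x) a b * S.tangent x j a * S.normal x b) / 2 := by
    simp only [P0, ricciNormal, schouten, Finset.mul_sum, ← Finset.sum_sub_distrib,
      Finset.sum_div]
    refine Finset.sum_congr rfl fun a _ => Finset.sum_congr rfl fun b _ => ?_
    push_cast
    ring
  rw [e, h]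
  ring

/-- Of the four Schouten terms, the two containing g(∂ᵢ, N) or g(∂ⱼ, N) vanish. -/
theorem W0_eq (hS : S.IsRegularOn U V) (hx : x ∈ U) (i j k : Fin 3) :
    S.W0 x i j k = S.curvNormal x i j k + S.P0 x j * S.h x i k - S.P0 x i * S.h x j k := by
  have h := fun i => hS.ambient_tangent_normal hx i
  have e : S.W0 x i j k = S.curvNormal x i j k
      + (∑ a, ∑ c, schouten S.ambient (S.param x) a c * S.tangent x i a * S.tangent x k c) *
        (∑ b, ∑ d, S.ambient (S.param x) b d * S.tangent x j b * S.normal x d)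
      - (∑ b, ∑ c, schouten S.ambient (S.param x) b c * S.tangent x j b * S.tangent x k c) *
        (∑ a, ∑ d, S.ambient (S.param x) a d * S.tangent x i a * S.normal x d)
      + S.P0 x j * S.h x i k - S.P0 x i * S.h x j k := by
    have hs : ∀ f g : Fin 4 → Fin 4 → ℝ, ∑ a, ∑ b, ∑ c, ∑ d, f b c * g a d =
        (∑ b, ∑ c, f b c) * ∑ a, ∑ d, g a d := fun f g => by
      rw [Finset.sum_comm, sum_mul_sum_pair]
    have h4 : ∀ i j, S.P0 x j * S.h x i k = ∑ a, ∑ b, ∑ c, ∑ d,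
        (S.ambient (S.param x) a c * S.tangent x i a * S.tangent x k c) *
          (schouten S.ambient (S.param x) b d * S.tangent x j b * S.normal x d) := fun i j => by
      rw [sum_mul_sum_pair, mul_comm]
      rfl
    have h5 : S.P0 x i * S.h x j k = ∑ a, ∑ b, ∑ c, ∑ d,
        (S.ambient (S.param x) b c * S.tangent x j b * S.tangent x k c) *
          (schouten S.ambient (S.param x) a d * S.tangent x i a * S.normal x d) := by
      rw [h4, Finset.sum_comm]
    rw [← sum_mul_sum_pair, ← hs, h4, h5]
    simp only [W0, curvNormal, weyl, ← Finset.sum_add_distrib, ← Finset.sum_sub_distrib]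
    refine Finset.sum_congr rfl fun a _ => Finset.sum_congr rfl fun b _ =>
      Finset.sum_congr rfl fun c _ => Finset.sum_congr rfl fun d _ => by ring
  rw [e, h, h]
  ring

theorem sum_inv_mul_metric_row (hS : S.IsRegularOn U V) (hx : x ∈ U) (j i : Fin 3) :
    ∑ k, (S.h x)⁻¹ i k * S.h x j k = (1 : Matrix (Fin 3) (Fin 3) ℝ) i j := by
  have hm := hS.isometric.source
  rw [← Matrix.nonsing_inv_mul _ (hm.isUnit_det hx), Matrix.mul_apply]
  exact Finset.sum_congr rfl fun k _ => by rw [hm.apply_symm hx j k]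

theorem sum_inv_mul_metric (hS : S.IsRegularOn U V) (hx : x ∈ U) :
    ∑ i, ∑ k, (S.h x)⁻¹ i k * S.h x i k = 3 := by
  simp [fun i => hS.sum_inv_mul_metric_row hx i i]

/-- The trace is -Ric(·, N) + (3 - 1)P̄₀, which is zero by `P0_eq`. -/
theorem W0_trace (hS : S.IsRegularOn U V) (hx : x ∈ U) (j : Fin 3) :
    ∑ i, ∑ k, (S.h x)⁻¹ i k * S.W0 x i j k = 0 := by
  have h1 := hS.sum_inv_mul_metric hx
  have h2 := hS.sum_inv_mul_metric_row hx j
  have e : ∑ i, ∑ k, (S.h x)⁻¹ i k * S.W0 x i j k =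
      ∑ i, ∑ k, (S.h x)⁻¹ i k * S.curvNormal x i j k
      + S.P0 x j * ∑ i, ∑ k, (S.h x)⁻¹ i k * S.h x i k
      - ∑ i, S.P0 x i * ∑ k, (S.h x)⁻¹ i k * S.h x j k := by
    simp only [hS.W0_eq hx, Finset.mul_sum, ← Finset.sum_add_distrib, ← Finset.sum_sub_distrib]
    exact Finset.sum_congr rfl fun i _ => Finset.sum_congr rfl fun k _ => by ring
  rw [e, hS.sum_metric_curvNormal hx, h1]
  simp only [h2, Matrix.one_apply, mul_ite, mul_one, mul_zero, Finset.sum_ite_eq',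
    Finset.mem_univ, if_true, hS.P0_eq hx]
  ring

/-- Since ∇h = 0, replacing L by its trace-free part only adds terms with dH, which join P̄₀ in σ.
-/
theorem W0_eq_nabla2_Lo (hS : S.IsRegularOn U V) (hx : x ∈ U) (i j k : Fin 3) :
    S.W0 x i j k = nabla2 S.h (fun y => Matrix.of (S.Lo y)) x j i k -
      nabla2 S.h (fun y => Matrix.of (S.Lo y)) x i j k +
      (dform S.H x j + S.P0 x j) * S.h x i k - (dform S.H x i + S.P0 x i) * S.h x j k := by
  have hm := hS.isometric.source
  have e : ∀ i j k, nabla2 S.h (fun y => Matrix.of (S.Lo y)) x i j k =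
      nabla2 S.h (fun y => Matrix.of (S.L y)) x i j k - dform S.H x i * S.h x j k := by
    intro i j k
    have h1 : nabla2 S.h (fun y => Matrix.of (S.Lo y)) x i =
        nabla2 S.h (fun y => Matrix.of (S.L y) - S.H y • S.h y) x i := rfl
    rw [h1, nabla2_sub (hS.smooth_L hx) ((hm.smooth x hx).smul (hS.smooth_H hx)),
      nabla2_smul (hS.smooth_H hx) (hm.smooth x hx), nabla2_metric hm hx]
    simp [dform]
  rw [hS.W0_eq hx, e, e]
  linear_combination hS.nabla2_L_antisymm hx i j k

/-- The contracted Codazzi equation: tracing `W0_eq_nabla2_Lo` over i, k, the left side vanishes,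
the term ∇ⱼ tr b vanishes, and 3σ - σ remains against the divergence. -/
theorem div2_Lo (hS : S.IsRegularOn U V) (hx : x ∈ U) (j : Fin 3) :
    div2 S.h S.Lo x j = 2 * (dform S.H x j + S.P0 x j) := by
  have hm := hS.isometric.source
  set σ := fun j => dform S.H x j + S.P0 x j with hσ
  set A := nabla2 S.h (fun y => Matrix.of (S.Lo y)) x with hA
  have hs : ∀ i, (A i)ᵀ = A i := by
    intro i
    rw [hA, nabla2_transpose]
    apply nabla2_congr
    filter_upwards [hm.mem_nhds hx] with y hy using hS.Lo_symm hy
  have h0 : ∑ i, ∑ k, (S.h x)⁻¹ i k * A j i k = 0 := by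
    have h1 := pd_metricTrace hm hx (hS.smooth_Lo hx) j
    have h2 : pd j (fun y => ((S.h y)⁻¹ * Matrix.of (S.Lo y)).trace) x = 0 := by
      rw [pd_congr (g := fun _ => 0) j, pd_const]
      filter_upwards [hm.mem_nhds hx] with y hy using hS.Lo_traceFree hy
    rw [h2] at h1
    rw [h1]
    simp only [Matrix.trace, Matrix.diag_apply, Matrix.mul_apply]
    exact Finset.sum_congr rfl fun i _ => Finset.sum_congr rfl fun k _ => by
      rw [← congrFun₂ (hs j) i k, Matrix.transpose_apply]
  have h1 := hS.sum_inv_mul_metric hx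
  have h2 := hS.sum_inv_mul_metric_row hx j
  have hd : div2 S.h S.Lo x j = ∑ i, ∑ k, (S.h x)⁻¹ i k * A i j k := by
    rw [show div2 S.h S.Lo x j = _ from div2_eq S.h (fun y => Matrix.of (S.Lo y)) x j]
    exact Finset.sum_congr rfl fun i _ => Finset.sum_congr rfl fun k _ => by
      rw [← congrFun₂ (hs i) j k, Matrix.transpose_apply]
  have e : ∑ i, ∑ k, (S.h x)⁻¹ i k * S.W0 x i j k =
      ∑ i, ∑ k, (S.h x)⁻¹ i k * A j i k - ∑ i, ∑ k, (S.h x)⁻¹ i k * A i j k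
      + σ j * ∑ i, ∑ k, (S.h x)⁻¹ i k * S.h x i k
      - ∑ i, σ i * ∑ k, (S.h x)⁻¹ i k * S.h x j k := by
    simp only [hS.W0_eq_nabla2_Lo hx, Finset.mul_sum, ← Finset.sum_add_distrib,
      ← Finset.sum_sub_distrib]
    exact Finset.sum_congr rfl fun i _ => Finset.sum_congr rfl fun k _ => by ring
  rw [hS.W0_trace hx, h0, ← hd, h1] at e
  simp only [h2, Matrix.one_apply, mul_ite, mul_one, mul_zero, Finset.sum_ite_eq',
    Finset.mem_univ, if_true] at e
  linarith

theorem isCodazziOn (hS : S.IsRegularOn U V) :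
    IsCodazziOn S.h S.Lo (fun x j => dform S.H x j + S.P0 x j) S.W0 U where
  metric := hS.isometric.source
  smooth := fun _ hx => hS.smooth_Lo hx
  symm := fun _ hx => hS.Lo_symm hx
  traceFree := fun _ hx => hS.Lo_traceFree hx
  codazzi := fun _ hx => hS.W0_eq_nabla2_Lo hx
  trace_eq_zero := fun _ hx => hS.W0_trace hx
  div_eq := fun _ hx => hS.div2_Lo hx

/-- Obtained as σ - dH, with σ already smooth as half of the divergence of b. -/
theorem smooth_P0 (hS : S.IsRegularOn U V) (hx : x ∈ U) (j : Fin 3) :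
    ContDiffAt ℝ ∞ (fun y => S.P0 y j) x := by
  have := (hS.isCodazziOn.smooth_σ hx j).sub (contDiffAt_pd j (hS.smooth_H hx))
  refine this.congr_of_eventuallyEq (Filter.Eventually.of_forall fun y => ?_)
  simp [dform]

end IsRegularOn

variable (S) in
theorem LoSq_eq (x : Coord 3) :
    Matrix.of (S.LoSq x) = Matrix.of (S.Lo x) * (S.h x)⁻¹ * Matrix.of (S.Lo x) := by
  ext i j
  simp only [LoSq, Matrix.of_apply, Matrix.mul_apply, Finset.sum_mul]
  rw [Finset.sum_comm]
  exact Finset.sum_congr rfl fun l _ => Finset.sum_congr rfl fun k _ => by ring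

variable (S) in
theorem formRhs₂_eq (x : Coord 3) (k : Fin 3) :
    S.formRhs₂ x k = -2 * inner2 S.h (fun y => S.W0 y k) S.Lo x := by
  simp only [formRhs₂, inner2]
  congr 1
  refine Finset.sum_congr rfl fun i _ => Finset.sum_congr rfl fun j _ =>
    Finset.sum_congr rfl fun i' _ => Finset.sum_congr rfl fun j' _ => by ring

namespace IsRegularOn

theorem div1_formRhs₁ (hS : S.IsRegularOn U V) (hx : x ∈ U) :
    div1 S.h S.formRhs₁ x = S.rhs₁ x := by
  rw [show S.formRhs₁ = fun y i => - ∑ j, ∑ k, (S.h y)⁻¹ j k * S.Lo y i j * div2 S.h S.Lo y k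
    from rfl, hS.isCodazziOn.div1_contraction hx, rhs₁]
  have e : (Matrix.of (cov1 S.h (fun x j => dform S.H x j + S.P0 x j) x)) =
      Matrix.of (hess S.h S.H x) + Matrix.of (cov1 S.h S.P0 x) := by
    ext i j
    exact cov1_add (fun i => contDiffAt_pd i (hS.smooth_H hx)) (hS.smooth_P0 hx) i j
  have e2 := (congrArg (pair2 (S.h x)⁻¹ (S.Lo x)) e).trans (pair2_add_right _ _ _)
  change inner2 S.h S.Lo (cov1 S.h _) x = inner2 S.h S.Lo (hess S.h S.H) x +
    inner2 S.h S.Lo (cov1 S.h S.P0) x at e2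
  rw [e2]
  ring

theorem div1_formRhs₂ (hS : S.IsRegularOn U V) (hx : x ∈ U) :
    div1 S.h S.formRhs₂ x = S.rhs₂ x := by
  rw [show S.formRhs₂ = fun y k => -2 * inner2 S.h (fun y => S.W0 y k) S.Lo y
    from funext₂ S.formRhs₂_eq, hS.isCodazziOn.div1_W_contraction hx, rhs₂]

theorem formLhs_eq (hS : S.IsRegularOn U V) (hx : x ∈ U) (k : Fin 3) :
    S.formLhs x k = S.formRhs₁ x k + S.formRhs₂ x k := by
  rw [formRhs₂_eq, formRhs₁, ← hS.isCodazziOn.form_eq hx, formLhs, normSqLo]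
  congr 2
  exact div2_congr (Filter.Eventually.of_forall S.LoSq_eq) k

theorem smooth_LoSq (hS : S.IsRegularOn U V) (hx : x ∈ U) :
    SmoothMatAt (fun y => Matrix.of (S.LoSq y)) x :=
  (((hS.smooth_Lo hx).mul (hS.isometric.source.smooth_inv hx)).mul (hS.smooth_Lo hx)).congr
    (Filter.Eventually.of_forall S.LoSq_eq)

theorem smooth_normSqLo (hS : S.IsRegularOn U V) (hx : x ∈ U) : ContDiffAt ℝ ∞ S.normSqLo x :=
  smooth_inner2 hS.isometric.source hx (hS.smooth_Lo hx) (hS.smooth_Lo hx)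

theorem smooth_formLhs (hS : S.IsRegularOn U V) (hx : x ∈ U) (i : Fin 3) :
    ContDiffAt ℝ ∞ (fun y => S.formLhs y i) x :=
  (contDiffAt_pd i (hS.smooth_normSqLo hx)).sub
    (contDiffAt_const.mul (smooth_div2 hS.isometric.source hx (hS.smooth_LoSq hx) i))

theorem smooth_formRhs₁ (hS : S.IsRegularOn U V) (hx : x ∈ U) (i : Fin 3) :
    ContDiffAt ℝ ∞ (fun y => S.formRhs₁ y i) x :=
  (ContDiffAt.sum fun j _ => ContDiffAt.sum fun k _ =>
    ((hS.isometric.source.smooth_inv hx j k).mul (hS.smooth_Lo hx i j)).mul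
      (smooth_div2 hS.isometric.source hx (hS.smooth_Lo hx) k)).neg

/-- Read off from the relation between the three forms. -/
theorem smooth_formRhs₂ (hS : S.IsRegularOn U V) (hx : x ∈ U) (i : Fin 3) :
    ContDiffAt ℝ ∞ (fun y => S.formRhs₂ y i) x := by
  refine ((hS.smooth_formLhs hx i).sub (hS.smooth_formRhs₁ hx i)).congr_of_eventuallyEq ?_
  filter_upwards [hS.isometric.source.mem_nhds hx] with y hy
  rw [hS.formLhs_eq hy]
  ring

theorem div1_formLhs (hS : S.IsRegularOn U V) (hx : x ∈ U) :
    div1 S.h S.formLhs x = S.lhs x := by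
  have h1 : ∀ i, ContDiffAt ℝ ∞ (fun y => div2 S.h S.LoSq y i) x := fun i =>
    smooth_div2 hS.isometric.source hx (hS.smooth_LoSq hx) i
  rw [show S.formLhs = fun y i => dform S.normSqLo y i + (-2) * div2 S.h S.LoSq y i from
    funext₂ fun y i => by rw [formLhs]; ring,
    div1_add (θ := dform S.normSqLo) (η := fun y i => (-2) * div2 S.h S.LoSq y i)
      (fun i => contDiffAt_pd i (hS.smooth_normSqLo hx))
      (fun i => contDiffAt_const.mul (h1 i)), div1_const_mul h1, lhs, laplacian]
  ring

/-- The identity in coordinates. -/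
theorem lhs_eq (hS : S.IsRegularOn U V) (hx : x ∈ U) : S.lhs x = S.rhs₁ x + S.rhs₂ x := by
  rw [← hS.div1_formLhs hx, ← hS.div1_formRhs₁ hx, ← hS.div1_formRhs₂ hx,
    ← div1_add (hS.smooth_formRhs₁ hx) (hS.smooth_formRhs₂ hx)]
  apply div1_congr
  filter_upwards [hS.isometric.source.mem_nhds hx] with y hy
  exact funext fun k => hS.formLhs_eq hy k

end IsRegularOn

end LocalHypersurface

/-! ### Naturality of covariant derivatives and contractions under isometries. -/

section Naturality

open Matrix

variable {l m n : ℕ}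

theorem jac_comp {ψ : Coord n → Coord l} {F : Coord m → Coord n} {x : Coord m}
    (hψ : DifferentiableAt ℝ ψ (F x)) (hF : DifferentiableAt ℝ F x) :
    jac (fun y => ψ (F y)) x = jac ψ (F x) * jac F x := by
  ext a i
  have hψa : DifferentiableAt ℝ (fun z => ψ z a) (F x) :=
    (EuclideanSpace.proj (𝕜 := ℝ) a).differentiableAt.comp (F x) hψ
  rw [Matrix.mul_apply]
  exact pd_comp (f := fun z => ψ z a) i hψa hF

theorem jac_congr {F F' : Coord m → Coord n} {x : Coord m} (h : F =ᶠ[nhds x] F') :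
    jac F x = jac F' x := by
  ext a i
  exact pd_congr (f := fun y => F y a) (g := fun y => F' y a) i (h.fun_comp (fun v => v a))

theorem secondDeriv_congr {K : Coord n → Matrix (Fin n) (Fin n) ℝ} {F F' : Coord m → Coord n}
    {x : Coord m} (h : F =ᶠ[nhds x] F') (i : Fin m) :
    secondDeriv K F x i = secondDeriv K F' x i := by
  have h1 : jac F =ᶠ[nhds x] jac F' := h.eventuallyEq_nhds.mono fun y hy => jac_congr hy
  rw [secondDeriv, secondDeriv, pullConn, pullConn, dmat_congr i h1, h1.eq_of_nhds, h.eq_of_nhds]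

/-- The chain rule for second covariant derivatives. -/
theorem secondDeriv_comp (K : Coord l → Matrix (Fin l) (Fin l) ℝ) {ψ : Coord n → Coord l}
    {F : Coord m → Coord n} {x : Coord m} (hψ : ∀ᶠ z in nhds (F x), ContDiffAt ℝ ∞ ψ z)
    (hF : ∀ᶠ y in nhds x, ContDiffAt ℝ ∞ F y) (i : Fin m) :
    secondDeriv K (fun y => ψ (F y)) x i =
      (∑ c, jac F x c i • secondDeriv K ψ (F x) c) * jac F x + jac ψ (F x) * dmat i (jac F) x := by
  have hFx := hF.self_of_nhds
  have hψx := hψ.self_of_nhds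
  have hJ : jac (fun y => ψ (F y)) =ᶠ[nhds x] fun y => jac ψ (F y) * jac F y := by
    filter_upwards [hF, hFx.continuousAt.eventually hψ] with y hy hy'
    exact jac_comp (differentiableAt_of_smooth hy') (differentiableAt_of_smooth hy)
  have hs : SmoothMatAt (fun y => jac ψ (F y)) x := (smooth_jac hψx).comp hFx
  have hp : pullConn K (fun y => ψ (F y)) x i = ∑ c, jac F x c i • pullConn K ψ (F x) c := by
    simp only [pullConn, hJ.eq_of_nhds, Matrix.mul_apply, Finset.smul_sum, smul_smul,
      Finset.sum_smul]
    rw [Finset.sum_comm]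
    simp only [mul_comm]
  rw [secondDeriv, dmat_congr i hJ, dmat_mul i hs (smooth_jac hFx),
    dmat_comp i (smooth_jac hψx) hFx,
    hp, hJ.eq_of_nhds]
  simp only [secondDeriv, smul_add, Finset.sum_add_distrib, Matrix.add_mul, Matrix.sum_mul,
    Matrix.smul_mul, Matrix.mul_assoc]
  change (∑ c, jac F x c i • _) + _ + _ = _
  abel

variable {G K : Coord n → Matrix (Fin n) (Fin n) ℝ} {φ : Coord n → Coord n}
  {U V : Set (Coord n)} {x : Coord n}

namespace IsIsometricOn

theorem jac_inv (hφ : IsIsometricOn G K φ U V) (hx : x ∈ U) :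
    jac φ x * ((G x)⁻¹ * ((jac φ x)ᵀ * K (φ x))) = 1 := by
  rw [mul_eq_one_comm, Matrix.mul_assoc, ← hφ.pullback x hx,
    Matrix.nonsing_inv_mul _ (hφ.source.isUnit_det hx)]

theorem jac_inv_metric (hφ : IsIsometricOn G K φ U V) (hx : x ∈ U) :
    jac φ x * (G x)⁻¹ * (jac φ x)ᵀ = (K (φ x))⁻¹ := by
  have h := congrArg (· * (K (φ x))⁻¹) (hφ.jac_inv hx)
  simp only [Matrix.mul_assoc, Matrix.mul_nonsing_inv _ (hφ.target.isUnit_det (hφ.mapsTo x hx)),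
    Matrix.mul_one, Matrix.one_mul] at h
  rw [Matrix.mul_assoc, h]

/-- In equal dimensions there is no normal component, and the tangential Gauss formula becomes the
transformation law of the Christoffel symbols. -/
theorem secondDeriv_eq (hφ : IsIsometricOn G K φ U V) (hx : x ∈ U) (i : Fin n) :
    secondDeriv K φ x i = jac φ x * connMat G x i := by
  rw [hφ.connMat_eq hx]
  conv_lhs => rw [← Matrix.one_mul (secondDeriv K φ x i), ← hφ.jac_inv hx]
  simp only [Matrix.mul_assoc]

/-- Second covariant derivatives are natural under isometries of the target. -/
theorem secondDeriv_comp (hφ : IsIsometricOn G K φ U V) {F : Coord m → Coord n} {y : Coord m}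
    (hF : ∀ᶠ z in nhds y, ContDiffAt ℝ ∞ F z) (hy : F y ∈ U) (i : Fin m) :
    secondDeriv K (fun z => φ (F z)) y i = jac φ (F y) * secondDeriv G F y i := by
  have hU : ∀ᶠ z in nhds (F y), ContDiffAt ℝ ∞ φ z := by
    filter_upwards [hφ.source.mem_nhds hy] with z hz using hφ.smooth z hz
  rw [HypersurfaceGeometry.secondDeriv_comp K hU hF, secondDeriv, pullConn]
  simp only [hφ.secondDeriv_eq hy, Matrix.mul_add, Matrix.sum_mul, Matrix.mul_sum, Matrix.smul_mul,
    Matrix.mul_smul, Matrix.mul_assoc]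
  abel

variable {a b a' b' : Coord n → Matrix (Fin n) (Fin n) ℝ}

/-- The derivatives of the two Jacobian factors cancel the inhomogeneous terms in the transformation
of the connection matrix. -/
theorem nabla2_eq (hφ : IsIsometricOn G K φ U V) (hx : x ∈ U)
    (hb' : SmoothMatAt b' (φ x)) (hb : ∀ y ∈ U, b y = (jac φ y)ᵀ * b' (φ y) * jac φ y)
    (i : Fin n) :
    nabla2 G b x i = (jac φ x)ᵀ * (∑ c, jac φ x c i • nabla2 K b' (φ x) c) * jac φ x := by
  have hJ := hφ.smooth_jac hx
  have hc : SmoothMatAt (fun y => b' (φ y)) x := hb'.comp (hφ.smooth x hx)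
  have h : b =ᶠ[nhds x] fun y => (jac φ y)ᵀ * b' (φ y) * jac φ y := by
    filter_upwards [hφ.source.mem_nhds hx] with y hy using hb y hy
  have hΓ : jac φ x * connMat G x i = dmat i (jac φ) x + pullConn K φ x i * jac φ x :=
    (hφ.secondDeriv_eq hx i).symm
  have hΓt := congrArg Matrix.transpose hΓ
  simp only [Matrix.transpose_mul, Matrix.transpose_add] at hΓt
  have e : ∑ c, jac φ x c i • nabla2 K b' (φ x) c = ∑ c, jac φ x c i • dmat c b' (φ x) -
      (pullConn K φ x i)ᵀ * b' (φ x) - b' (φ x) * pullConn K φ x i := by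
    simp only [nabla2, smul_sub, Finset.sum_sub_distrib, pullConn, Matrix.transpose_sum,
      Matrix.transpose_smul, Matrix.sum_mul, Matrix.mul_sum, Matrix.smul_mul, Matrix.mul_smul]
  rw [nabla2, dmat_congr i h, h.eq_of_nhds, dmat_mul i (hJ.transpose.mul hc) hJ,
    dmat_mul i hJ.transpose hc, dmat_comp i hb' (hφ.smooth x hx), dmat_transpose, e,
    Matrix.mul_assoc _ (jac φ x) (connMat G x i), hΓ, ← Matrix.mul_assoc (connMat G x i)ᵀ,
    ← Matrix.mul_assoc (connMat G x i)ᵀ, hΓt]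
  simp only [show ∀ c, pd i (fun z => φ z c) x = jac φ x c i from fun _ => rfl,
    Matrix.mul_add, Matrix.add_mul, Matrix.mul_sub, Matrix.sub_mul, Matrix.mul_assoc]
  abel

theorem div2_eq (hφ : IsIsometricOn G K φ U V) (hx : x ∈ U)
    (hb' : SmoothMatAt b' (φ x)) (hb : ∀ y ∈ U, b y = (jac φ y)ᵀ * b' (φ y) * jac φ y)
    (j : Fin n) : div2 G b x j = ∑ e, jac φ x e j * div2 K b' (φ x) e := by
  have hq : ∀ c a, ∑ i, ∑ k, (G x)⁻¹ i k * jac φ x c i * jac φ x a k = (K (φ x))⁻¹ c a := by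
    intro c a
    rw [← hφ.jac_inv_metric hx]
    simp only [Matrix.mul_apply, Matrix.transpose_apply, Finset.sum_mul]
    rw [Finset.sum_comm]
    exact Finset.sum_congr rfl fun i _ => Finset.sum_congr rfl fun k _ => by ring
  have hn : ∀ i k, nabla2 G b x i k j =
      ∑ e, ∑ c, ∑ a, jac φ x c i * jac φ x a k * (jac φ x e j * nabla2 K b' (φ x) c a e) := by
    intro i k
    rw [hφ.nabla2_eq hx hb' hb]
    simp only [Matrix.mul_apply, Matrix.transpose_apply, Matrix.sum_apply, Matrix.smul_apply,
      smul_eq_mul, Finset.sum_mul, Finset.mul_sum]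
    exact Finset.sum_congr rfl fun e _ => Finset.sum_congr rfl fun c _ =>
      Finset.sum_congr rfl fun a _ => by ring
  simp only [HypersurfaceGeometry.div2_eq, hn, ← hq, Finset.mul_sum, Finset.sum_mul]
  rw [Finset.sum_congr rfl fun i _ => Finset.sum_comm, Finset.sum_comm]
  refine Finset.sum_congr rfl fun e _ => ?_
  rw [sum_pair_comm]
  exact Finset.sum_congr rfl fun c _ => Finset.sum_congr rfl fun a _ =>
    Finset.sum_congr rfl fun i _ => Finset.sum_congr rfl fun k _ => by ring

theorem mul_inv_mul_eq (hφ : IsIsometricOn G K φ U V) (hx : x ∈ U) {τ : Type*}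
    {θ : Coord n → Matrix (Fin n) τ ℝ} {θ' : Matrix (Fin n) τ ℝ}
    (hb : b x = (jac φ x)ᵀ * b' (φ x) * jac φ x) (hθ : θ x = (jac φ x)ᵀ * θ') :
    b x * (G x)⁻¹ * θ x = (jac φ x)ᵀ * (b' (φ x) * (K (φ x))⁻¹ * θ') := by
  rw [hb, hθ, ← hφ.jac_inv_metric hx]
  simp only [Matrix.mul_assoc]

theorem trace_eq (hφ : IsIsometricOn G K φ U V) (hx : x ∈ U)
    (hb : b x = (jac φ x)ᵀ * b' (φ x) * jac φ x) :
    ((G x)⁻¹ * b x).trace = ((K (φ x))⁻¹ * b' (φ x)).trace := by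
  rw [hb, ← hφ.jac_inv_metric hx, ← Matrix.mul_assoc, Matrix.trace_mul_comm]
  simp only [Matrix.mul_assoc]

theorem inner2_eq (hφ : IsIsometricOn G K φ U V) (hx : x ∈ U)
    (ha : a x = (jac φ x)ᵀ * a' (φ x) * jac φ x) (hb : b x = (jac φ x)ᵀ * b' (φ x) * jac φ x) :
    inner2 G a b x = inner2 K a' b' (φ x) := by
  have hbt : (b x)ᵀ = (jac φ x)ᵀ * ((b' (φ x))ᵀ * jac φ x) := by
    rw [hb]
    simp only [Matrix.transpose_mul, Matrix.transpose_transpose]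
  rw [inner2_eq_trace hφ.source hx, inner2_eq_trace hφ.target (hφ.mapsTo x hx)]
  refine hφ.trace_eq (b := fun y => a y * (G y)⁻¹ * (b y)ᵀ)
    (b' := fun y => a' y * (K y)⁻¹ * (b' y)ᵀ) hx ?_
  rw [hφ.mul_inv_mul_eq (θ := fun y => (b y)ᵀ) hx ha hbt]
  simp only [Matrix.mul_assoc]

end IsIsometricOn

end Naturality

/-! ### Transformation of the hypersurface data under changes of both charts. -/

namespace LocalHypersurface

open Matrix

/-- `φ` and `ψ` transform the coordinate expression `S` into `S'`. -/
structure IsTransition (S S' : LocalHypersurface) (φ : Coord 3 → Coord 3) (ψ : Coord 4 → Coord 4)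
    (U U' : Set (Coord 3)) (V V' : Set (Coord 4)) : Prop where
  regular : S.IsRegularOn U V
  regular' : S'.IsRegularOn U' V'
  mapsTo : ∀ x ∈ U, φ x ∈ U'
  smooth : ∀ x ∈ U, ContDiffAt ℝ ∞ φ x
  ambient : IsIsometricOn S.ambient S'.ambient ψ V V'
  param : ∀ x ∈ U, S'.param (φ x) = ψ (S.param x)
  normal : ∀ x ∈ U, S'.normalCol (φ x) = jac ψ (S.param x) * S.normalCol x

namespace IsTransition

variable {S S' : LocalHypersurface} {φ : Coord 3 → Coord 3} {ψ : Coord 4 → Coord 4}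
  {U U' : Set (Coord 3)} {V V' : Set (Coord 4)} {x : Coord 3}

theorem param_eventuallyEq (h : S.IsTransition S' φ ψ U U' V V') (hx : x ∈ U) :
    (fun y => S'.param (φ y)) =ᶠ[nhds x] fun y => ψ (S.param y) := by
  filter_upwards [h.regular.isometric.source.mem_nhds hx] with y hy using h.param y hy

theorem jac_mul_jac (h : S.IsTransition S' φ ψ U U' V V') (hx : x ∈ U) :
    jac S'.param (φ x) * jac φ x = jac ψ (S.param x) * jac S.param x := by
  rw [← jac_comp, ← jac_comp, jac_congr (h.param_eventuallyEq hx)]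
  · exact differentiableAt_of_smooth (h.ambient.smooth _ (h.regular.isometric.mapsTo x hx))
  · exact differentiableAt_of_smooth (h.regular.isometric.smooth x hx)
  · exact differentiableAt_of_smooth (h.regular'.isometric.smooth _ (h.mapsTo x hx))
  · exact differentiableAt_of_smooth (h.smooth x hx)

/-- Changes of coordinates are isometries of the induced metrics. -/
theorem isometric (h : S.IsTransition S' φ ψ U U' V V') : IsIsometricOn S.h S'.h φ U U' where
  source := h.regular.isometric.source
  target := h.regular'.isometric.source
  mapsTo := h.mapsTo
  smooth := h.smooth
  pullback := fun x hx => by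
    have hJ := h.jac_mul_jac hx
    have hJt := congrArg Matrix.transpose hJ
    simp only [Matrix.transpose_mul] at hJt
    rw [S.h_eq, S'.h_eq, h.ambient.pullback _ (h.regular.isometric.mapsTo x hx), h.param x hx]
    rw [← Matrix.mul_assoc, ← Matrix.mul_assoc, ← Matrix.mul_assoc, ← Matrix.mul_assoc, hJt,
      Matrix.mul_assoc _ (jac S'.param (φ x)), hJ, Matrix.mul_assoc _ (jac ψ (S.param x))]

/-- Compute the second derivative of ψ ∘ F = F' ∘ φ in two ways. The left side is handled by
isometry of ψ, the right by the chain rule, whose extra term with second derivatives of φ is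
tangential and is killed by the normal. -/
theorem secondForm_eq (h : S.IsTransition S' φ ψ U U' V V') (hx : x ∈ U) (i : Fin 3) :
    secondForm S.ambient S.param S.normalCol x i =
      (∑ c, jac φ x c i • secondForm S'.ambient S'.param S'.normalCol (φ x) c) * jac φ x := by
  have hU := h.regular.isometric.source.mem_nhds hx
  have hU' := h.regular'.isometric.source.mem_nhds (h.mapsTo x hx)
  have hV := h.regular.isometric.mapsTo x hx
  have e1 : jac ψ (S.param x) * secondDeriv S.ambient S.param x i =
      (∑ c, jac φ x c i • secondDeriv S'.ambient S'.param (φ x) c) * jac φ x +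
        jac S'.param (φ x) * dmat i (jac φ) x := by
    rw [← h.ambient.secondDeriv_comp (Filter.mem_of_superset hU h.regular.isometric.smooth) hV,
      ← secondDeriv_congr (h.param_eventuallyEq hx)]
    exact secondDeriv_comp _ (Filter.mem_of_superset hU' h.regular'.isometric.smooth)
      (Filter.mem_of_superset hU h.smooth) i
  have e2 : (S.normalCol x)ᵀ * S.ambient (S.param x) =
      (S'.normalCol (φ x))ᵀ * S'.ambient (S'.param (φ x)) * jac ψ (S.param x) := by
    rw [h.normal x hx, h.ambient.pullback _ hV, h.param x hx]
    simp only [Matrix.transpose_mul, Matrix.mul_assoc]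
  simp only [secondForm, e2]
  rw [Matrix.mul_assoc, e1, Matrix.mul_add, ← Matrix.mul_assoc _ (jac S'.param (φ x)),
    h.regular'.normal.normal _ (h.mapsTo x hx), Matrix.zero_mul, add_zero]
  simp only [smul_neg, Finset.sum_neg_distrib, Matrix.neg_mul, Matrix.sum_mul, Matrix.mul_sum,
    Matrix.smul_mul, Matrix.mul_smul, Matrix.mul_assoc]

theorem L_eq (h : S.IsTransition S' φ ψ U U' V V') (hx : x ∈ U) :
    Matrix.of (S.L x) = (jac φ x)ᵀ * Matrix.of (S'.L (φ x)) * jac φ x := by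
  ext i j
  rw [Matrix.of_apply, h.regular.L_eq hx, h.secondForm_eq hx, Matrix.mul_apply, Matrix.mul_apply]
  refine Finset.sum_congr rfl fun k _ => ?_
  congr 1
  rw [Matrix.sum_apply, Matrix.mul_apply]
  refine Finset.sum_congr rfl fun c _ => ?_
  rw [Matrix.smul_apply, ← h.regular'.L_eq (h.mapsTo x hx)]
  rfl

theorem H_eq (h : S.IsTransition S' φ ψ U U' V V') (hx : x ∈ U) : S.H x = S'.H (φ x) := by
  rw [h.regular.H_eq hx, h.regular'.H_eq (h.mapsTo x hx)]
  congr 1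
  exact h.isometric.trace_eq (b := fun y => Matrix.of (S.L y)) (b' := fun y => Matrix.of (S'.L y))
    hx (h.L_eq hx)

theorem Lo_eq (h : S.IsTransition S' φ ψ U U' V V') (hx : x ∈ U) :
    Matrix.of (S.Lo x) = (jac φ x)ᵀ * Matrix.of (S'.Lo (φ x)) * jac φ x := by
  have e : ∀ (S : LocalHypersurface) x, Matrix.of (S.Lo x) = Matrix.of (S.L x) - S.H x • S.h x :=
    fun _ _ => rfl
  rw [e, e, h.L_eq hx, h.H_eq hx, h.isometric.pullback x hx]
  simp only [Matrix.mul_sub, Matrix.sub_mul, Matrix.mul_smul, Matrix.smul_mul]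

theorem LoSq_eq (h : S.IsTransition S' φ ψ U U' V V') (hx : x ∈ U) :
    Matrix.of (S.LoSq x) = (jac φ x)ᵀ * Matrix.of (S'.LoSq (φ x)) * jac φ x := by
  rw [S.LoSq_eq, S'.LoSq_eq]
  have := h.isometric.mul_inv_mul_eq (b := fun y => Matrix.of (S.Lo y))
    (b' := fun y => Matrix.of (S'.Lo y)) (θ := fun y => Matrix.of (S.Lo y)) hx (h.Lo_eq hx)
    ((h.Lo_eq hx).trans (Matrix.mul_assoc _ _ _))
  rw [this]
  simp only [Matrix.mul_assoc]

theorem normSqLo_eq (h : S.IsTransition S' φ ψ U U' V V') (hx : x ∈ U) :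
    S.normSqLo x = S'.normSqLo (φ x) :=
  h.isometric.inner2_eq (a := fun y => Matrix.of (S.Lo y)) (b := fun y => Matrix.of (S.Lo y))
    (a' := fun y => Matrix.of (S'.Lo y)) (b' := fun y => Matrix.of (S'.Lo y)) hx
    (h.Lo_eq hx) (h.Lo_eq hx)

theorem formLhs_eq (h : S.IsTransition S' φ ψ U U' V V') (hx : x ∈ U) (i : Fin 3) :
    S.formLhs x i = ∑ k, jac φ x k i * S'.formLhs (φ x) k := by
  have h1 : dform S.normSqLo x i = ∑ k, jac φ x k i * dform S'.normSqLo (φ x) k := by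
    have e : S.normSqLo =ᶠ[nhds x] fun y => S'.normSqLo (φ y) := by
      filter_upwards [h.isometric.source.mem_nhds hx] with y hy using h.normSqLo_eq hy
    rw [dform, pd_congr i e, pd_comp i
      (differentiableAt_of_smooth (h.regular'.smooth_normSqLo (h.mapsTo x hx)))
      (differentiableAt_of_smooth (h.smooth x hx))]
    exact Finset.sum_congr rfl fun k _ => mul_comm _ _
  have h2 : div2 S.h S.LoSq x i = _ :=
    h.isometric.div2_eq (b := fun y => Matrix.of (S.LoSq y)) (b' := fun y => Matrix.of (S'.LoSq y))
      hx (h.regular'.smooth_LoSq (h.mapsTo x hx)) (fun y hy => h.LoSq_eq hy) i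
  rw [formLhs, h1, h2, Finset.mul_sum, ← Finset.sum_sub_distrib]
  exact Finset.sum_congr rfl fun k _ => by
    rw [formLhs, mul_sub, mul_left_comm]
    rfl

theorem formRhs₁_eq (h : S.IsTransition S' φ ψ U U' V V') (hx : x ∈ U) (i : Fin 3) :
    S.formRhs₁ x i = ∑ k, jac φ x k i * S'.formRhs₁ (φ x) k := by
  have e : ∀ (S : LocalHypersurface) x i, S.formRhs₁ x i = - (Matrix.of (S.Lo x) * (S.h x)⁻¹ *
      (Matrix.of fun j _ => div2 S.h S.Lo x j : Matrix (Fin 3) Unit ℝ)) i () := by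
    intro S x i
    simp only [formRhs₁, Matrix.mul_apply, Matrix.of_apply, Finset.sum_mul]
    rw [Finset.sum_comm]
    simp only [mul_comm]
  have h2 : (Matrix.of fun j _ => div2 S.h S.Lo x j : Matrix (Fin 3) Unit ℝ) =
      (jac φ x)ᵀ * (Matrix.of fun j _ => div2 S'.h S'.Lo (φ x) j : Matrix (Fin 3) Unit ℝ) := by
    ext j u
    exact h.isometric.div2_eq (b := fun y => Matrix.of (S.Lo y))
      (b' := fun y => Matrix.of (S'.Lo y))
      hx (h.regular'.smooth_Lo (h.mapsTo x hx)) (fun y hy => h.Lo_eq hy) j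
  have h3 := h.isometric.mul_inv_mul_eq (b := fun y => Matrix.of (S.Lo y))
    (b' := fun y => Matrix.of (S'.Lo y))
    (θ := fun y => (Matrix.of fun j _ => div2 S.h S.Lo y j : Matrix (Fin 3) Unit ℝ)) hx
    (h.Lo_eq hx) h2
  simp only [e]
  rw [h3, Matrix.mul_apply, ← Finset.sum_neg_distrib]
  exact Finset.sum_congr rfl fun k _ => by rw [Matrix.transpose_apply, mul_neg]

/-- By subtraction from the laws for the other two forms, which avoids transforming the Weyl tensor.
-/
theorem formRhs₂_eq (h : S.IsTransition S' φ ψ U U' V V') (hx : x ∈ U) (i : Fin 3) :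
    S.formRhs₂ x i = ∑ k, jac φ x k i * S'.formRhs₂ (φ x) k := by
  have h1 := h.regular.formLhs_eq hx i
  have h2 := fun k => h.regular'.formLhs_eq (h.mapsTo x hx) k
  rw [h.formLhs_eq hx, h.formRhs₁_eq hx] at h1
  simp only [h2, mul_add, Finset.sum_add_distrib] at h1
  linarith

end IsTransition

end LocalHypersurface

/-! ### Derivatives of charts and smoothness of components. -/

section ManifoldDerivatives

variable {l m n : ℕ} {X : Type*} [TopologicalSpace X] [ChartedSpace (Coord n) X]
  {Y : Type*} [TopologicalSpace Y] [ChartedSpace (Coord m) Y]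
  {Z : Type*} [TopologicalSpace Z] [ChartedSpace (Coord l) Z]

/-- The manifold derivative, as a linear map between the model spaces. -/
def tderiv (n m : ℕ) {X : Type*} [TopologicalSpace X] [ChartedSpace (Coord n) X]
    {Y : Type*} [TopologicalSpace Y] [ChartedSpace (Coord m) Y] (f : X → Y) (p : X) :
    Coord n →L[ℝ] Coord m :=
  mfderiv 𝓘(ℝ, Coord n) 𝓘(ℝ, Coord m) f p

theorem tderiv_comp {g : Y → Z} {f : X → Y} {p : X}
    (hg : ContMDiffAt 𝓘(ℝ, Coord m) 𝓘(ℝ, Coord l) ∞ g (f p))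
    (hf : ContMDiffAt 𝓘(ℝ, Coord n) 𝓘(ℝ, Coord m) ∞ f p) (v : Coord n) :
    tderiv n l (fun q => g (f q)) p v = tderiv m l g (f p) (tderiv n m f p v) := by
  have h := mfderiv_comp p (hg.mdifferentiableAt (by simp)) (hf.mdifferentiableAt (by simp))
  exact DFunLike.congr_fun h v

theorem tderiv_congr {f g : X → Y} {p : X} (h : f =ᶠ[nhds p] g) : tderiv n m f p = tderiv n m g p :=
  h.mfderiv_eq

theorem tderiv_id (p : X) (v : Coord n) : tderiv n n (fun q : X => q) p v = v :=
  DFunLike.congr_fun (mfderiv_id (I := 𝓘(ℝ, Coord n)) (x := p)) v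

theorem jac_apply {F : Coord n → Coord m} {x : Coord n} (hF : ContDiffAt ℝ ∞ F x) (a : Fin m)
    (i : Fin n) : jac F x a i = tderiv n m F x (EuclideanSpace.single i 1) a := by
  have h := (EuclideanSpace.proj (𝕜 := ℝ) a).hasFDerivAt.comp x
    (differentiableAt_of_smooth hF).hasFDerivAt
  rw [tderiv, mfderiv_eq_fderiv]
  exact pd_eq_of_hasFDerivAt i h

theorem coord_eq_sum (v : Coord n) : v = ∑ i, v i • (EuclideanSpace.single i 1 : Coord n) := by
  conv_lhs => rw [← (EuclideanSpace.basisFun (Fin n) ℝ).sum_repr v]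
  simp

variable {e : OpenPartialHomeomorph X (Coord n)}

theorem contMDiffAt_chart (he : e ∈ IsManifold.maximalAtlas 𝓘(ℝ, Coord n) ∞ X) {p : X}
    (hp : p ∈ e.source) : ContMDiffAt 𝓘(ℝ, Coord n) 𝓘(ℝ, Coord n) ∞ e p :=
  (contMDiffOn_of_mem_maximalAtlas he p hp).contMDiffAt (e.open_source.mem_nhds hp)

theorem contMDiffAt_chart_symm (he : e ∈ IsManifold.maximalAtlas 𝓘(ℝ, Coord n) ∞ X) {x : Coord n}
    (hx : x ∈ e.target) : ContMDiffAt 𝓘(ℝ, Coord n) 𝓘(ℝ, Coord n) ∞ e.symm x :=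
  (contMDiffOn_symm_of_mem_maximalAtlas he x hx).contMDiffAt (e.open_target.mem_nhds hx)

theorem tderiv_symm_tderiv (he : e ∈ IsManifold.maximalAtlas 𝓘(ℝ, Coord n) ∞ X) {p : X}
    (hp : p ∈ e.source) (v : Coord n) : tderiv n n e.symm (e p) (tderiv n n e p v) = v := by
  rw [← tderiv_comp (contMDiffAt_chart_symm he (e.map_source hp)) (contMDiffAt_chart he hp),
    tderiv_congr (g := fun q => q), tderiv_id]
  filter_upwards [e.open_source.mem_nhds hp] with q hq using e.left_inv hq

theorem tderiv_tderiv_symm (he : e ∈ IsManifold.maximalAtlas 𝓘(ℝ, Coord n) ∞ X) {x : Coord n}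
    (hx : x ∈ e.target) (v : Coord n) : tderiv n n e (e.symm x) (tderiv n n e.symm x v) = v := by
  rw [← tderiv_comp (contMDiffAt_chart he (e.map_target hx)) (contMDiffAt_chart_symm he hx),
    tderiv_congr (g := fun q => q), tderiv_id]
  filter_upwards [e.open_target.mem_nhds hx] with q hq using e.right_inv hq

variable [IsManifold 𝓘(ℝ, Coord n) ∞ X]

theorem tangentMap_contMDiffAt [IsManifold 𝓘(ℝ, Coord m) ∞ Y] {f : X → Y} {s : Set X}
    (hs : IsOpen s) (hf : ContMDiffOn 𝓘(ℝ, Coord n) 𝓘(ℝ, Coord m) ∞ f s)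
    (p : TangentBundle 𝓘(ℝ, Coord n) X) (hp : p.1 ∈ s) :
    ContMDiffAt 𝓘(ℝ, Coord n).tangent 𝓘(ℝ, Coord m).tangent ∞
      (tangentMap 𝓘(ℝ, Coord n) 𝓘(ℝ, Coord m) f) p := by
  have hps : IsOpen (Bundle.TotalSpace.proj ⁻¹' s : Set (TangentBundle 𝓘(ℝ, Coord n) X)) :=
    hs.preimage (FiberBundle.continuous_proj (Coord n) (TangentSpace 𝓘(ℝ, Coord n)))
  have h := (hf.contMDiffOn_tangentMapWithin (m := ∞) (by simp) hs.uniqueMDiffOn) p hp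
  refine (h.contMDiffAt (hps.mem_nhds hp)).congr_of_eventuallyEq ?_
  filter_upwards [hps.mem_nhds hp] with q hq
  exact (tangentMapWithin_eq_tangentMap (hs.uniqueMDiffOn _ hq)
    ((hf.contMDiffAt (hs.mem_nhds hq)).mdifferentiableAt (by simp))).symm

/-- Coordinate vector fields are smooth. -/
theorem contMDiffAt_coordField (he : e ∈ IsManifold.maximalAtlas 𝓘(ℝ, Coord n) ∞ X) {x : Coord n}
    (hx : x ∈ e.target) (v : Coord n) :
    ContMDiffAt 𝓘(ℝ, Coord n) 𝓘(ℝ, Coord n).tangent ∞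
      (fun y => (⟨e.symm y, tderiv n n e.symm y v⟩ : TangentBundle 𝓘(ℝ, Coord n) X)) x := by
  have h1 : ContMDiffAt 𝓘(ℝ, Coord n) 𝓘(ℝ, Coord n).tangent ∞
      (fun y => (⟨y, v⟩ : TangentBundle 𝓘(ℝ, Coord n) (Coord n))) x :=
    contMDiffAt_vectorSpace_iff_contDiffAt.2 contDiffAt_const
  exact (tangentMap_contMDiffAt e.open_target (contMDiffOn_symm_of_mem_maximalAtlas he)
    ⟨x, v⟩ hx).comp x h1

/-- The components of a smooth vector field along a map are smooth. -/
theorem contDiffAt_components (he : e ∈ IsManifold.maximalAtlas 𝓘(ℝ, Coord n) ∞ X)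
    {f : Coord m → X} {N : Coord m → Coord n} {x : Coord m} (hx : f x ∈ e.source)
    (hN : ContMDiffAt 𝓘(ℝ, Coord m) 𝓘(ℝ, Coord n).tangent ∞
      (fun y => (⟨f y, N y⟩ : TangentBundle 𝓘(ℝ, Coord n) X)) x) :
    ContDiffAt ℝ ∞ (fun y => tderiv n n e (f y) (N y)) x := by
  have h := (tangentMap_contMDiffAt e.open_source (contMDiffOn_of_mem_maximalAtlas he)
    ⟨f x, N x⟩ hx).comp x hN
  have h2 := (Bundle.contMDiffAt_totalSpace.1 h).2
  rw [← contMDiffAt_iff_contDiffAt]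
  refine h2.congr_of_eventuallyEq (Filter.Eventually.of_forall fun y => ?_)
  simp [tangentMap, tderiv]
  rfl

end ManifoldDerivatives

/-! ### The coordinate matrix of a Riemannian metric. -/

section Metric

variable {n : ℕ} {X : Type*} [TopologicalSpace X] [ChartedSpace (Coord n) X]
  [IsManifold 𝓘(ℝ, Coord n) ∞ X]
  (g : Bundle.ContMDiffRiemannianMetric 𝓘(ℝ, Coord n) ∞ (Coord n)
      (fun q : X => TangentSpace 𝓘(ℝ, Coord n) q))
  {e : OpenPartialHomeomorph X (Coord n)}

/-- The metric at a point, as a bilinear form on the model space. -/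
def metricAt (q : X) : Coord n →L[ℝ] Coord n →L[ℝ] ℝ := g.inner q

theorem metricAt_symm (q : X) (u v : Coord n) : metricAt g q u v = metricAt g q v u :=
  g.symm q u v

theorem metricInChart_apply (e : OpenPartialHomeomorph X (Coord n)) (y : Coord n) (a b : Fin n) :
    metricInChart g e y a b = metricAt g (e.symm y)
      (tderiv n n e.symm y (EuclideanSpace.single a 1))
      (tderiv n n e.symm y (EuclideanSpace.single b 1)) := rfl

theorem sum_metricAt {k : ℕ} (q : X) (T : Coord k →L[ℝ] Coord n) (u v : Coord k) :
    ∑ a, ∑ b, metricAt g q (T (EuclideanSpace.single a 1)) (T (EuclideanSpace.single b 1)) *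
      u a * v b = metricAt g q (T u) (T v) := by
  conv_rhs => rw [coord_eq_sum u, coord_eq_sum v]
  simp only [map_sum, map_smul, _root_.sum_apply, _root_.smul_apply, smul_eq_mul]
  rw [Finset.sum_comm]
  refine Finset.sum_congr rfl fun b _ => ?_
  rw [Finset.mul_sum]
  exact Finset.sum_congr rfl fun a _ => by ring

/-- A kernel vector of the Gram matrix would map to a vector of length zero, contradicting
definiteness and injectivity of T. It serves for both the ambient and the induced metric. -/
theorem det_ne_zero_of_pos {k : ℕ} {q : X} {T : Coord k →L[ℝ] Coord n}
    (hT : Function.Injective T) {A : Matrix (Fin k) (Fin k) ℝ}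
    (hA : ∀ a b, A a b =
      metricAt g q (T (EuclideanSpace.single a 1)) (T (EuclideanSpace.single b 1))) :
    A.det ≠ 0 := by
  intro h0
  obtain ⟨v, hv, hv0⟩ := Matrix.exists_mulVec_eq_zero_iff.2 h0
  set w : Coord k := WithLp.toLp 2 v with hw
  have hw0 : w ≠ 0 := fun h => hv (by rw [show v = w.ofLp from rfl, h]; rfl)
  have h1 : metricAt g q (T w) (T w) = 0 := by
    rw [← sum_metricAt]
    simp only [← hA]
    refine Finset.sum_eq_zero fun a _ => ?_
    have := congrFun hv0 a
    rw [Matrix.mulVec, dotProduct] at this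
    calc _ = w a * ∑ b, A a b * v b := by
          rw [Finset.mul_sum]
          exact Finset.sum_congr rfl fun b _ => by simp only [hw]; ring
      _ = 0 := by rw [this]; simp
  exact (g.pos q (T w) fun h => hw0 (hT (h.trans (map_zero T).symm))).ne' h1

theorem isMetricOn_metricInChart (he : e ∈ IsManifold.maximalAtlas 𝓘(ℝ, Coord n) ∞ X) :
    IsMetricOn (metricInChart g e) e.target where
  isOpen := e.open_target
  smooth := fun y hy a b => by
    have h := ContMDiffAt.clm_bundle_apply₂ (F₁ := Coord n) (F₂ := Coord n) (F₃ := ℝ)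
      (E₃ := Bundle.Trivial X ℝ) (b := e.symm)
      ((g.contMDiff (e.symm y)).comp y (contMDiffAt_chart_symm he hy))
      (contMDiffAt_coordField he hy (EuclideanSpace.single a 1))
      (contMDiffAt_coordField he hy (EuclideanSpace.single b 1))
    rw [← contMDiffAt_iff_contDiffAt]
    exact (Bundle.contMDiffAt_totalSpace.1 h).2
  symm := fun y _ => by
    ext a b
    exact metricAt_symm g _ _ _
  det_ne_zero := fun y hy => by
    refine det_ne_zero_of_pos g (q := e.symm y) (T := tderiv n n e.symm y) ?_
      fun _ _ => rfl
    exact Function.LeftInverse.injective (g := tderiv n n e (e.symm y)) (tderiv_tderiv_symm he hy)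

theorem sum_metricInChart_components (he : e ∈ IsManifold.maximalAtlas 𝓘(ℝ, Coord n) ∞ X) {q : X}
    (hq : q ∈ e.source) (u v : Coord n) :
    ∑ a, ∑ b, metricInChart g e (e q) a b * tderiv n n e q u a * tderiv n n e q v b =
      metricAt g q u v := by
  simp only [metricInChart_apply]
  rw [sum_metricAt, tderiv_symm_tderiv he hq, tderiv_symm_tderiv he hq, e.left_inv hq]

end Metric

/-! ### Injectivity of the differential of an immersion. -/

section Immersions

variable {m n : ℕ} {M : Type*} [TopologicalSpace M] [ChartedSpace (Coord m) M]
  {X : Type*} [TopologicalSpace X] [ChartedSpace (Coord n) X]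

/-- In adapted charts the map is u ↦ (u, 0) followed by a linear equivalence, so its derivative is
injective, and chart differentials are invertible. -/
theorem tderiv_injective_of_isImmersionAt {ι : M → X} {p : M}
    (h : Manifold.IsImmersionAt 𝓘(ℝ, Coord m) 𝓘(ℝ, Coord n) ∞ ι p) :
    Function.Injective (tderiv m n ι p) := by
  obtain ⟨F, _, _, hF⟩ := h
  set e := hF.domChart
  set e' := hF.codChart
  have he := hF.domChart_mem_maximalAtlas
  have he' := hF.codChart_mem_maximalAtlas
  have hp : p ∈ e.source := hF.mem_domChart_source
  have hp' : ι p ∈ e'.source := hF.mem_codChart_source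
  have hι : ContMDiffAt 𝓘(ℝ, Coord m) 𝓘(ℝ, Coord n) ∞ ι p := hF.contMDiffAt
  have hx := e.map_source hp
  have hpe : e.symm (e p) = p := e.left_inv hp
  have hι' : ContMDiffAt 𝓘(ℝ, Coord m) 𝓘(ℝ, Coord n) ∞ ι (e.symm (e p)) := by rwa [hpe]
  have hp'' : ι (e.symm (e p)) ∈ e'.source := by rwa [hpe]
  have hc : (fun x => e' (ι (e.symm x))) =ᶠ[nhds (e p)] fun x => hF.equiv (x, 0) := by
    filter_upwards [e.open_target.mem_nhds hx] with x hx
    exact hF.writtenInCharts (by simpa [OpenPartialHomeomorph.extend] using hx)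
  rw [injective_iff_map_eq_zero]
  intro w hw
  have h1 : tderiv m n (fun x => e' (ι (e.symm x))) (e p) (tderiv m m e p w) = 0 := by
    rw [tderiv_comp (m := m) (g := fun q => e' (ι q)) (f := e.symm)
      ((contMDiffAt_chart he' hp'').comp _ hι') (contMDiffAt_chart_symm he hx),
      tderiv_symm_tderiv he hp, hpe, tderiv_comp (contMDiffAt_chart he' hp') hι, hw, map_zero]
  have h2 : tderiv m n (fun x : Coord m => hF.equiv (x, 0)) (e p) =
      hF.equiv.toContinuousLinearMap.comp (ContinuousLinearMap.inl ℝ (Coord m) F) := by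
    rw [tderiv, mfderiv_eq_fderiv]
    exact (hF.equiv.toContinuousLinearMap.comp (ContinuousLinearMap.inl ℝ (Coord m) F)).fderiv
  rw [tderiv_congr hc, h2] at h1
  have h3 : tderiv m m e p w = 0 := by
    have := (map_eq_zero_iff _ hF.equiv.injective).1 h1
    exact (Prod.ext_iff.1 this).1
  rw [← tderiv_symm_tderiv he hp w, h3, map_zero]

end Immersions

/-! ### From embedded hypersurfaces to regular coordinate expressions. -/

section Hypersurfaces

theorem isOpen_commonDomain {M X : Type*} [TopologicalSpace M] [TopologicalSpace X] {ι : M → X}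
    (hι : Continuous ι) (e : OpenPartialHomeomorph M (Coord 3))
    (e' : OpenPartialHomeomorph X (Coord 4)) : IsOpen (commonDomain ι e e') :=
  e.isOpen_inter_preimage_symm (e'.open_source.preimage hι)

variable {X : Type*} [TopologicalSpace X] [ChartedSpace (Coord 4) X]
  [IsManifold 𝓘(ℝ, Coord 4) ∞ X]
  {M : Type*} [TopologicalSpace M] [ChartedSpace (Coord 3) M]
  {g : Bundle.ContMDiffRiemannianMetric 𝓘(ℝ, Coord 4) ∞ (Coord 4)
    (fun q : X => TangentSpace 𝓘(ℝ, Coord 4) q)}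
  {ι : M → X} {N : (p : M) → TangentSpace 𝓘(ℝ, Coord 4) (ι p)}
  {e e₂ : OpenPartialHomeomorph M (Coord 3)} {e' e₂' : OpenPartialHomeomorph X (Coord 4)}
  {x : Coord 3}

theorem contDiffAt_param (hι : ContMDiff 𝓘(ℝ, Coord 3) 𝓘(ℝ, Coord 4) ∞ ι)
    (he : e ∈ IsManifold.maximalAtlas 𝓘(ℝ, Coord 3) ∞ M)
    (he' : e' ∈ IsManifold.maximalAtlas 𝓘(ℝ, Coord 4) ∞ X) (hx : x ∈ commonDomain ι e e') :
    ContDiffAt ℝ ∞ (localHypersurface g ι N e e').param x := by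
  rw [← contMDiffAt_iff_contDiffAt]
  exact ContMDiffAt.comp (g := e') (f := fun y => ι (e.symm y)) x (contMDiffAt_chart he' hx.2)
    ((hι (e.symm x)).comp x (contMDiffAt_chart_symm he hx.1))

/-- The differential of the hypersurface, as a linear map between coordinate spaces. -/
def tangentMapAt (ι : M → X) (e : OpenPartialHomeomorph M (Coord 3)) (x : Coord 3) :
    Coord 3 →L[ℝ] Coord 4 :=
  (tderiv 3 4 ι (e.symm x)).comp (tderiv 3 3 e.symm x)

theorem tangent_eq (hι : ContMDiff 𝓘(ℝ, Coord 3) 𝓘(ℝ, Coord 4) ∞ ι)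
    (he : e ∈ IsManifold.maximalAtlas 𝓘(ℝ, Coord 3) ∞ M)
    (he' : e' ∈ IsManifold.maximalAtlas 𝓘(ℝ, Coord 4) ∞ X) (hx : x ∈ commonDomain ι e e')
    (i : Fin 3) (a : Fin 4) :
    (localHypersurface g ι N e e').tangent x i a =
      tderiv 4 4 e' (ι (e.symm x)) (tangentMapAt ι e x (EuclideanSpace.single i 1)) a := by
  have h := jac_apply (contDiffAt_param (g := g) (N := N) hι he he' hx) a i
  refine Eq.trans h ?_
  have h2 : tderiv 3 4 (localHypersurface g ι N e e').param x =
      tderiv 3 4 (fun y => (fun q => e' (ι q)) (e.symm y)) x := rfl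
  rw [h2, tderiv_comp (m := 3) (g := fun q => e' (ι q)) (f := e.symm)
    ((contMDiffAt_chart he' hx.2).comp _ (hι _)) (contMDiffAt_chart_symm he hx.1),
    tderiv_comp (contMDiffAt_chart he' hx.2) (hι _)]
  rfl

theorem contDiffAt_normal (hN : IsUnitNormalField g ι N)
    (he : e ∈ IsManifold.maximalAtlas 𝓘(ℝ, Coord 3) ∞ M)
    (he' : e' ∈ IsManifold.maximalAtlas 𝓘(ℝ, Coord 4) ∞ X) (hx : x ∈ commonDomain ι e e') :
    ContDiffAt ℝ ∞ (localHypersurface g ι N e e').normal x :=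
  contDiffAt_components he' (f := fun y => ι (e.symm y)) (N := fun y => N (e.symm y)) hx.2
    ((hN.contMDiff (e.symm x)).comp x (contMDiffAt_chart_symm he hx.1))

/-- The coordinate expressions of a hypersurface are regular. -/
theorem isRegularOn_localHypersurface
    (hι : Manifold.IsSmoothEmbedding 𝓘(ℝ, Coord 3) 𝓘(ℝ, Coord 4) ∞ ι)
    (hN : IsUnitNormalField g ι N)
    (he : e ∈ IsManifold.maximalAtlas 𝓘(ℝ, Coord 3) ∞ M)
    (he' : e' ∈ IsManifold.maximalAtlas 𝓘(ℝ, Coord 4) ∞ X) :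
    (localHypersurface g ι N e e').IsRegularOn (commonDomain ι e e') e'.target := by
  set S := localHypersurface g ι N e e' with hS
  have hK : IsMetricOn S.ambient e'.target := isMetricOn_metricInChart g he'
  have hm : ∀ x ∈ commonDomain ι e e', S.param x ∈ e'.target := fun x hx => e'.map_source hx.2
  have hT := fun x hx => tangent_eq (g := g) (N := N) hι.contMDiff he he' (x := x) hx
  refine S.isRegularOn_of (isOpen_commonDomain hι.contMDiff.continuous e e') hK hm
    (fun x hx => contDiffAt_param hι.contMDiff he he' hx) (fun x hx => ?_) ?_
  · refine det_ne_zero_of_pos g (q := ι (e.symm x)) (T := tangentMapAt ι e x) ?_ ?_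
    · exact (tderiv_injective_of_isImmersionAt (hι.isImmersion.isImmersionAt _)).comp
        (Function.LeftInverse.injective (g := tderiv 3 3 e (e.symm x)) (tderiv_tderiv_symm he hx.1))
    · intro i j
      rw [← sum_metricInChart_components g he' hx.2]
      simp only [← hT x hx]
      rfl
  · refine ⟨rfl, fun x hx a _ => contDiffAt_coord (contDiffAt_normal hN he he' hx) a, ?_, ?_⟩
    · intro x hx
      ext u v
      rw [Matrix.one_apply, if_pos (Subsingleton.elim u v),
        S.normal_pairing x _ v (hK.symm _ (hm x hx))]
      exact (sum_metricInChart_components g he' hx.2 _ _).trans (hN.unit (e.symm x))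
    · intro x hx
      ext u i
      rw [Matrix.zero_apply, S.normal_pairing x _ i (hK.symm _ (hm x hx))]
      have h := sum_metricInChart_components g he' hx.2
        (tangentMapAt ι e x (EuclideanSpace.single i 1)) (N (e.symm x))
      simp only [← hT x hx] at h
      exact h.trans (hN.normal (e.symm x) _)

theorem IsMetricOn.mono {n : ℕ} {G : Coord n → Matrix (Fin n) (Fin n) ℝ} {V V' : Set (Coord n)}
    (hG : IsMetricOn G V) (hV' : IsOpen V') (h : V' ⊆ V) : IsMetricOn G V' :=
  ⟨hV', fun x hx => hG.smooth x (h hx), fun x hx => hG.symm x (h hx),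
    fun x hx => hG.det_ne_zero x (h hx)⟩

theorem LocalHypersurface.IsRegularOn.mono {S : LocalHypersurface} {U U' : Set (Coord 3)}
    {V V' : Set (Coord 4)} (hS : S.IsRegularOn U V) (hU' : IsOpen U') (hV' : IsOpen V')
    (hU : U' ⊆ U) (hV : V' ⊆ V) (hm : ∀ x ∈ U', S.param x ∈ V') : S.IsRegularOn U' V' :=
  ⟨⟨hS.isometric.source.mono hU' hU, hS.isometric.target.mono hV' hV, hm,
    fun x hx => hS.isometric.smooth x (hU hx), fun x hx => hS.isometric.pullback x (hU hx)⟩,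
    ⟨rfl, fun x hx => hS.normal.smooth x (hU hx), fun x hx => hS.normal.unit x (hU hx),
      fun x hx => hS.normal.normal x (hU hx)⟩⟩

/-- The domains are shrunk to the points lying in all four charts. There the transition maps are φ =
e₂ ∘ e⁻¹ and ψ = e₂' ∘ e'⁻¹, and ψ is an isometry because both matrices represent the same g. -/
theorem isTransition_localHypersurface
    (hι : Manifold.IsSmoothEmbedding 𝓘(ℝ, Coord 3) 𝓘(ℝ, Coord 4) ∞ ι)
    (hN : IsUnitNormalField g ι N)
    (he : e ∈ IsManifold.maximalAtlas 𝓘(ℝ, Coord 3) ∞ M)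
    (he' : e' ∈ IsManifold.maximalAtlas 𝓘(ℝ, Coord 4) ∞ X)
    (he₂ : e₂ ∈ IsManifold.maximalAtlas 𝓘(ℝ, Coord 3) ∞ M)
    (he₂' : e₂' ∈ IsManifold.maximalAtlas 𝓘(ℝ, Coord 4) ∞ X) :
    (localHypersurface g ι N e e').IsTransition (localHypersurface g ι N e₂ e₂')
      (fun y => e₂ (e.symm y)) (fun z => e₂' (e'.symm z))
      (commonDomain ι e e' ∩ (e.target ∩ e.symm ⁻¹' (e₂.source ∩ ι ⁻¹' e₂'.source)))
      (commonDomain ι e₂ e₂') (e'.target ∩ e'.symm ⁻¹' e₂'.source) e₂'.target := by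
  have hc := hι.contMDiff.continuous
  have hr := isRegularOn_localHypersurface hι hN he he'
  have hV : IsOpen (e'.target ∩ e'.symm ⁻¹' e₂'.source) :=
    e'.isOpen_inter_preimage_symm e₂'.open_source
  have hψ : ∀ z ∈ e'.target ∩ e'.symm ⁻¹' e₂'.source,
      ContDiffAt ℝ ∞ (fun z => e₂' (e'.symm z)) z := fun z hz => by
    rw [← contMDiffAt_iff_contDiffAt]
    exact (contMDiffAt_chart he₂' hz.2).comp z (contMDiffAt_chart_symm he' hz.1)
  have hj : ∀ z ∈ e'.target ∩ e'.symm ⁻¹' e₂'.source, ∀ a i,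
      jac (fun z => e₂' (e'.symm z)) z a i = tderiv 4 4 e₂' (e'.symm z)
        (tderiv 4 4 e'.symm z (EuclideanSpace.single i 1)) a := fun z hz a i => by
    rw [jac_apply (hψ z hz), tderiv_comp (contMDiffAt_chart he₂' hz.2)
      (contMDiffAt_chart_symm he' hz.1)]
  refine
    { regular := hr.mono ?_ hV Set.inter_subset_left Set.inter_subset_left ?_
      regular' := isRegularOn_localHypersurface hι hN he₂ he₂'
      mapsTo := ?_
      smooth := ?_
      ambient := ?_
      param := ?_
      normal := ?_ }
  · exact hr.isometric.source.isOpen.inter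
      (e.isOpen_inter_preimage_symm (e₂.open_source.inter (e₂'.open_source.preimage hc)))
  · intro x hx
    refine ⟨e'.map_source hx.1.2, ?_⟩
    change e'.symm (e' (ι (e.symm x))) ∈ e₂'.source
    rw [e'.left_inv hx.1.2]
    exact hx.2.2.2
  · intro x hx
    refine ⟨e₂.map_source hx.2.2.1, ?_⟩
    rw [e₂.left_inv hx.2.2.1]
    exact hx.2.2.2
  · intro x hx
    rw [← contMDiffAt_iff_contDiffAt]
    exact (contMDiffAt_chart he₂ hx.2.2.1).comp x (contMDiffAt_chart_symm he hx.1.1)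
  · refine ⟨(isMetricOn_metricInChart g he').mono hV Set.inter_subset_left,
      isMetricOn_metricInChart g he₂', fun z hz => e₂'.map_source hz.2, hψ, fun z hz => ?_⟩
    ext a b
    refine (sum_metricInChart_components g he₂' hz.2
      (tderiv 4 4 e'.symm z (EuclideanSpace.single a 1))
      (tderiv 4 4 e'.symm z (EuclideanSpace.single b 1))).symm.trans ?_
    simp only [← hj z hz, Matrix.mul_apply, Matrix.transpose_apply, Finset.sum_mul]
    rw [Finset.sum_comm]
    refine Finset.sum_congr rfl fun c _ => Finset.sum_congr rfl fun d _ => ?_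
    change _ = _ * metricInChart g e₂' (e₂' (e'.symm z)) d c * _
    ring
  · intro x hx
    change e₂' (ι (e₂.symm (e₂ (e.symm x)))) = e₂' (e'.symm (e' (ι (e.symm x))))
    rw [e₂.left_inv hx.2.2.1, e'.left_inv hx.1.2]
  · intro x hx
    have hz : e' (ι (e.symm x)) ∈ e'.target ∩ e'.symm ⁻¹' e₂'.source := by
      refine ⟨e'.map_source hx.1.2, ?_⟩
      rw [Set.mem_preimage, e'.left_inv hx.1.2]
      exact hx.2.2.2
    ext a u
    -- N p lies in a fibre depending on p, so the point is generalized and the equality of base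
    -- points is then used by substitution.
    have hn : ∀ p, p = e.symm x → tderiv 4 4 e₂' (ι p) (N p) a =
        ∑ b, jac (fun z => e₂' (e'.symm z)) (e' (ι (e.symm x))) a b *
          tderiv 4 4 e' (ι (e.symm x)) (N (e.symm x)) b := by
      rintro p rfl
      have h1 : ∀ v : Coord 4, tderiv 4 4 e₂' (ι (e.symm x)) v =
          tderiv 4 4 (fun z => e₂' (e'.symm z)) (e' (ι (e.symm x)))
            (tderiv 4 4 e' (ι (e.symm x)) v) := fun v => by
        rw [tderiv_comp (contMDiffAt_chart he₂' hz.2) (contMDiffAt_chart_symm he' hz.1),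
          tderiv_symm_tderiv he' hx.1.2, e'.left_inv hx.1.2]
      rw [h1 (N (e.symm x))]
      conv_lhs => rw [coord_eq_sum (tderiv 4 4 e' (ι (e.symm x)) (N (e.symm x)))]
      simp only [map_sum, map_smul, jac_apply (hψ _ hz), WithLp.ofLp_sum, WithLp.ofLp_smul,
        Finset.sum_apply, Pi.smul_apply, smul_eq_mul, mul_comm]
    exact hn _ (e₂.left_inv hx.2.2.1)

end Hypersurfaces

/-! ### Gluing components to a global smooth 1-form. -/

section OneForms

variable {X : Type*} [TopologicalSpace X] [ChartedSpace (Coord 4) X]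
  [IsManifold 𝓘(ℝ, Coord 4) ∞ X]
  {M : Type*} [TopologicalSpace M] [ChartedSpace (Coord 3) M] [IsManifold 𝓘(ℝ, Coord 3) ∞ M]

/-- Components that transform like those of a 1-form come from a 1-form. -/
theorem exists_oneForm {ι : M → X} (hι : Continuous ι)
    (c : OpenPartialHomeomorph M (Coord 3) → OpenPartialHomeomorph X (Coord 4) →
      Coord 3 → Fin 3 → ℝ)
    (smooth : ∀ e ∈ IsManifold.maximalAtlas 𝓘(ℝ, Coord 3) ∞ M,
      ∀ e' ∈ IsManifold.maximalAtlas 𝓘(ℝ, Coord 4) ∞ X, ∀ x ∈ commonDomain ι e e', ∀ i,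
        ContDiffAt ℝ ∞ (fun y => c e e' y i) x)
    (trans : ∀ e ∈ IsManifold.maximalAtlas 𝓘(ℝ, Coord 3) ∞ M,
      ∀ e' ∈ IsManifold.maximalAtlas 𝓘(ℝ, Coord 4) ∞ X,
      ∀ e₂ ∈ IsManifold.maximalAtlas 𝓘(ℝ, Coord 3) ∞ M,
      ∀ e₂' ∈ IsManifold.maximalAtlas 𝓘(ℝ, Coord 4) ∞ X, ∀ x ∈ commonDomain ι e e',
        e.symm x ∈ e₂.source → ι (e.symm x) ∈ e₂'.source → ∀ i,
          c e e' x i = ∑ k, jac (fun y => e₂ (e.symm y)) x k i * c e₂ e₂' (e₂ (e.symm x)) k) :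
    ∃ θ : OneForm 3 M, ∀ e ∈ IsManifold.maximalAtlas 𝓘(ℝ, Coord 3) ∞ M,
      ∀ e' ∈ IsManifold.maximalAtlas 𝓘(ℝ, Coord 4) ∞ X, ∀ x ∈ commonDomain ι e e',
        OneForm.inChart θ e x = c e e' x := by
  -- At each point the form is built from the components in the preferred charts at p and at ι p.
  -- The transformation law then shows that any other pair of charts gives the same covector.
  set θ : M → Coord 3 →L[ℝ] ℝ := fun p =>
    ∑ i, c (chartAt (Coord 3) p) (chartAt (Coord 4) (ι p)) (chartAt (Coord 3) p p) i •
      (EuclideanSpace.proj i : Coord 3 →L[ℝ] ℝ).comp (tderiv 3 3 (chartAt (Coord 3) p) p) with hθ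
  have hm : ∀ p : M, chartAt (Coord 3) p ∈ IsManifold.maximalAtlas 𝓘(ℝ, Coord 3) ∞ M :=
    fun p => IsManifold.chart_mem_maximalAtlas p
  have hm' : ∀ q : X, chartAt (Coord 4) q ∈ IsManifold.maximalAtlas 𝓘(ℝ, Coord 4) ∞ X :=
    fun q => IsManifold.chart_mem_maximalAtlas q
  have key : ∀ e ∈ IsManifold.maximalAtlas 𝓘(ℝ, Coord 3) ∞ M,
      ∀ e' ∈ IsManifold.maximalAtlas 𝓘(ℝ, Coord 4) ∞ X, ∀ x ∈ commonDomain ι e e', ∀ i,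
        θ (e.symm x) (tderiv 3 3 e.symm x (EuclideanSpace.single i 1)) = c e e' x i := by
    intro e he e' he' x hx i
    have h3 := mem_chart_source (Coord 3) (e.symm x)
    have hc := contMDiffAt_chart (hm (e.symm x)) h3
    have hs := contMDiffAt_chart_symm he hx.1
    rw [trans e he e' he' _ (hm (e.symm x)) _ (hm' (ι (e.symm x))) x hx h3
      (mem_chart_source _ _)]
    simp only [hθ, _root_.sum_apply, _root_.smul_apply, smul_eq_mul,
      ContinuousLinearMap.comp_apply]
    refine Finset.sum_congr rfl fun k _ => ?_
    have hj := jac_apply (F := fun y => chartAt (Coord 3) (e.symm x) (e.symm y))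
      (contMDiffAt_iff_contDiffAt.1 (hc.comp x hs)) k i
    rw [tderiv_comp hc hs] at hj
    rw [hj, mul_comm]
    rfl
  refine ⟨⟨θ, fun p₀ => ?_⟩, fun e he e' he' x hx => funext (key e he e' he' x hx)⟩
  -- Smoothness near p₀ is checked in the trivialization of the fixed charts at p₀, where θ has the
  -- smooth coefficients c, although its definition uses charts varying with the point.
  refine (contMDiffAt_hom_bundle _).2 ⟨contMDiffAt_id, ?_⟩
  set e := chartAt (Coord 3) p₀
  set e' := chartAt (Coord 4) (ι p₀)
  have hp : p₀ ∈ e.source := mem_chart_source _ _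
  have hx : e p₀ ∈ commonDomain ι e e' := by
    refine ⟨e.map_source hp, ?_⟩
    rw [e.left_inv hp]
    exact mem_chart_source _ _
  have hsm : ContMDiffAt 𝓘(ℝ, Coord 3) 𝓘(ℝ, Coord 3 →L[ℝ] ℝ) ∞
      (fun p => ∑ i, c e e' (e p) i • (EuclideanSpace.proj i : Coord 3 →L[ℝ] ℝ)) p₀ := by
    have h : ContDiffAt ℝ ∞
        (fun y => ∑ i, c e e' y i • (EuclideanSpace.proj i : Coord 3 →L[ℝ] ℝ)) (e p₀) :=
      ContDiffAt.sum fun i _ => (smooth e (hm _) e' (hm' _) _ hx i).smul contDiffAt_const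
    exact (contMDiffAt_iff_contDiffAt.2 h).comp p₀ (contMDiffAt_chart (hm _) hp)
  refine hsm.congr_of_eventuallyEq ?_
  filter_upwards [e.open_source.mem_nhds hp,
    (chartAt (Coord 4) (ι p₀)).open_source.preimage hι |>.mem_nhds (mem_chart_source _ (ι p₀))]
    with p hpe hpe'
  have hxp : e p ∈ commonDomain ι e e' := by
    refine ⟨e.map_source hpe, ?_⟩
    rw [e.left_inv hpe]
    exact hpe'
  ext v
  -- The inverse trivialization of the tangent bundle is the differential of the inverse chart, so θ
  -- is evaluated on coordinate vectors.
  have h1 : ((trivializationAt (Coord 3) (TangentSpace 𝓘(ℝ, Coord 3)) p₀).symmL ℝ p :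
      Coord 3 →L[ℝ] Coord 3) v =
      tderiv 3 3 e.symm (e p) v := by
    rw [TangentBundle.symmL_trivializationAt hpe]
    simp only [mfld_simps, mfderivWithin_univ]
    rfl
  refine (DFunLike.congr_fun (Bundle.Trivial.continuousLinearMapAt_trivialization ℝ M ℝ p)
    (θ p (((trivializationAt (Coord 3) (TangentSpace 𝓘(ℝ, Coord 3)) p₀).symmL ℝ p :
      Coord 3 →L[ℝ] Coord 3) v))).trans ?_
  rw [ContinuousLinearMap.id_apply]
  rw [h1]
  have h2 : ∀ i, θ p (tderiv 3 3 e.symm (e p) (EuclideanSpace.single i 1)) = c e e' (e p) i := by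
    intro i
    have := key e (hm _) e' (hm' _) (e p) hxp i
    rwa [e.left_inv hpe] at this
  conv_lhs => rw [coord_eq_sum v]
  simp only [map_sum, map_smul, h2, _root_.sum_apply, _root_.smul_apply, smul_eq_mul]
  refine Finset.sum_congr rfl fun i _ => ?_
  rw [mul_comm]
  rfl

end OneForms

end HypersurfaceGeometry

end

/-! ### The theorem on manifolds. -/

open HypersurfaceGeometry in
theorem lemma3p10
    {X : Type*} [TopologicalSpace X] [ChartedSpace (Coord 4) X] [IsManifold 𝓘(ℝ, Coord 4) ∞ X]
    {M : Type*} [TopologicalSpace M] [ChartedSpace (Coord 3) M] [IsManifold 𝓘(ℝ, Coord 3) ∞ M]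
    (g : Bundle.ContMDiffRiemannianMetric 𝓘(ℝ, Coord 4) ∞ (Coord 4)
      (fun q : X => TangentSpace 𝓘(ℝ, Coord 4) q))
    (ι : M → X) (hι : Manifold.IsSmoothEmbedding 𝓘(ℝ, Coord 3) 𝓘(ℝ, Coord 4) ∞ ι)
    (N : (p : M) → TangentSpace 𝓘(ℝ, Coord 4) (ι p)) (hN : IsUnitNormalField g ι N) :
    -- the identity, at every point, in every pair of charts
    (∀ e ∈ IsManifold.maximalAtlas 𝓘(ℝ, Coord 3) ∞ M,
      ∀ e' ∈ IsManifold.maximalAtlas 𝓘(ℝ, Coord 4) ∞ X,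
      ∀ x ∈ commonDomain ι e e',
        (localHypersurface g ι N e e').lhs x =
          (localHypersurface g ι N e e').rhs₁ x + (localHypersurface g ι N e e').rhs₂ x) ∧
    -- both sides are total divergences
    (∃ γ α β : OneForm 3 M,
      ∀ e ∈ IsManifold.maximalAtlas 𝓘(ℝ, Coord 3) ∞ M,
      ∀ e' ∈ IsManifold.maximalAtlas 𝓘(ℝ, Coord 4) ∞ X,
      ∀ x ∈ commonDomain ι e e',
        OneForm.inChart γ e x = (localHypersurface g ι N e e').formLhs x ∧
        OneForm.inChart α e x = (localHypersurface g ι N e e').formRhs₁ x ∧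
        OneForm.inChart β e x = (localHypersurface g ι N e e').formRhs₂ x ∧
        div1 (localHypersurface g ι N e e').h (OneForm.inChart γ e) x =
          (localHypersurface g ι N e e').lhs x ∧
        div1 (localHypersurface g ι N e e').h (OneForm.inChart α e) x =
          (localHypersurface g ι N e e').rhs₁ x ∧
        div1 (localHypersurface g ι N e e').h (OneForm.inChart β e) x =
          (localHypersurface g ι N e e').rhs₂ x) := by
  have hc := hι.contMDiff.continuous
  have hr := fun e he e' he' =>
    isRegularOn_localHypersurface (g := g) (e := e) (e' := e') hι hN he he'
  have hev : ∀ (e : OpenPartialHomeomorph M (Coord 3)) (e' : OpenPartialHomeomorph X (Coord 4)),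
      ∀ x ∈ commonDomain ι e e', commonDomain ι e e' ∈ nhds x := fun e e' x hx =>
    (isOpen_commonDomain hc e e').mem_nhds hx
  refine ⟨fun e he e' he' x hx => (hr e he e' he').lhs_eq hx, ?_⟩
  obtain ⟨γ, hγ⟩ := exists_oneForm hc (fun e e' => (localHypersurface g ι N e e').formLhs)
    (fun e he e' he' x hx i => (hr e he e' he').smooth_formLhs hx i)
    (fun e he e' he' e₂ he₂ e₂' he₂' x hx h₁ h₂ i =>
      (isTransition_localHypersurface hι hN he he' he₂ he₂').formLhs_eq ⟨hx, hx.1, h₁, h₂⟩ i)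
  obtain ⟨α, hα⟩ := exists_oneForm hc (fun e e' => (localHypersurface g ι N e e').formRhs₁)
    (fun e he e' he' x hx i => (hr e he e' he').smooth_formRhs₁ hx i)
    (fun e he e' he' e₂ he₂ e₂' he₂' x hx h₁ h₂ i =>
      (isTransition_localHypersurface hι hN he he' he₂ he₂').formRhs₁_eq ⟨hx, hx.1, h₁, h₂⟩ i)
  obtain ⟨β, hβ⟩ := exists_oneForm hc (fun e e' => (localHypersurface g ι N e e').formRhs₂)
    (fun e he e' he' x hx i => (hr e he e' he').smooth_formRhs₂ hx i)
    (fun e he e' he' e₂ he₂ e₂' he₂' x hx h₁ h₂ i =>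
      (isTransition_localHypersurface hι hN he he' he₂ he₂').formRhs₂_eq ⟨hx, hx.1, h₁, h₂⟩ i)
  refine ⟨γ, α, β, fun e he e' he' x hx =>
    ⟨hγ e he e' he' x hx, hα e he e' he' x hx, hβ e he e' he' x hx, ?_, ?_, ?_⟩⟩
  · rw [← (hr e he e' he').div1_formLhs hx]
    -- The components agree on an open set, hence near x, which is what a divergence at x requires.
    exact div1_congr (Filter.eventuallyEq_of_mem (hev e e' x hx) (hγ e he e' he'))
  · rw [← (hr e he e' he').div1_formRhs₁ hx]
    exact div1_congr (Filter.eventuallyEq_of_mem (hev e e' x hx) (hα e he e' he'))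
  · rw [← (hr e he e' he').div1_formRhs₂ hx]
    exact div1_congr (Filter.eventuallyEq_of_mem (hev e e' x hx) (hβ e he e' he'))
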